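/- Let $p$ be a prime, let $R_p=\widehat{\mathbb Z}_p^{ur}=W(\overline{\mathbb F}_p)$ be the completion of the maximal unramified extension of $\mathbb Z_p$, let $\pi$ be a root of a monic Eisenstein polynomial of degree $e\ge 2$ over $\mathbb Z_p$, and let $R_\pi=R_p[\pi]=R_p\otimes_{\mathbb Z_p}\mathbb Z_p[\pi]$. Let $\phi$ be the lift of the $p$-power Frobenius to $R_p$, extended to $R_\pi$ by $\phi(\pi)=\pi$, and put $\delta_p x=(\phi(x)-x^p)/p$ on $R_p$ and $\delta_\pi x=(\phi(x)-x^p)/\pi$ on $R_\pi$. For $\varpi\in\{p,\pi\}$, a $\delta_\varpi$-prolongation sequence (over $R_\varpi$) is a sequence $S^*=(S^n)_{n\ge 0}$ of $R_\varpi$-algebras with $R_\varpi$-algebra maps $\varphi:S^n\to S^{n+1}$ and maps $\delta_\varpi:S^n\to S^{n+1}$ that extend $\delta_\varpi$ on $R_\varpi$, commute with $\varphi$, and satisfy $\delta_\varpi(1)=0$ and $$\delta_\varpi(x+y)=\delta_\varpi x+\delta_\varpi y+\tfrac{p}{\varpi}C_p(x,y),\qquad \delta_\varpi(xy)=x^p\delta_\varpi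 y+y^p\delta_\varpi x+\varpi\,\delta_\varpi x\,\delta_\varpi y,$$ where $C_p(X,Y)=(X^p+Y^p-(X+Y)^p)/p$ (images under $\varphi$ being understood on the right-hand sides); a morphism is a sequence of $R_\varpi$-algebra maps commuting with $\varphi$ and $\delta_\varpi$. If $S^*$ is a $\delta_p$-prolongation sequence of flat $R_p$-algebras, then $S^*\otimes_{R_p}R_\pi$ is a $\delta_\pi$-prolongation sequence via $\phi(x\otimes y)=\phi(x)\otimes\phi(y)$ and $\delta_\pi z=(\phi(z)-z^p)/\pi$, where $\phi(x)=x^p+p\,\delta_p x$ on $S^*$. For an affine scheme $Y=\mathrm{Spec}\,A$ of finite type over $R_\varpi$ let $A^*$ be the universal $\delta_\varpi$-prolongation sequence with $A^0=A$, and let $\mathcal O(J^n_\varpi(Y))$ be the $p$-adic completion of $A^n$; these again form a $\delta_\varpi$-prolongation sequence. For a scheme $Y$ locally of finite type over $R_\varpi$ let $\mathcal O(J^n_\varpi(Y))$ be the ring of global functions on the formal scheme $J^n_\varpi(Y)$ glued from the formal schemes $\mathrm{Spf}\,\mathcal O(J^n_\varpi(V))$, $V\subset Y$ affine open, i.e.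 the ring of compatible families of elements of the rings $\mathcal O(J^n_\varpi(V))$. Let $X$ be a smooth scheme over $R_p$ and $X_{R_\pi}=X\otimes_{R_p}R_\pi$. The rings $\mathcal O(J^n_p(X))$, and $\mathcal O(J^n_p(U))$ for $U\subset X$ affine open, are flat over $R_p$. For each affine open $U\subset X$ there is a unique morphism of $\delta_\pi$-prolongation sequences $\mathcal O(J^n_\pi(U_{R_\pi}))\to\mathcal O(J^n_p(U))\otimes_{R_p}R_\pi$, $n\ge 0$, which sends (the pull-back of) each $a\in\mathcal O(U)$ to $a\otimes 1$ for $n=0$; and there is a unique morphism of $\delta_\pi$-prolongation sequences $$\mathcal O(J^n_\pi(X_{R_\pi}))\longrightarrow \mathcal O(J^n_p(X))\otimes_{R_p}R_\pi ,\qquad n\ge 0,$$ that is compatible with these under restriction to all affine opens $U\subset X$. This canonical morphism is injective for every $n\ge 0$. On the other hand, if $X$ is affine and its special fibre $X\otimes_{R_p}\overline{\mathbb F}_p$ has positive Krull dimension, then for every $n\ge 1$ this map is not surjective and its reduction modulo $p$ is not injective. -/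

import Mathlib

open CategoryTheory AlgebraicGeometry TensorProduct Polynomial

noncomputable section

namespace ArithJet

/-- The value at `(x, y)` of the integral polynomial `(X ^ p + Y ^ p - (X + Y) ^ p) / p`. -/
def carry (p : ℕ) {B : Type} [CommRing B] (x y : B) : B :=
  -∑ i ∈ Finset.Ioo 0 p, ((p.choose i / p : ℕ) : B) * x ^ i * y ^ (p - i)

section Carry

variable {p : ℕ} {B C : Type} [CommRing B] [CommRing C]

theorem mul_carry [hp : Fact p.Prime] (x y : B) :
    (p : B) * carry p x y = x ^ p + y ^ p - (x + y) ^ p := by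
  have hp0 : 0 < p := hp.out.pos
  have h : (x + y) ^ p = y ^ p + x ^ p
      + ∑ i ∈ Finset.Ioo 0 p, x ^ i * y ^ (p - i) * (p.choose i : B) := by
    rw [add_pow, Finset.range_eq_Ico, Finset.sum_Ico_succ_top (Nat.zero_le p),
      ← Finset.sum_Ioo_add_eq_sum_Ico hp0]
    simp
    ring
  rw [h, carry, mul_neg, Finset.mul_sum]
  have : ∀ i ∈ Finset.Ioo 0 p, (p : B) * (((p.choose i / p : ℕ) : B) * x ^ i * y ^ (p - i))
      = x ^ i * y ^ (p - i) * (p.choose i : B) := by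
    intro i hi
    rw [Finset.mem_Ioo] at hi
    have hd := hp.out.dvd_choose_self hi.1.ne' hi.2
    have : (p.choose i : B) = (p : B) * ((p.choose i / p : ℕ) : B) := by
      rw [← Nat.cast_mul, Nat.mul_div_cancel' hd]
    rw [this]; ring
  rw [Finset.sum_congr rfl this]
  ring

theorem map_carry (f : B →+* C) (x y : B) : f (carry p x y) = carry p (f x) (f y) := by
  simp [carry]

theorem carry_mem (I : Ideal B) (x : B) {y : B} (hy : y ∈ I) : carry p x y ∈ I := by
  refine I.neg_mem (I.sum_mem fun i hi => I.mul_mem_left _ (I.pow_mem_of_mem hy _ ?_))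
  rw [Finset.mem_Ioo] at hi
  omega

end Carry

/-- A base ring for arithmetic differentiation: a ring `R`, a non-zero-divisor `unif` dividing `p`,
with `ratio = p / unif`, and a ring endomorphism `frob` lifting the `p`-power map modulo `unif`. -/
structure FrobeniusBase (p : ℕ) (R : Type) [CommRing R] where
  unif : R
  ratio : R
  ratio_mul_unif : ratio * unif = p
  unif_mem : unif ∈ nonZeroDivisors R
  frob : R →+* R
  unif_dvd : ∀ x, unif ∣ frob x - x ^ p

/-- The Fermat quotient `δ x = (φ x - x ^ p) / unif` on the base ring. -/
def FrobeniusBase.δ {p : ℕ} {R : Type} [CommRing R] (D : FrobeniusBase p R) (x : R) : R :=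
  (D.unif_dvd x).choose

theorem FrobeniusBase.unif_mul_δ {p : ℕ} {R : Type} [CommRing R] (D : FrobeniusBase p R) (x : R) :
    D.unif * D.δ x = D.frob x - x ^ p :=
  (D.unif_dvd x).choose_spec.symm

/-- Prolongation sequences over the base `D`: a sequence of `R`-algebras `obj n`, with
`R`-algebra maps `incl : obj n → obj (n + 1)` and `unif`-derivations `δ : obj n → obj (n + 1)`
commuting with them, and extending the Fermat quotient of the base. -/
structure Prolongation {p : ℕ} {R : Type} [CommRing R] (D : FrobeniusBase p R) where
  obj : ℕ → Type
  [ring : ∀ n, CommRing (obj n)]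
  [alg : ∀ n, Algebra R (obj n)]
  incl : ∀ n, obj n →ₐ[R] obj (n + 1)
  δ : ∀ n, obj n → obj (n + 1)
  δ_one : ∀ n, δ n 1 = 0
  δ_add : ∀ n x y, δ n (x + y) =
    δ n x + δ n y + algebraMap R (obj (n + 1)) D.ratio * carry p (incl n x) (incl n y)
  δ_mul : ∀ n x y, δ n (x * y) = incl n x ^ p * δ n y + incl n y ^ p * δ n x
    + algebraMap R (obj (n + 1)) D.unif * δ n x * δ n y
  δ_algebraMap : ∀ n r, δ n (algebraMap R (obj n) r) = algebraMap R (obj (n + 1)) (D.δ r)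
  δ_incl : ∀ n x, δ (n + 1) (incl n x) = incl (n + 1) (δ n x)

attribute [instance] Prolongation.ring Prolongation.alg

namespace Prolongation

variable {p : ℕ} {R : Type} [CommRing R] {D : FrobeniusBase p R}

/-- Morphisms of prolongation sequences over the base. -/
@[ext]
structure Hom (S T : Prolongation D) where
  hom : ∀ n, S.obj n →ₐ[R] T.obj n
  hom_incl : ∀ n x, hom (n + 1) (S.incl n x) = T.incl n (hom n x)
  hom_δ : ∀ n x, hom (n + 1) (S.δ n x) = T.δ n (hom n x)

theorem unif_dvd_p (S : Type) [CommRing S] [Algebra R S] :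
    algebraMap R S D.ratio * algebraMap R S D.unif = p := by
  rw [← map_mul, D.ratio_mul_unif, map_natCast]

theorem unif_mul_ratio_mul_carry [Fact p.Prime] {S : Type} [CommRing S] [Algebra R S] (x y : S) :
    algebraMap R S D.unif * (algebraMap R S D.ratio * carry p x y) =
      x ^ p + y ^ p - (x + y) ^ p := by
  rw [← mul_carry, ← unif_dvd_p (D := D)]; ring

theorem δ_zero [Fact p.Prime] (S : Prolongation D) (n : ℕ) : S.δ n 0 = 0 := by
  have h : D.δ 0 = 0 := by
    have := D.unif_mul_δ 0
    rw [map_zero, zero_pow (Fact.out : p.Prime).ne_zero, sub_zero, mul_comm] at this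
    exact (mem_nonZeroDivisors_iff_right.mp D.unif_mem) _ this
  rw [← map_zero (algebraMap R _), S.δ_algebraMap, h, map_zero]

/-- The lift of Frobenius `φ x = x ^ p + unif * δ x` of a prolongation sequence. -/
def frob [Fact p.Prime] (S : Prolongation D) (n : ℕ) : S.obj n →+* S.obj (n + 1) where
  toFun x := S.incl n x ^ p + algebraMap R _ D.unif * S.δ n x
  map_one' := by simp [S.δ_one]
  map_zero' := by
    have hp : p ≠ 0 := (Fact.out : p.Prime).ne_zero
    simp [S.δ_zero, hp]
  map_add' x y := by
    rw [S.δ_add, mul_add, unif_mul_ratio_mul_carry, map_add]; ring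
  map_mul' x y := by
    rw [S.δ_mul, map_mul]; ring

theorem frob_algebraMap [Fact p.Prime] (S : Prolongation D) (n : ℕ) (r : R) :
    S.frob n (algebraMap R _ r) = algebraMap R _ (D.frob r) := by
  change S.incl n _ ^ p + algebraMap R _ D.unif * S.δ n _ = _
  rw [S.δ_algebraMap, ← map_mul, D.unif_mul_δ, AlgHom.commutes, map_sub, map_pow]
  ring

theorem frob_incl [Fact p.Prime] (S : Prolongation D) (n : ℕ) (x : S.obj n) :
    S.frob (n + 1) (S.incl n x) = S.incl (n + 1) (S.frob n x) := by
  change S.incl _ _ ^ p + algebraMap R _ D.unif * S.δ _ _ =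
    S.incl _ (S.incl n _ ^ p + algebraMap R _ D.unif * S.δ n _)
  rw [S.δ_incl, map_add, map_mul, map_pow, AlgHom.commutes]

/-- On a sequence of algebras without `unif`-torsion, compatible ring homomorphisms `φ` with
`φ x ≡ x ^ p` modulo `unif` define a prolongation sequence by `δ x = (φ x - x ^ p) / unif`. -/
def ofFrobenius [Fact p.Prime] (S : ℕ → Type) [∀ n, CommRing (S n)] [∀ n, Algebra R (S n)]
    (incl : ∀ n, S n →ₐ[R] S (n + 1)) (φ : ∀ n, S n →+* S (n + 1))
    (hreg : ∀ n, algebraMap R (S n) D.unif ∈ nonZeroDivisors (S n))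
    (hbase : ∀ n r, φ n (algebraMap R (S n) r) = algebraMap R (S (n + 1)) (D.frob r))
    (hincl : ∀ n x, φ (n + 1) (incl n x) = incl (n + 1) (φ n x))
    (d : ∀ n, S n → S (n + 1))
    (hd : ∀ n x, algebraMap R (S (n + 1)) D.unif * d n x = φ n x - incl n x ^ p) :
    Prolongation D :=
  have cancel : ∀ n (a b : S n),
      algebraMap R (S n) D.unif * a = algebraMap R (S n) D.unif * b → a = b := fun n a b h =>
    (mul_cancel_left_mem_nonZeroDivisors (hreg n)).mp h
  { obj := S
    incl := incl
    δ := d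
    δ_one := fun n => cancel _ _ _ (by rw [hd]; simp)
    δ_add := fun n x y => cancel _ _ _ (by
      rw [mul_add, mul_add, unif_mul_ratio_mul_carry, hd, hd, hd, map_add, map_add]; ring)
    δ_mul := fun n x y => cancel _ _ _ (by
      rw [hd, map_mul, map_mul, eq_add_of_sub_eq (hd n x).symm, eq_add_of_sub_eq (hd n y).symm]
      ring)
    δ_algebraMap := fun n r => cancel _ _ _ (by
      rw [hd, hbase, ← map_mul, D.unif_mul_δ, AlgHom.commutes, map_sub, map_pow])
    δ_incl := fun n x => cancel _ _ _ (by
      rw [hd, hincl, ← map_pow, ← map_sub, ← hd, map_mul, AlgHom.commutes]) }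

/-- The quotient of a prolongation sequence by a sequence of ideals stable under `incl` and `δ`. -/
def quot (S : Prolongation D) (I : ∀ n, Ideal (S.obj n))
    (hincl : ∀ n, ∀ x ∈ I n, S.incl n x ∈ I (n + 1))
    (hδ : ∀ n, ∀ x ∈ I n, S.δ n x ∈ I (n + 1)) : Prolongation D where
  obj n := S.obj n ⧸ I n
  incl n := Ideal.quotientMapₐ (I (n + 1)) (S.incl n) (hincl n)
  δ n := Quotient.lift (fun x => Ideal.Quotient.mk (I (n + 1)) (S.δ n x)) (by
    intro x y hxy
    have hxy' : x - y ∈ I n := (Submodule.quotientRel_def (I n)).mp hxy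
    have hx : x = y + (x - y) := by ring
    refine Ideal.Quotient.eq.mpr ?_
    rw [hx, S.δ_add]
    have h := (I (n + 1)).add_mem (hδ n _ hxy') ((I (n + 1)).mul_mem_left
      (algebraMap R _ D.ratio) (carry_mem (p := p) _ (S.incl n y) (hincl n _ hxy')))
    convert h using 1
    ring)
  δ_one n := by
    change Ideal.Quotient.mk _ (S.δ n 1) = 0
    rw [S.δ_one, map_zero]
  δ_add n x y := by
    obtain ⟨x, rfl⟩ := Ideal.Quotient.mk_surjective x
    obtain ⟨y, rfl⟩ := Ideal.Quotient.mk_surjective y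
    change Ideal.Quotient.mk _ (S.δ n (x + y)) = _
    rw [S.δ_add, map_add, map_add, map_mul, map_carry]
    rfl
  δ_mul n x y := by
    obtain ⟨x, rfl⟩ := Ideal.Quotient.mk_surjective x
    obtain ⟨y, rfl⟩ := Ideal.Quotient.mk_surjective y
    change Ideal.Quotient.mk _ (S.δ n (x * y)) = _
    rw [S.δ_mul]
    simp only [map_add, map_mul, map_pow]
    rfl
  δ_algebraMap n r := by
    change Ideal.Quotient.mk _ (S.δ n (algebraMap R _ r)) = _
    rw [S.δ_algebraMap]
    rfl
  δ_incl n x := by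
    obtain ⟨x, rfl⟩ := Ideal.Quotient.mk_surjective x
    change Ideal.Quotient.mk _ (S.δ (n + 1) (S.incl n x)) = _
    rw [S.δ_incl]
    rfl

/-- The limit of a family of prolongation sequences indexed by a preorder: the compatible
families, with componentwise operations. -/
def limit {J : Type} [Preorder J] (S : J → Prolongation D)
    (res : ∀ i j : J, i ≤ j → Hom (S j) (S i)) : Prolongation D where
  obj n := ({ carrier := {x | ∀ i j (h : i ≤ j), (res i j h).hom n (x j) = x i}
              mul_mem' := fun ha hb i j h => by simp [ha i j h, hb i j h]
              add_mem' := fun ha hb i j h => by simp [ha i j h, hb i j h]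
              algebraMap_mem' := fun r i j h => by simp } : Subalgebra R (∀ j, (S j).obj n))
  incl n :=
    { toFun := fun x => ⟨fun j => (S j).incl n (x.1 j), fun i j h => by
        rw [(res i j h).hom_incl, x.2 i j h]⟩
      map_one' := Subtype.ext (funext fun j => map_one _)
      map_mul' := fun x y => Subtype.ext (funext fun j => map_mul _ _ _)
      map_zero' := Subtype.ext (funext fun j => map_zero _)
      map_add' := fun x y => Subtype.ext (funext fun j => map_add _ _ _)
      commutes' := fun r => Subtype.ext (funext fun j => AlgHom.commutes _ _) }
  δ n x := ⟨fun j => (S j).δ n (x.1 j), fun i j h => by rw [(res i j h).hom_δ, x.2 i j h]⟩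
  δ_one n := Subtype.ext (funext fun j => (S j).δ_one n)
  δ_add n x y := by
    refine Subtype.ext (funext fun j => ((S j).δ_add n _ _).trans ?_)
    simp only [carry]
    simp
  δ_mul n x y := Subtype.ext (funext fun j => (S j).δ_mul n _ _)
  δ_algebraMap n r := Subtype.ext (funext fun j => (S j).δ_algebraMap n r)
  δ_incl n x := Subtype.ext (funext fun j => (S j).δ_incl n _)

/-- The projections of a limit. -/
def limitProj {J : Type} [Preorder J] (S : J → Prolongation D)
    (res : ∀ i j : J, i ≤ j → Hom (S j) (S i)) (j : J) : Hom (limit S res) (S j) where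
  hom n := (Pi.evalAlgHom R (fun j => (S j).obj n) j).comp (Subalgebra.val _)
  hom_incl _ _ := rfl
  hom_δ _ _ := rfl

/-- The quotient map on prolongation sequences induced by a morphism. -/
def quotMap {S T : Prolongation D} (f : Hom S T) (I : ∀ n, Ideal (S.obj n))
    (J : ∀ n, Ideal (T.obj n)) (hI hI' hJ hJ')
    (h : ∀ n, ∀ x ∈ I n, f.hom n x ∈ J n) : Hom (S.quot I hI hI') (T.quot J hJ hJ') where
  hom n := Ideal.quotientMapₐ (J n) (f.hom n) (h n)
  hom_incl n x := by
    obtain ⟨x, rfl⟩ := Ideal.Quotient.mk_surjective x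
    exact congrArg (Ideal.Quotient.mk (J (n + 1))) (f.hom_incl n x)
  hom_δ n x := by
    obtain ⟨x, rfl⟩ := Ideal.Quotient.mk_surjective x
    exact congrArg (Ideal.Quotient.mk (J (n + 1))) (f.hom_δ n x)

section Completion

/-- The `p`-adic completion of a ring. -/
abbrev Compl (p : ℕ) (A : Type) [CommRing A] : Type :=
  AdicCompletion (Ideal.span {(p : A)}) A

theorem complMap_le {A B : Type} [CommRing A] [CommRing B] (p m : ℕ) (f : A →+* B) :
    Ideal.span {(p : A)} ^ m ≤ (Ideal.span {(p : B)} ^ m).comap f := by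
  rw [Ideal.span_singleton_pow, Ideal.span_le, Set.singleton_subset_iff]
  simp only [SetLike.mem_coe, Ideal.mem_comap, map_pow, map_natCast]
  exact Ideal.pow_mem_pow (Ideal.mem_span_singleton_self _) m

/-- The projection from the `p`-adic completion of `A` to `A / p ^ m`. -/
def complEval (p m : ℕ) (A : Type) [CommRing A] :
    Compl p A →+* A ⧸ Ideal.span {(p : A)} ^ m :=
  (AdicCompletion.evalₐ (Ideal.span {(p : A)}) m).toRingHom

theorem compl_ext {p : ℕ} {A : Type} [CommRing A] {x y : Compl p A}
    (h : ∀ m, complEval p m A x = complEval p m A y) : x = y :=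
  AdicCompletion.ext_evalₐ h

theorem complEval_algebraMap {p : ℕ} {A : Type} [CommRing A] [Algebra R A] (m : ℕ) (r : R) :
    complEval p m A (algebraMap R (Compl p A) r) = Ideal.Quotient.mk _ (algebraMap R A r) :=
  AdicCompletion.evalₐ_of _ m _

theorem compl_exists_rep {p : ℕ} {A : Type} [CommRing A] (x : Compl p A) (m : ℕ) :
    ∃ a : A, ∀ k ≤ m, complEval p k A x = Ideal.Quotient.mk _ a := by
  obtain ⟨s, rfl⟩ := AdicCompletion.mk_surjective _ _ x
  refine ⟨s m, fun k hk => (AdicCompletion.evalₐ_mk _ k s).trans ?_⟩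
  exact AdicCompletion.Ideal.mk_eq_mk _ hk s |>.symm

theorem complMap_compat {A B : Type} [CommRing A] [CommRing B] (p : ℕ) (f : A →+* B)
    {m n : ℕ} (hmn : m ≤ n) :
    (Ideal.Quotient.factorPow (Ideal.span {(p : B)}) hmn).comp
      ((Ideal.quotientMap (Ideal.span {(p : B)} ^ n) f (complMap_le p n f)).comp
        (complEval p n A)) =
      (Ideal.quotientMap (Ideal.span {(p : B)} ^ m) f (complMap_le p m f)).comp
        (complEval p m A) := by
  ext x
  obtain ⟨a, ha⟩ := compl_exists_rep x n
  simp only [RingHom.comp_apply, ha n le_rfl, ha m hmn]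
  simp

/-- The map of `p`-adic completions induced by an algebra homomorphism. -/
def complMap {A B : Type} [CommRing A] [CommRing B] [Algebra R A] [Algebra R B] (p : ℕ)
    (f : A →ₐ[R] B) : Compl p A →ₐ[R] Compl p B where
  toRingHom := AdicCompletion.liftRingHom _
    (fun m => (Ideal.quotientMap (Ideal.span {(p : B)} ^ m) f.toRingHom
      (complMap_le p m f.toRingHom)).comp (complEval p m A)) (complMap_compat p f.toRingHom)
  commutes' r := by
    refine compl_ext fun m => ?_
    rw [complEval_algebraMap]
    refine (AdicCompletion.evalₐ_liftRingHom _ _ _ m _).trans ?_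
    rw [RingHom.comp_apply, complEval_algebraMap]
    simp

theorem complEval_complMap {A B : Type} [CommRing A] [CommRing B] [Algebra R A] [Algebra R B]
    {p : ℕ} (f : A →ₐ[R] B) (m : ℕ) {x : Compl p A} {a : A}
    (h : complEval p m A x = Ideal.Quotient.mk _ a) :
    complEval p m B (complMap p f x) = Ideal.Quotient.mk _ (f a) := by
  refine (AdicCompletion.evalₐ_liftRingHom _ _ (complMap_compat p f.toRingHom) m x).trans ?_
  rw [RingHom.comp_apply, h]
  simp

theorem pow_dvd_baseδ [hp : Fact p.Prime] (m : ℕ) :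
    (p : R) ^ m ∣ D.δ ((p : R) ^ (m + 1)) := by
  refine ⟨D.ratio * (1 - (p : R) ^ ((m + 1) * p - (m + 1))), ?_⟩
  refine (mul_cancel_left_mem_nonZeroDivisors D.unif_mem).mp ?_
  have h1 : (m + 1) ≤ (m + 1) * p := Nat.le_mul_of_pos_right _ hp.out.pos
  have h2 : (p : R) ^ ((m + 1) * p) = (p : R) ^ (m + 1) * (p : R) ^ ((m + 1) * p - (m + 1)) := by
    rw [← pow_add, Nat.add_sub_cancel' h1]
  rw [D.unif_mul_δ, map_pow, map_natCast, ← pow_mul, h2, pow_succ]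
  conv_lhs => rw [← D.ratio_mul_unif]
  rw [← D.ratio_mul_unif]
  ring

theorem δ_congr [hp : Fact p.Prime] (S : Prolongation D) (n m : ℕ) {x y : S.obj n}
    (h : x - y ∈ Ideal.span {(p : S.obj n)} ^ (m + 1)) :
    S.δ n x - S.δ n y ∈ Ideal.span {(p : S.obj (n + 1))} ^ m := by
  have h0 := complMap_le p (m + 1) (S.incl n).toRingHom h
  have hle : Ideal.span {(p : S.obj (n + 1))} ^ (m + 1) ≤ Ideal.span {(p : S.obj (n + 1))} ^ m :=
    Ideal.pow_le_pow_right (Nat.le_succ m)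
  have hx : x = y + (x - y) := by ring
  have h1 : S.δ n (x - y) ∈ Ideal.span {(p : S.obj (n + 1))} ^ m := by
    rw [Ideal.span_singleton_pow, Ideal.mem_span_singleton] at h
    obtain ⟨z, hz⟩ := h
    rw [hz, S.δ_mul, Ideal.span_singleton_pow, Ideal.mem_span_singleton]
    have e1 : (p : S.obj n) ^ (m + 1) = algebraMap R _ ((p : R) ^ (m + 1)) := by simp
    have e2 : (p : S.obj (n + 1)) ^ m ∣ S.δ n ((p : S.obj n) ^ (m + 1)) := by
      rw [e1, S.δ_algebraMap]
      simpa using map_dvd (algebraMap R (S.obj (n + 1))) (pow_dvd_baseδ (D := D) m)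
    have e3 : (p : S.obj (n + 1)) ^ m ∣ S.incl n ((p : S.obj n) ^ (m + 1)) ^ p := by
      rw [map_pow, map_natCast, ← pow_mul]
      exact pow_dvd_pow _ ((Nat.le_succ m).trans (Nat.le_mul_of_pos_right _ hp.out.pos))
    exact dvd_add (dvd_add (e3.mul_right _) (e2.mul_left _))
      ((e2.mul_left _).mul_right _)
  have h2 := (Ideal.span {(p : S.obj (n + 1))} ^ m).add_mem h1
    ((Ideal.span {(p : S.obj (n + 1))} ^ m).mul_mem_left (algebraMap R _ D.ratio)
      (carry_mem (p := p) _ (S.incl n y) (hle h0)))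
  rw [hx, S.δ_add]
  convert h2 using 1
  simp
  ring

/-- The continuous extension of `δ` to the `p`-adic completions. -/
def complδ [Fact p.Prime] (S : Prolongation D) (n : ℕ) (x : Compl p (S.obj n)) :
    Compl p (S.obj (n + 1)) :=
  AdicCompletion.mk _ _ ⟨fun m => S.δ n (compl_exists_rep x (m + 1)).choose, by
    intro m k hmk
    rw [SModEq.sub_mem, smul_eq_mul, Ideal.mul_top]
    refine δ_congr S n m ?_
    rw [← Ideal.Quotient.eq]
    exact ((compl_exists_rep x (m + 1)).choose_spec _ le_rfl).symm.trans
      ((compl_exists_rep x (k + 1)).choose_spec _ (Nat.succ_le_succ hmk))⟩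

theorem complEval_complδ [Fact p.Prime] (S : Prolongation D) (n m : ℕ) {x : Compl p (S.obj n)}
    {a : S.obj n} (h : complEval p (m + 1) _ x = Ideal.Quotient.mk _ a) :
    complEval p m _ (complδ S n x) = Ideal.Quotient.mk _ (S.δ n a) := by
  refine (AdicCompletion.evalₐ_mk _ m _).trans (Ideal.Quotient.eq.mpr (δ_congr S n m ?_))
  rw [← Ideal.Quotient.eq]
  exact ((compl_exists_rep x (m + 1)).choose_spec _ le_rfl).symm.trans h

/-- The `p`-adic completion of a prolongation sequence. -/
def completion [Fact p.Prime] (S : Prolongation D) : Prolongation D where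
  obj n := Compl p (S.obj n)
  incl n := complMap p (S.incl n)
  δ n := complδ S n
  δ_one n := compl_ext fun m => by
    rw [complEval_complδ S n m (a := 1) (map_one _), S.δ_one, map_zero, map_zero]
  δ_add n x y := compl_ext fun m => by
    obtain ⟨a, ha⟩ := compl_exists_rep x (m + 1)
    obtain ⟨b, hb⟩ := compl_exists_rep y (m + 1)
    rw [complEval_complδ S n m (a := a + b) (by rw [map_add, ha _ le_rfl, hb _ le_rfl, map_add]),
      S.δ_add, map_add, map_add, map_mul, map_add, map_add, map_mul, map_carry, map_carry,
      complEval_complδ S n m (ha _ le_rfl), complEval_complδ S n m (hb _ le_rfl),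
      complEval_complMap _ m (ha _ (Nat.le_succ m)), complEval_complMap _ m (hb _ (Nat.le_succ m)),
      complEval_algebraMap]
  δ_mul n x y := compl_ext fun m => by
    obtain ⟨a, ha⟩ := compl_exists_rep x (m + 1)
    obtain ⟨b, hb⟩ := compl_exists_rep y (m + 1)
    rw [complEval_complδ S n m (a := a * b) (by rw [map_mul, ha _ le_rfl, hb _ le_rfl, map_mul]),
      S.δ_mul]
    simp only [map_add, map_mul, map_pow]
    rw [complEval_complδ S n m (ha _ le_rfl), complEval_complδ S n m (hb _ le_rfl),
      complEval_complMap _ m (ha _ (Nat.le_succ m)), complEval_complMap _ m (hb _ (Nat.le_succ m)),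
      complEval_algebraMap]
  δ_algebraMap n r := compl_ext fun m => by
    rw [complEval_complδ S n m (complEval_algebraMap _ r), S.δ_algebraMap, complEval_algebraMap]
  δ_incl n x := compl_ext fun m => by
    obtain ⟨a, ha⟩ := compl_exists_rep x (m + 1)
    rw [complEval_complδ S _ m (complEval_complMap _ _ (ha _ le_rfl)),
      complEval_complMap _ m (complEval_complδ S n m (ha _ le_rfl)), S.δ_incl]

/-- The morphism of `p`-adic completions induced by a morphism of prolongation sequences. -/
def completionMap [Fact p.Prime] {S T : Prolongation D} (f : Hom S T) :
    Hom S.completion T.completion where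
  hom n := complMap p (f.hom n)
  hom_incl n x := compl_ext fun m => by
    obtain ⟨a, ha⟩ := compl_exists_rep x m
    exact (complEval_complMap _ m (complEval_complMap _ m (ha _ le_rfl))).trans
      (Eq.trans (by rw [f.hom_incl])
        (complEval_complMap _ m (complEval_complMap _ m (ha _ le_rfl))).symm)
  hom_δ n x := compl_ext fun m => by
    obtain ⟨a, ha⟩ := compl_exists_rep x (m + 1)
    exact (complEval_complMap _ m (complEval_complδ S n m (ha _ le_rfl))).trans
      (Eq.trans (by rw [f.hom_δ])
        (complEval_complδ T n m (complEval_complMap _ _ (ha _ le_rfl))).symm)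

end Completion
section BaseChange

variable {R' : Type} [CommRing R'] [Algebra R R']

/-- The tensor product of the lifts of Frobenius of a base and of a prolongation sequence. -/
def tensorFrob [Fact p.Prime] (D' : FrobeniusBase p R')
    (hφ : ∀ r, D'.frob (algebraMap R R' r) = algebraMap R R' (D.frob r))
    (S : Prolongation D) (n : ℕ) : R' ⊗[R] S.obj n →+* R' ⊗[R] S.obj (n + 1) :=
  Algebra.TensorProduct.mapRingHom D.frob D'.frob (S.frob n)
    (RingHom.ext hφ) (RingHom.ext fun r => S.frob_algebraMap n r)

theorem tensorFrob_dvd [hp : Fact p.Prime] (D' : FrobeniusBase p R')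
    (hφ : ∀ r, D'.frob (algebraMap R R' r) = algebraMap R R' (D.frob r))
    (hu : D'.unif ∣ algebraMap R R' D.unif) (S : Prolongation D) (n : ℕ) (z : R' ⊗[R] S.obj n) :
    algebraMap R' (R' ⊗[R] S.obj (n + 1)) D'.unif ∣
      tensorFrob D' hφ S n z - Algebra.TensorProduct.map (AlgHom.id R' R') (S.incl n) z ^ p := by
  induction z with
  | zero => simp [hp.out.ne_zero]
  | add z w hz hw =>
    have h : algebraMap R' (R' ⊗[R] S.obj (n + 1)) D'.unif ∣ (p : R' ⊗[R] S.obj (n + 1)) :=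
      Dvd.intro_left _ (unif_dvd_p (D := D') (R' ⊗[R] S.obj (n + 1)))
    have e := mul_carry (p := p) (Algebra.TensorProduct.map (AlgHom.id R' R') (S.incl n) z)
      (Algebra.TensorProduct.map (AlgHom.id R' R') (S.incl n) w)
    have := dvd_add (dvd_add hz hw) (h.mul_right
      (carry p (Algebra.TensorProduct.map (AlgHom.id R' R') (S.incl n) z)
        (Algebra.TensorProduct.map (AlgHom.id R' R') (S.incl n) w)))
    rw [e] at this
    convert this using 1
    rw [map_add, map_add]
    ring
  | tmul y x =>
    obtain ⟨u, hu⟩ := hu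
    refine ⟨D'.δ y ⊗ₜ S.frob n x + (u * y ^ p) ⊗ₜ S.δ n x, ?_⟩
    have h1 : tensorFrob D' hφ S n (y ⊗ₜ x) = D'.frob y ⊗ₜ S.frob n x :=
      Algebra.TensorProduct.mapRingHom_tmul ..
    rw [h1, Algebra.TensorProduct.map_tmul, Algebra.TensorProduct.tmul_pow,
      Algebra.TensorProduct.algebraMap_apply, mul_add, Algebra.TensorProduct.tmul_mul_tmul,
      Algebra.TensorProduct.tmul_mul_tmul, one_mul, one_mul, Algebra.algebraMap_self_apply,
      D'.unif_mul_δ, ← mul_assoc, ← hu, ← Algebra.smul_def, TensorProduct.smul_tmul,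
      TensorProduct.sub_tmul]
    have h2 : D.unif • S.δ n x = S.frob n x - S.incl n x ^ p := by
      rw [Algebra.smul_def]
      change _ = (S.incl n x ^ p + algebraMap R _ D.unif * S.δ n x) - S.incl n x ^ p
      ring
    rw [h2, TensorProduct.tmul_sub]
    simp

/-- The base change of a prolongation sequence of flat algebras along an extension `R → R'` of
base rings: `φ` is extended by `φ (y ⊗ x) = φ y ⊗ φ x`, and `δ z = (φ z - z ^ p) / unif`. -/
def baseChange [Fact p.Prime] (D' : FrobeniusBase p R')
    (hφ : ∀ r, D'.frob (algebraMap R R' r) = algebraMap R R' (D.frob r))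
    (hu : D'.unif ∣ algebraMap R R' D.unif)
    (S : Prolongation D) (hS : ∀ n, Module.Flat R (S.obj n)) : Prolongation D' :=
  ofFrobenius (D := D') (fun n => R' ⊗[R] S.obj n)
    (fun n => Algebra.TensorProduct.map (AlgHom.id R' R') (S.incl n))
    (tensorFrob D' hφ S)
    (fun n => by
      have := hS n
      have h : IsSMulRegular (R' ⊗[R] S.obj n) D'.unif :=
        Module.Flat.isSMulRegular_of_nonZeroDivisors D'.unif_mem
      rw [mem_nonZeroDivisors_iff_right]
      intro z hz
      refine h ?_
      change D'.unif • z = D'.unif • (0 : R' ⊗[R] S.obj n)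
      rw [smul_zero, Algebra.smul_def, mul_comm, hz])
    (fun n r => by
      simp only [Algebra.TensorProduct.algebraMap_apply, Algebra.algebraMap_self_apply]
      refine (Algebra.TensorProduct.mapRingHom_tmul ..).trans ?_
      rw [map_one])
    (fun n z => by
      induction z with
      | zero => simp
      | add z w hz hw => simp only [map_add, hz, hw]
      | tmul y x =>
        rw [Algebra.TensorProduct.map_tmul]
        refine (Algebra.TensorProduct.mapRingHom_tmul ..).trans ?_
        refine Eq.trans ?_ (congrArg _ (Algebra.TensorProduct.mapRingHom_tmul ..).symm)
        rw [Algebra.TensorProduct.map_tmul, S.frob_incl]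
        rfl)
    (fun n z => (tensorFrob_dvd D' hφ hu S n z).choose)
    (fun n z => (tensorFrob_dvd D' hφ hu S n z).choose_spec.symm)

end BaseChange

end Prolongation

section Jet

variable {p : ℕ} {R : Type} [CommRing R] (D : FrobeniusBase p R)

/-- Polynomials in the symbols `δ^i a` for `i ≤ n` and `a ∈ A`. -/
abbrev FreeObj (R : Type) [CommRing R] (A : Type) (n : ℕ) : Type :=
  MvPolynomial (Fin (n + 1) × A) R

/-- The inclusion of the polynomials of order `n` in those of order `n + 1`. -/
def freeIncl (R : Type) [CommRing R] (A : Type) (n : ℕ) :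
    FreeObj R A n →ₐ[R] FreeObj R A (n + 1) :=
  MvPolynomial.rename (Prod.map Fin.castSucc id)

/-- The lift of Frobenius with `φ (δ^i a) = (δ^i a) ^ p + unif * δ^(i+1) a`. -/
def freeFrob (A : Type) (n : ℕ) : FreeObj R A n →+* FreeObj R A (n + 1) :=
  MvPolynomial.eval₂Hom (MvPolynomial.C.comp D.frob) fun ia =>
    MvPolynomial.X (ia.1.castSucc, ia.2) ^ p
      + MvPolynomial.C D.unif * MvPolynomial.X (ia.1.succ, ia.2)

theorem free_reg (A : Type) (n : ℕ) :
    algebraMap R (FreeObj R A n) D.unif ∈ nonZeroDivisors (FreeObj R A n) := by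
  rw [mem_nonZeroDivisors_iff_right]
  intro f hf
  ext m
  have := congrArg (MvPolynomial.coeff m) hf
  rw [mul_comm, MvPolynomial.algebraMap_eq, MvPolynomial.coeff_C_mul, MvPolynomial.coeff_zero,
    mul_comm] at this
  rw [MvPolynomial.coeff_zero]
  exact (mem_nonZeroDivisors_iff_right.mp D.unif_mem) _ this

theorem freeFrob_dvd [hp : Fact p.Prime] (A : Type) (n : ℕ) (f : FreeObj R A n) :
    algebraMap R (FreeObj R A (n + 1)) D.unif ∣ freeFrob D A n f - freeIncl R A n f ^ p := by
  induction f using MvPolynomial.induction_on with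
  | C r =>
    refine ⟨algebraMap R _ (D.δ r), ?_⟩
    rw [← map_mul, D.unif_mul_δ]
    simp [freeFrob, freeIncl]
  | add f g hf hg =>
    have h : algebraMap R (FreeObj R A (n + 1)) D.unif ∣ (p : FreeObj R A (n + 1)) :=
      Dvd.intro_left _ (Prolongation.unif_dvd_p (D := D) _)
    have := dvd_add (dvd_add hf hg) (h.mul_right
      (carry p (freeIncl R A n f) (freeIncl R A n g)))
    rw [mul_carry] at this
    convert this using 1
    rw [map_add, map_add]
    ring
  | mul_X f ia hf =>
    have h : freeFrob D A n (f * MvPolynomial.X ia) - freeIncl R A n (f * MvPolynomial.X ia) ^ p =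
        (freeFrob D A n f - freeIncl R A n f ^ p) * freeFrob D A n (MvPolynomial.X ia)
        + algebraMap R (FreeObj R A (n + 1)) D.unif *
          (freeIncl R A n f ^ p * MvPolynomial.X (ia.1.succ, ia.2)) := by
      simp [freeFrob, freeIncl, Prod.map]
      ring
    rw [h]
    exact dvd_add (hf.mul_right _) (dvd_mul_right _ _)

/-- The operator `δ f = (φ f - f ^ p) / unif` on polynomials, so that `δ (δ^i a) = δ^(i+1) a`. -/
def freeδ [Fact p.Prime] (A : Type) (n : ℕ) (f : FreeObj R A n) : FreeObj R A (n + 1) :=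
  (freeFrob_dvd D A n f).choose

theorem unif_mul_freeδ [Fact p.Prime] (A : Type) (n : ℕ) (f : FreeObj R A n) :
    algebraMap R (FreeObj R A (n + 1)) D.unif * freeδ D A n f =
      freeFrob D A n f - freeIncl R A n f ^ p :=
  (freeFrob_dvd D A n f).choose_spec.symm

/-- The free prolongation sequence on symbols `a ∈ A`. -/
def freeProlongation [Fact p.Prime] (A : Type) : Prolongation D :=
  Prolongation.ofFrobenius (FreeObj R A) (freeIncl R A) (freeFrob D A) (free_reg D A)
    (fun n r => by simp [freeFrob])
    (fun n f => by
      induction f using MvPolynomial.induction_on with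
      | C r => simp [freeFrob, freeIncl]
      | add f g hf hg => simp only [map_add, hf, hg]
      | mul_X f ia hf =>
        simp only [map_mul, hf]
        simp [freeFrob, freeIncl, Prod.map])
    (freeδ D A) (unif_mul_freeδ D A)

theorem rename_freeIncl {A B : Type} (f : A → B) (n : ℕ) (x : FreeObj R A n) :
    MvPolynomial.rename (Prod.map id f) (freeIncl R A n x) =
      freeIncl R B n (MvPolynomial.rename (Prod.map id f) x) := by
  rw [freeIncl, freeIncl, MvPolynomial.rename_rename, MvPolynomial.rename_rename]
  rfl

theorem rename_freeFrob {A B : Type} (f : A → B) (n : ℕ) (x : FreeObj R A n) :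
    MvPolynomial.rename (Prod.map id f) (freeFrob D A n x) =
      freeFrob D B n (MvPolynomial.rename (Prod.map id f) x) := by
  induction x using MvPolynomial.induction_on with
  | C r => simp [freeFrob]
  | add f g hf hg => simp only [map_add, hf, hg]
  | mul_X f ia hf =>
    simp only [map_mul, hf]
    simp [freeFrob]

theorem rename_freeδ [Fact p.Prime] {A B : Type} (f : A → B) (n : ℕ) (x : FreeObj R A n) :
    MvPolynomial.rename (Prod.map id f) (freeδ D A n x) =
      freeδ D B n (MvPolynomial.rename (Prod.map id f) x) := by
  refine (mul_cancel_left_mem_nonZeroDivisors (free_reg D B (n + 1))).mp ?_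
  rw [unif_mul_freeδ, ← rename_freeFrob, ← rename_freeIncl, ← map_pow, ← map_sub,
    ← unif_mul_freeδ, map_mul, AlgHom.commutes]

/-- The morphism of free prolongation sequences induced by a map. -/
def freeMap [Fact p.Prime] {A B : Type} (f : A → B) :
    Prolongation.Hom (freeProlongation D A) (freeProlongation D B) where
  hom n := (MvPolynomial.rename (Prod.map id f) : FreeObj R A n →ₐ[R] FreeObj R B n)
  hom_incl n x := rename_freeIncl f n x
  hom_δ n x := rename_freeδ D f n x

variable (A B : Type) [CommRing A] [Algebra R A] [CommRing B] [Algebra R B]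

/-- The relations of the jet algebras: in order `0` the relations between the elements of `A`, and
in order `n + 1` those of order `n` and their images under `δ`. -/
def jetIdeal [Fact p.Prime] : ∀ n, Ideal (FreeObj R A n)
  | 0 => RingHom.ker (MvPolynomial.aeval (fun ia => ia.2) : FreeObj R A 0 →ₐ[R] A)
  | n + 1 => Ideal.span (freeIncl R A n '' jetIdeal n ∪ freeδ D A n '' jetIdeal n)

/-- The universal prolongation sequence `A^*` with `A^0 = A` over the base. -/
def jet [Fact p.Prime] : Prolongation D :=
  (freeProlongation D A).quot (jetIdeal D A)
    (fun _ x hx => Ideal.subset_span (Or.inl ⟨x, hx, rfl⟩))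
    (fun _ x hx => Ideal.subset_span (Or.inr ⟨x, hx, rfl⟩))

/-- The canonical map `A → A^0`, which is an isomorphism. -/
def toJet [Fact p.Prime] (a : A) : (jet D A).obj 0 :=
  Ideal.Quotient.mk (jetIdeal D A 0) (MvPolynomial.X (0, a) : FreeObj R A 0)

variable {A B}

theorem rename_mem_jetIdeal [Fact p.Prime] (f : A →ₐ[R] B) (n : ℕ) :
    ∀ x ∈ jetIdeal D A n, MvPolynomial.rename (Prod.map id f) x ∈ jetIdeal D B n := by
  induction n with
  | zero =>
    intro x hx
    have hx' : (MvPolynomial.aeval (fun ia => ia.2) : FreeObj R A 0 →ₐ[R] A) x = 0 := hx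
    change (MvPolynomial.aeval (fun ia => ia.2) : FreeObj R B 0 →ₐ[R] B)
      (MvPolynomial.rename (Prod.map id f) x) = 0
    rw [MvPolynomial.aeval_rename, ← map_zero f, ← hx']
    exact (MvPolynomial.comp_aeval_apply _ f x).symm
  | succ n ih =>
    change jetIdeal D A (n + 1) ≤ (jetIdeal D B (n + 1)).comap
      (MvPolynomial.rename (Prod.map id f) : FreeObj R A (n + 1) →ₐ[R] FreeObj R B (n + 1))
    refine Ideal.span_le.mpr ?_
    rintro _ (⟨x, hx, rfl⟩ | ⟨x, hx, rfl⟩)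
    · exact Ideal.subset_span (Or.inl ⟨_, ih x hx, (rename_freeIncl f n x).symm⟩)
    · exact Ideal.subset_span (Or.inr ⟨_, ih x hx, (rename_freeδ D f n x).symm⟩)

/-- The morphism of jet sequences induced by an algebra homomorphism. -/
def jetMap [Fact p.Prime] (f : A →ₐ[R] B) : Prolongation.Hom (jet D A) (jet D B) :=
  Prolongation.quotMap (freeMap D f) _ _ _ _ _ _ (rename_mem_jetIdeal D f)

end Jet

section BaseRings

variable (p : ℕ) [Fact p.Prime]

/-- The residue field `k`, an algebraic closure of `𝔽_p`. -/
abbrev ResidueField : Type := AlgebraicClosure (ZMod p)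

/-- The ring `R_p`, the completion of the maximal unramified extension of `ℤ_p`, realized as the
ring of `p`-typical Witt vectors of an algebraic closure of `𝔽_p`. -/
abbrev Rp : Type := WittVector p (ResidueField p)

/-- The inclusion of `ℤ_p = W(𝔽_p)` in `R_p`. -/
def padicToRp : ℤ_[p] →+* Rp p :=
  (WittVector.map (algebraMap (ZMod p) (ResidueField p))).comp
    (WittVector.equiv p).symm.toRingHom

theorem frobenius_padicToRp (a : ℤ_[p]) :
    WittVector.frobenius (padicToRp p a) = padicToRp p a := by
  ext n
  rw [WittVector.coeff_frobenius_charP]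
  change algebraMap (ZMod p) (ResidueField p) _ ^ p = algebraMap (ZMod p) (ResidueField p) _
  rw [← map_pow, ZMod.pow_card]

theorem p_dvd_frobenius (x : Rp p) : (p : Rp p) ∣ WittVector.frobenius x - x ^ p := by
  rw [← Ideal.mem_span_singleton, WittVector.mem_span_p_iff_coeff_zero_eq_zero]
  have h : WittVector.constantCoeff (WittVector.frobenius x - x ^ p) = 0 := by
    rw [map_sub, map_pow]
    change (WittVector.frobenius x).coeff 0 - x.coeff 0 ^ p = 0
    rw [WittVector.coeff_frobenius_charP, sub_self]
  exact h

/-- `R_p` with `δ_p x = (φ x - x ^ p) / p`. -/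
def baseP : FrobeniusBase p (Rp p) where
  unif := p
  ratio := 1
  ratio_mul_unif := one_mul _
  unif_mem := mem_nonZeroDivisors_of_ne_zero (WittVector.p_nonzero p _)
  frob := WittVector.frobenius
  unif_dvd := p_dvd_frobenius p

/-- Eisenstein polynomials of degree at least `2` over `ℤ_p`. -/
structure IsRamifiedEisenstein (E : ℤ_[p][X]) : Prop where
  monic : E.Monic
  eisenstein : E.IsEisensteinAt (Ideal.span {(p : ℤ_[p])})
  two_le : 2 ≤ E.natDegree

variable (E : ℤ_[p][X])

/-- The ring `R_π = R_p[π]`, where `π` is a root of `E`. -/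
abbrev Rpi : Type := AdjoinRoot (E.map (padicToRp p))

/-- The uniformizer `π`. -/
abbrev piElt : Rpi p E := AdjoinRoot.root (E.map (padicToRp p))

/-- The endomorphism `φ` of `R_π` extending the Frobenius of `R_p`, with `φ π = π`. -/
def frobPi : Rpi p E →+* Rpi p E :=
  AdjoinRoot.lift ((AdjoinRoot.of _).comp WittVector.frobenius) (piElt p E) (by
    have h : ((AdjoinRoot.of (E.map (padicToRp p))).comp WittVector.frobenius).comp (padicToRp p) =
        (AdjoinRoot.of (E.map (padicToRp p))).comp (padicToRp p) :=
      RingHom.ext fun a => by simp [frobenius_padicToRp]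
    rw [eval₂_map, h, ← eval₂_map]
    exact AdjoinRoot.eval₂_root _)

theorem frobPi_algebraMap (r : Rp p) : frobPi p E (algebraMap (Rp p) (Rpi p E) r) =
    algebraMap (Rp p) (Rpi p E) (WittVector.frobenius r) :=
  AdjoinRoot.lift_of _

variable {E}

theorem exists_unit_coeff_zero (hE : IsRamifiedEisenstein p E) :
    ∃ u : ℤ_[p], IsUnit u ∧ E.coeff 0 = p * u := by
  have h1 := hE.eisenstein.mem (n := 0) (by have := hE.two_le; omega)
  obtain ⟨u, hu⟩ := Ideal.mem_span_singleton.mp h1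
  refine ⟨u, ?_, hu⟩
  by_contra hun
  have h2 := hE.eisenstein.notMem
  have h3 : (p : ℤ_[p]) ∣ u := by
    rw [← Ideal.mem_span_singleton, ← PadicInt.maximalIdeal_eq_span_p]
    exact hun
  apply h2
  rw [Ideal.span_singleton_pow, Ideal.mem_span_singleton, hu, pow_two]
  exact mul_dvd_mul_left _ h3

theorem pi_dvd_p (hE : IsRamifiedEisenstein p E) : piElt p E ∣ (p : Rpi p E) := by
  obtain ⟨u, ⟨u, rfl⟩, h⟩ := exists_unit_coeff_zero p hE
  have h1 : AdjoinRoot.mk (E.map (padicToRp p)) (E.map (padicToRp p)) = 0 := AdjoinRoot.mk_self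
  have h2 : piElt p E ∣ AdjoinRoot.of _ (padicToRp p (E.coeff 0)) := by
    refine ⟨-AdjoinRoot.mk _ (E.map (padicToRp p)).divX, ?_⟩
    replace h1 := (congrArg (AdjoinRoot.mk (E.map (padicToRp p)))
      (Polynomial.X_mul_divX_add (E.map (padicToRp p)))).trans h1
    rw [map_add, map_mul, AdjoinRoot.mk_X, AdjoinRoot.mk_C, coeff_map] at h1
    rw [mul_neg, eq_neg_iff_add_eq_zero, add_comm]
    exact h1
  have h3 : (p : Rpi p E) = AdjoinRoot.of _ (padicToRp p (E.coeff 0)) *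
      AdjoinRoot.of _ (padicToRp p ↑u⁻¹) := by
    rw [← map_mul, ← map_mul, h, mul_assoc, Units.mul_inv, mul_one, map_natCast, map_natCast]
  rw [h3]
  exact h2.mul_right _

theorem pi_mem_nonZeroDivisors (hE : IsRamifiedEisenstein p E) :
    piElt p E ∈ nonZeroDivisors (Rpi p E) := by
  rw [mem_nonZeroDivisors_iff_right]
  intro x hx
  obtain ⟨f, rfl⟩ := AdjoinRoot.mk_surjective x
  rw [piElt, ← AdjoinRoot.mk_X, ← map_mul, AdjoinRoot.mk_eq_zero] at hx
  obtain ⟨g, hg⟩ := hx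
  obtain ⟨u, hu, h⟩ := exists_unit_coeff_zero p hE
  have h0 : (E.map (padicToRp p)).coeff 0 ≠ 0 := by
    rw [coeff_map, h, map_mul, map_natCast]
    exact mul_ne_zero (WittVector.p_nonzero p _) (hu.map (padicToRp p)).ne_zero
  have h1 : (E.map (padicToRp p)).coeff 0 * g.coeff 0 = 0 := by
    rw [← mul_coeff_zero, ← hg, mul_coeff_zero, coeff_X_zero, mul_zero]
  obtain ⟨g', rfl⟩ := X_dvd_iff.mpr ((mul_eq_zero.mp h1).resolve_left h0)
  rw [AdjoinRoot.mk_eq_zero]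
  refine ⟨g', ?_⟩
  have h2 : X * f = X * (E.map (padicToRp p) * g') := by rw [mul_comm, hg]; ring
  exact mul_left_cancel₀ X_ne_zero h2

theorem pi_dvd_frobPi (hE : IsRamifiedEisenstein p E) (x : Rpi p E) :
    piElt p E ∣ frobPi p E x - x ^ p := by
  obtain ⟨f, rfl⟩ := AdjoinRoot.mk_surjective x
  have key : AdjoinRoot.mk (E.map (padicToRp p)) f =
      piElt p E * AdjoinRoot.mk _ f.divX + AdjoinRoot.of _ (f.coeff 0) := by
    nth_rewrite 1 [← Polynomial.X_mul_divX_add f]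
    rw [map_add, map_mul, AdjoinRoot.mk_X, AdjoinRoot.mk_C]
  have hpi : frobPi p E (piElt p E) = piElt p E := AdjoinRoot.lift_root _
  have hof : ∀ a, frobPi p E (AdjoinRoot.of _ a) = AdjoinRoot.of _ (WittVector.frobenius a) :=
    fun a => AdjoinRoot.lift_of _
  have h1 : piElt p E ∣ AdjoinRoot.of (E.map (padicToRp p))
      (WittVector.frobenius (f.coeff 0) - f.coeff 0 ^ p) := by
    refine (pi_dvd_p p hE).trans ?_
    have := map_dvd (AdjoinRoot.of (E.map (padicToRp p))) (p_dvd_frobenius p (f.coeff 0))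
    rwa [map_natCast] at this
  have h2 : piElt p E ∣ AdjoinRoot.mk (E.map (padicToRp p)) f ^ p -
      AdjoinRoot.of _ (f.coeff 0) ^ p :=
    (Dvd.intro (AdjoinRoot.mk _ f.divX) (by rw [key]; ring) :
      piElt p E ∣ AdjoinRoot.mk (E.map (padicToRp p)) f - AdjoinRoot.of _ (f.coeff 0)).trans
      (sub_dvd_pow_sub_pow _ _ p)
  have h3 : frobPi p E (AdjoinRoot.mk _ f) - AdjoinRoot.mk (E.map (padicToRp p)) f ^ p =
      piElt p E * frobPi p E (AdjoinRoot.mk _ f.divX)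
      + AdjoinRoot.of _ (WittVector.frobenius (f.coeff 0) - f.coeff 0 ^ p)
      - (AdjoinRoot.mk (E.map (padicToRp p)) f ^ p - AdjoinRoot.of _ (f.coeff 0) ^ p) := by
    nth_rewrite 1 [key]
    rw [map_add, map_mul, hpi, hof, map_sub, map_pow]
    ring
  rw [h3]
  exact dvd_sub (dvd_add (dvd_mul_right _ _) h1) h2

/-- `R_π` with `δ_π x = (φ x - x ^ p) / π`. -/
def basePi (hE : IsRamifiedEisenstein p E) : FrobeniusBase p (Rpi p E) where
  unif := piElt p E
  ratio := (pi_dvd_p p hE).choose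
  ratio_mul_unif := by rw [mul_comm]; exact (pi_dvd_p p hE).choose_spec.symm
  unif_mem := pi_mem_nonZeroDivisors p hE
  frob := frobPi p E
  unif_dvd := pi_dvd_frobPi p hE

/-- The `δ_π`-prolongation sequence `S^* ⊗_{R_p} R_π`, for `S^*` flat over `R_p`. -/
def tensorPi (hE : IsRamifiedEisenstein p E) (S : Prolongation (baseP p))
    (hS : ∀ n, Module.Flat (Rp p) (S.obj n)) : Prolongation (basePi p hE) :=
  Prolongation.baseChange (basePi p hE) (frobPi_algebraMap p E)
    (by
      change piElt p E ∣ AdjoinRoot.of _ (p : Rp p)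
      rw [map_natCast]
      exact pi_dvd_p p hE) S hS

end BaseRings

section Schemes

variable {R : Type} [CommRing R] {Y : Scheme.{0}} (f : Y ⟶ Spec (CommRingCat.of R))

/-- The sections of the structure sheaf of an `R`-scheme, as an `R`-algebra. -/
def Sections (_f : Y ⟶ Spec (CommRingCat.of R)) (V : Y.Opens) : Type := Γ(Y, V)

instance (V : Y.Opens) : CommRing (Sections f V) := inferInstanceAs (CommRing Γ(Y, V))

/-- The ring homomorphism `R → Γ(Y, V)`. -/
def structMap (V : Y.Opens) : R →+* Γ(Y, V) :=
  ((Scheme.ΓSpecIso (CommRingCat.of R)).inv ≫ f.appTop ≫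
    Y.presheaf.map (homOfLE (le_top : V ≤ ⊤)).op).hom

instance (V : Y.Opens) : Algebra R (Sections f V) := (structMap f V).toAlgebra

/-- Restriction of sections, as an algebra homomorphism. -/
def Sections.res {V W : Y.Opens} (h : V ≤ W) : Sections f W →ₐ[R] Sections f V where
  toRingHom := (Y.presheaf.map (homOfLE h).op).hom
  commutes' r := by
    change (Y.presheaf.map (homOfLE h).op).hom (structMap f W r) = structMap f V r
    simp only [structMap]
    rw [← RingHom.comp_apply, ← CommRingCat.hom_comp, Category.assoc, Category.assoc,
      ← Functor.map_comp]
    rfl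

variable {p : ℕ} [Fact p.Prime] (D : FrobeniusBase p R)

/-- The prolongation sequence `O(J^n(V))` of the jet spaces of an affine open `V`: the
`p`-adic completion of the universal prolongation sequence of the algebra of functions. -/
def affineJet (V : Y.Opens) : Prolongation D := (jet D (Sections f V)).completion

/-- Restriction to a smaller affine open. -/
def affineJetRes {V W : Y.Opens} (h : V ≤ W) :
    Prolongation.Hom (affineJet f D W) (affineJet f D V) :=
  Prolongation.completionMap (jetMap D (Sections.res f h))

/-- A function on `V`, as a function on the jet space of order `0`. -/
def toAffineJet (V : Y.Opens) (a : Sections f V) : (affineJet f D V).obj 0 :=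
  AdicCompletion.of _ _ (toJet D (Sections f V) a)

/-- The prolongation sequence `O(J^n(Y))` of global functions on the jet spaces of `Y`, which are
glued from the jet spaces of the affine opens of `Y`: compatible families of functions on the jet
spaces of all affine opens. -/
def globalJet : Prolongation D :=
  Prolongation.limit (fun V : Y.affineOpens => affineJet f D V.1)
    (fun _ _ h => affineJetRes f D h)

/-- Restriction of global functions to the jet spaces of an affine open. -/
def globalJetRes (V : Y.affineOpens) : Prolongation.Hom (globalJet f D) (affineJet f D V.1) :=
  Prolongation.limitProj _ _ V

end Schemes

section Comparison

variable {p : ℕ} [Fact p.Prime] {E : ℤ_[p][X]} (hE : IsRamifiedEisenstein p E)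
  {X : Scheme.{0}} (f : X ⟶ Spec (CommRingCat.of (Rp p)))

/-- `Spec R_π → Spec R_p`. -/
abbrev specPi (p : ℕ) [Fact p.Prime] (E : ℤ_[p][X]) :
    Spec (CommRingCat.of (Rpi p E)) ⟶ Spec (CommRingCat.of (Rp p)) :=
  Spec.map (CommRingCat.ofHom (algebraMap (Rp p) (Rpi p E)))

/-- The base change `X_{R_π}`. -/
abbrev XPi (E : ℤ_[p][X]) : Scheme.{0} := Limits.pullback f (specPi p E)

/-- The structure morphism `X_{R_π} → Spec R_π`. -/
abbrev structPi (E : ℤ_[p][X]) : XPi f E ⟶ Spec (CommRingCat.of (Rpi p E)) :=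
  Limits.pullback.snd f (specPi p E)

/-- The projection `X_{R_π} → X`. -/
abbrev projPi (E : ℤ_[p][X]) : XPi f E ⟶ X := Limits.pullback.fst f (specPi p E)

/-- The affine open `U_{R_π}` of `X_{R_π}`, for an affine open `U` of `X`. -/
def preimagePi (E : ℤ_[p][X]) (U : X.affineOpens) : (XPi f E).affineOpens :=
  have : IsAffineHom (projPi f E) :=
    isAffineHom_isStableUnderBaseChange.of_isPullback (IsPullback.of_hasPullback f (specPi p E)).flip
      (inferInstance : IsAffineHom (specPi p E))
  ⟨projPi f E ⁻¹ᵁ U.1, U.2.preimage (projPi f E)⟩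

/-- The pull-back of functions from `U` to `U_{R_π}`. -/
def pullbackPi (E : ℤ_[p][X]) (U : X.affineOpens) :
    Sections f U.1 → Sections (structPi f E) (preimagePi f E U).1 :=
  fun a => ((projPi f E).app U.1).hom a

/-- The element `x ⊗ 1` of `S^n ⊗_{R_p} R_π`. -/
def tmulOne (S : Prolongation (baseP p)) (hS : ∀ n, Module.Flat (Rp p) (S.obj n)) (n : ℕ)
    (x : S.obj n) : (tensorPi p hE S hS).obj n :=
  ((1 : Rpi p E) ⊗ₜ[Rp p] x : Rpi p E ⊗[Rp p] S.obj n)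

/-- The map `S^n ⊗_{R_p} R_π → T^n ⊗_{R_p} R_π` induced by a morphism `S^* → T^*`. -/
def tensorPiMap {S T : Prolongation (baseP p)} (hS : ∀ n, Module.Flat (Rp p) (S.obj n))
    (hT : ∀ n, Module.Flat (Rp p) (T.obj n)) (g : Prolongation.Hom S T) (n : ℕ) :
    (tensorPi p hE S hS).obj n →ₐ[Rpi p E] (tensorPi p hE T hT).obj n :=
  (Algebra.TensorProduct.map (AlgHom.id (Rpi p E) (Rpi p E)) (g.hom n) :
    Rpi p E ⊗[Rp p] S.obj n →ₐ[Rpi p E] Rpi p E ⊗[Rp p] T.obj n)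

/-- For an affine open `U` of `X`, the morphism of `δ_π`-prolongation sequences
`O(J^n_π(U_{R_π})) → O(J^n_p(U)) ⊗_{R_p} R_π` is the canonical one if it is given
on functions on `U` by `a ↦ a ⊗ 1`. -/
def IsCanonicalOn (U : X.affineOpens)
    (hU : ∀ n, Module.Flat (Rp p) ((affineJet f (baseP p) U.1).obj n))
    (T : Prolongation.Hom (affineJet (structPi f E) (basePi p hE) (preimagePi f E U).1)
      (tensorPi p hE (affineJet f (baseP p) U.1) hU)) : Prop :=
  ∀ a : Sections f U.1,
    T.hom 0 (toAffineJet (structPi f E) (basePi p hE) _ (pullbackPi f E U a)) =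
      tmulOne hE _ hU 0 (toAffineJet f (baseP p) U.1 a)

/-- The morphism of `δ_π`-prolongation sequences
`O(J^n_π(X_{R_π})) → O(J^n_p(X)) ⊗_{R_p} R_π` is the canonical one if over each affine open of `X`
it restricts to the canonical one. -/
def IsCanonical (hX : ∀ n, Module.Flat (Rp p) ((globalJet f (baseP p)).obj n))
    (T : Prolongation.Hom (globalJet (structPi f E) (basePi p hE))
      (tensorPi p hE (globalJet f (baseP p)) hX)) : Prop :=
  ∀ U : X.affineOpens, ∃ (hU : ∀ n, Module.Flat (Rp p) ((affineJet f (baseP p) U.1).obj n))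
    (TU : Prolongation.Hom (affineJet (structPi f E) (basePi p hE) (preimagePi f E U).1)
      (tensorPi p hE (affineJet f (baseP p) U.1) hU)),
    IsCanonicalOn hE f U hU TU ∧ ∀ n x,
      tensorPiMap hE hX hU (globalJetRes f (baseP p) U) n (T.hom n x) =
        TU.hom n ((globalJetRes (structPi f E) (basePi p hE) (preimagePi f E U)).hom n x)

/-- The reduction modulo `p` of a ring homomorphism. -/
def modP (p : ℕ) {A B : Type} [CommRing A] [CommRing B] (g : A →+* B) :
    A ⧸ Ideal.span {(p : A)} →+* B ⧸ Ideal.span {(p : B)} :=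
  Ideal.quotientMap _ g (by
    rw [Ideal.span_le, Set.singleton_subset_iff]
    simp only [SetLike.mem_coe, Ideal.mem_comap, map_natCast]
    exact Ideal.mem_span_singleton_self _)

end Comparison

end ArithJet

end

open ArithJet

/-! Existence and uniqueness are universal properties. A morphism from the completed jet sequence of
an algebra to a `p`-adically complete sequence is the same as an algebra map in order `0`
(`jetLift`, `completionLift`, `hom_ext_of_complete`). The target `S^* ⊗ R_π` is complete because
`R_π` is finite free over `R_p` (`tensor_isAdicComplete`). For the same reason tensoring with `R_π`
commutes with forming compatible families, so the local morphisms glue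
(`exists_hom_baseChange_limit`). Flatness over the discrete valuation ring `R_p` is absence of
`p`-torsion, which is a local matter.

Injectivity can be tested on a Zariski cover (`eq_zero_of_forall_completionMap_eq_zero`), so étale
coordinates `x_j` on an algebra `A` may be assumed. The completed `p`-jets of order `n` are then the
completed polynomials over `A` in the `δ_p ^ i x_j`, `1 ≤ i ≤ n` (`complMap_genMap_bijective`), and
the completed `π`-jets are at least a quotient of the completed polynomials over `R_π ⊗ A` in the
`δ_π ^ i x_j` (`complMap_genMap_surjective`). Both Fermat quotients have numerator `φ x - x ^ p`.
Hence `δ_π x` becomes `(p / π) δ_p x`, and `δ_π ^ (i + 1) x` becomes a universal polynomial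
`jetPoly` in `δ_p x, ..., δ_p ^ (i + 1) x` (`elt_baseChangeOf`). After inverting `p` this change of
variables has an inverse without constant terms, and scaling the variables by a power `p ^ M` makes
the inverse integral (`exists_aeval_jetPoly`). The canonical map followed by this substitution is
the scaling `Z ↦ p ^ M Z` on the generators, which is injective on completed polynomials over a
`p`-torsion-free ring (`complMap_scale_injective`). Since the generators map onto the `π`-jets, the
canonical map is injective (`canonical_injective_of_coordinates`).

The negative statements rest on `π ^ 2 ∣ p`, which holds since `e ≥ 2`. The element `π δ_π a` maps
to `p δ_p a`, which vanishes modulo `p`; but its value at an `R_π`-point `P` is `φ (P a) - (P a) ^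
p`, which is not divisible by `p` for a suitable `P` (`not_injective_modP`). As `π` divides `p / π`,
the image in order `n + 1` consists of elements that modulo `π` come from order `n`
(`hom_mem_lowOrder`). The element `δ_p ^ (n + 1) a` is not of this kind: two `R_p`-points congruent
modulo `p ^ (n + 1)` have the same `δ_p ^ i` modulo `p` for `i ≤ n`, yet `δ_p ^ (n + 1) a` can
separate them (`not_surjective`). The points come from a non-zero tangent vector of the special
fibre (`exists_tangent`), lifted by smoothness (`exists_perturbation`). -/

noncomputable section
set_option linter.unusedSectionVars false
namespace ArithJet

/-! ### The universal property of the jet sequence -/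

namespace Prolongation

variable {p : ℕ} {R : Type} [CommRing R] {D : FrobeniusBase p R}

/-- Composition of morphisms of prolongation sequences. -/
def Hom.comp {S T U : Prolongation D} (g : Hom T U) (f : Hom S T) : Hom S U where
  hom n := (g.hom n).comp (f.hom n)
  hom_incl n x := by simp [f.hom_incl, g.hom_incl]
  hom_δ n x := by simp [f.hom_δ, g.hom_δ]

/-- The inverse of a bijective morphism of prolongation sequences. -/
def Hom.inv {S T : Prolongation D} (f : Hom S T) (hf : ∀ n, Function.Bijective (f.hom n)) :
    Hom T S where
  hom n := (AlgEquiv.ofBijective (f.hom n) (hf n)).symm.toAlgHom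
  hom_incl n x := by
    obtain ⟨x, rfl⟩ := (hf n).2 x
    refine (hf (n + 1)).1 ?_
    have h1 : ∀ n x, f.hom n ((AlgEquiv.ofBijective (f.hom n) (hf n)).symm x) = x :=
      fun n x => (AlgEquiv.ofBijective (f.hom n) (hf n)).apply_symm_apply x
    change f.hom (n + 1) ((AlgEquiv.ofBijective (f.hom (n + 1)) (hf (n + 1))).symm _) =
      f.hom (n + 1) (S.incl n ((AlgEquiv.ofBijective (f.hom n) (hf n)).symm _))
    rw [h1, f.hom_incl, h1]
  hom_δ n x := by
    obtain ⟨x, rfl⟩ := (hf n).2 x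
    refine (hf (n + 1)).1 ?_
    have h1 : ∀ n x, f.hom n ((AlgEquiv.ofBijective (f.hom n) (hf n)).symm x) = x :=
      fun n x => (AlgEquiv.ofBijective (f.hom n) (hf n)).apply_symm_apply x
    change f.hom (n + 1) ((AlgEquiv.ofBijective (f.hom (n + 1)) (hf (n + 1))).symm _) =
      f.hom (n + 1) (S.δ n ((AlgEquiv.ofBijective (f.hom n) (hf n)).symm _))
    rw [h1, f.hom_δ, h1]

theorem Hom.hom_inv {S T : Prolongation D} (f : Hom S T) (hf : ∀ n, Function.Bijective (f.hom n))
    (n : ℕ) (x : S.obj n) : (f.inv hf).hom n (f.hom n x) = x :=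
  (AlgEquiv.ofBijective (f.hom n) (hf n)).symm_apply_apply x

/-- The element `δ ^ i x` of order `i ≤ n`, as an element of the `n`-th ring. -/
def elt (S : Prolongation D) : ∀ n : ℕ, ℕ → S.obj 0 → S.obj n
  | 0, _, x => x
  | n + 1, i, x => if i ≤ n then S.incl n (S.elt n i x) else S.δ n (S.elt n n x)

theorem incl_elt (S : Prolongation D) {n i : ℕ} (h : i ≤ n) (x : S.obj 0) :
    S.incl n (S.elt n i x) = S.elt (n + 1) i x := by
  rw [elt, if_pos h]

/-- Since `δ` commutes with `incl`, it raises the index `i` whatever the order in which `δ ^ i x` is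
regarded. The bound on `i` matters: beyond `n`, `elt` takes default values. -/
theorem δ_elt (S : Prolongation D) {n i : ℕ} (h : i ≤ n) (x : S.obj 0) :
    S.δ n (S.elt n i x) = S.elt (n + 1) (i + 1) x := by
  induction n with
  | zero =>
    obtain rfl : i = 0 := by omega
    simp [elt]
  | succ n ih =>
    rcases h.lt_or_eq with h | rfl
    · have h : i ≤ n := by omega
      rw [← S.incl_elt h, S.δ_incl, ih h, S.incl_elt (by omega)]
    · conv_rhs => rw [elt, if_neg (by omega)]

theorem Hom.hom_elt {S T : Prolongation D} (f : Hom S T) (n i : ℕ) (x : S.obj 0) :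
    f.hom n (S.elt n i x) = T.elt n i (f.hom 0 x) := by
  induction n generalizing i with
  | zero => rfl
  | succ n ih =>
    rw [elt, elt]
    split_ifs
    · rw [f.hom_incl, ih]
    · rw [f.hom_δ, ih]

end Prolongation

section Universal

open Prolongation

variable {p : ℕ} [Fact p.Prime] {R : Type} [CommRing R] (D : FrobeniusBase p R)

theorem freeδ_X (A : Type) (n : ℕ) (i : Fin (n + 1)) (a : A) :
    freeδ D A n (MvPolynomial.X (i, a)) = MvPolynomial.X (i.succ, a) := by
  refine (mul_cancel_left_mem_nonZeroDivisors (free_reg D A (n + 1))).mp ?_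
  rw [unif_mul_freeδ]
  simp [freeFrob, freeIncl]

variable {D}
variable {A : Type} (S : Prolongation D)

/-- The evaluation of the symbols `δ ^ i a` in a prolongation sequence. -/
def freeLift (α : A → S.obj 0) (n : ℕ) : FreeObj R A n →ₐ[R] S.obj n :=
  MvPolynomial.aeval fun ia => S.elt n ia.1 (α ia.2)

theorem freeLift_X (α : A → S.obj 0) (n : ℕ) (i : Fin (n + 1)) (a : A) :
    freeLift S α n (MvPolynomial.X (i, a)) = S.elt n i (α a) := by
  simp [freeLift]

theorem freeLift_incl (α : A → S.obj 0) (n : ℕ) (x : FreeObj R A n) :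
    freeLift S α (n + 1) (freeIncl R A n x) = S.incl n (freeLift S α n x) := by
  change ((freeLift S α (n + 1)).comp (freeIncl R A n)) x = ((S.incl n).comp (freeLift S α n)) x
  congr 1
  ext ⟨i, a⟩
  simp [freeLift, freeIncl, S.incl_elt (Nat.lt_succ_iff.mp i.2)]

/-- The target may have `unif`-torsion, so this cannot be deduced from a compatibility with
Frobenius by division. The sum and product formulas carry an induction on the polynomial instead. -/
theorem freeLift_δ (α : A → S.obj 0) (n : ℕ) (x : FreeObj R A n) :
    freeLift S α (n + 1) (freeδ D A n x) = S.δ n (freeLift S α n x) := by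
  have hadd := (freeProlongation D A).δ_add n
  have hmul := (freeProlongation D A).δ_mul n
  change ∀ x y : FreeObj R A n, freeδ D A n (x + y) = freeδ D A n x + freeδ D A n y +
    algebraMap R (FreeObj R A (n + 1)) D.ratio *
      carry p (freeIncl R A n x) (freeIncl R A n y) at hadd
  change ∀ x y : FreeObj R A n, freeδ D A n (x * y) = freeIncl R A n x ^ p * freeδ D A n y +
    freeIncl R A n y ^ p * freeδ D A n x +
    algebraMap R (FreeObj R A (n + 1)) D.unif * freeδ D A n x * freeδ D A n y at hmul
  induction x using MvPolynomial.induction_on with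
  | C r =>
    have h : freeδ D A n (algebraMap R (FreeObj R A n) r) = algebraMap R (FreeObj R A (n + 1))
        (D.δ r) := (freeProlongation D A).δ_algebraMap n r
    rw [← MvPolynomial.algebraMap_eq, h, AlgHom.commutes, AlgHom.commutes, S.δ_algebraMap]
  | add f g hf hg =>
    rw [hadd, map_add, map_add, map_add, S.δ_add, hf, hg, map_mul, AlgHom.commutes]
    have := map_carry (p := p) (freeLift S α (n + 1)).toRingHom (freeIncl R A n f)
      (freeIncl R A n g)
    erw [this]
    erw [freeLift_incl, freeLift_incl]
  | mul_X f ia hf =>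
    obtain ⟨i, a⟩ := ia
    rw [hmul, freeδ_X]
    simp only [map_add, map_mul, map_pow, AlgHom.commutes, freeLift_incl, hf, freeLift_X]
    rw [S.δ_mul, S.δ_elt (Nat.lt_succ_iff.mp i.2)]
    rfl

variable [CommRing A] [Algebra R A]

/-- The relations in higher order are generated by images of those in order `0` under `incl` and
`δ`, and the evaluation commutes with both. -/
theorem freeLift_eq_zero (α : A →ₐ[R] S.obj 0) (n : ℕ) :
    ∀ x ∈ jetIdeal D A n, freeLift S α n x = 0 := by
  induction n with
  | zero =>
    intro x hx
    have hx' : (MvPolynomial.aeval (fun ia => ia.2) : FreeObj R A 0 →ₐ[R] A) x = 0 := hx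
    have h := congrArg α hx'
    rw [map_zero] at h
    rw [← h]
    change freeLift S α 0 x =
      (α.comp (MvPolynomial.aeval (fun ia => ia.2) : FreeObj R A 0 →ₐ[R] A)) x
    congr 1
    ext ⟨i, a⟩
    simp [freeLift, elt]
  | succ n ih =>
    change jetIdeal D A (n + 1) ≤ RingHom.ker (freeLift S α (n + 1))
    refine Ideal.span_le.mpr ?_
    rintro _ (⟨x, hx, rfl⟩ | ⟨x, hx, rfl⟩)
    · change freeLift S α (n + 1) (freeIncl R A n x) = 0
      rw [freeLift_incl, ih x hx, map_zero]
    · change freeLift S α (n + 1) (freeδ D A n x) = 0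
      rw [freeLift_δ, ih x hx, S.δ_zero]

variable (D A) in
/-- The quotient map to the jet algebra. -/
def jetMk (n : ℕ) : FreeObj R A n →ₐ[R] (jet D A).obj n :=
  (Ideal.Quotient.mkₐ R (jetIdeal D A n) : FreeObj R A n →ₐ[R] FreeObj R A n ⧸ jetIdeal D A n)

theorem jetMk_surjective (n : ℕ) : Function.Surjective (jetMk D A n) :=
  Ideal.Quotient.mkₐ_surjective R (jetIdeal D A n)

theorem jetMk_eq_zero_iff {n : ℕ} {x : FreeObj R A n} :
    jetMk D A n x = 0 ↔ x ∈ jetIdeal D A n :=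
  Ideal.Quotient.eq_zero_iff_mem

/-- The relations in order `0` are exactly those holding in `A`; this is what makes `toJet` a
homomorphism. -/
theorem jetMk_zero_eq {x y : FreeObj R A 0}
    (h : (MvPolynomial.aeval (fun ia => ia.2) : FreeObj R A 0 →ₐ[R] A) x =
      (MvPolynomial.aeval (fun ia => ia.2) : FreeObj R A 0 →ₐ[R] A) y) :
    jetMk D A 0 x = jetMk D A 0 y := by
  rw [← sub_eq_zero, ← map_sub, jetMk_eq_zero_iff]
  change (MvPolynomial.aeval (fun ia => ia.2) : FreeObj R A 0 →ₐ[R] A) _ = 0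
  rw [map_sub, h, sub_self]

/-- The morphism from the jet sequence given by an algebra homomorphism in order `0`. -/
def jetLift (α : A →ₐ[R] S.obj 0) : Hom (jet D A) S where
  hom n := Ideal.Quotient.liftₐ (jetIdeal D A n) (freeLift S α n) (freeLift_eq_zero S α n)
  hom_incl n x := by
    obtain ⟨x, rfl⟩ := jetMk_surjective n x
    exact freeLift_incl S α n x
  hom_δ n x := by
    obtain ⟨x, rfl⟩ := jetMk_surjective n x
    exact freeLift_δ S α n x

theorem jetLift_toJet (α : A →ₐ[R] S.obj 0) (a : A) :
    (jetLift S α).hom 0 (toJet D A a) = α a :=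
  freeLift_X S α 0 0 a

variable (D A) in
/-- The canonical map `A → A^0` as an algebra homomorphism. -/
def toJetₐ : A →ₐ[R] (jet D A).obj 0 :=
  AlgHom.ofLinearMap
    { toFun := toJet D A
      map_add' := fun a b => (jetMk_zero_eq (by simp)).trans (map_add (jetMk D A 0) _ _)
      map_smul' := fun r a => (jetMk_zero_eq (by simp)).trans (map_smul (jetMk D A 0) r _) }
    ((jetMk_zero_eq (by simp)).trans (map_one (jetMk D A 0)))
    (fun a b => (jetMk_zero_eq (by simp)).trans (map_mul (jetMk D A 0) _ _))

theorem jetMk_X (n : ℕ) (i : Fin (n + 1)) (a : A) :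
    jetMk D A n (MvPolynomial.X (i, a)) =
      (jet D A).elt n i (toJet D A a) := by
  induction n with
  | zero =>
    obtain rfl : i = 0 := Fin.fin_one_eq_zero i
    rfl
  | succ n ih =>
    induction i using Fin.lastCases with
    | last =>
      have h : freeδ D A n (MvPolynomial.X (Fin.last n, a)) = MvPolynomial.X (Fin.last (n + 1), a) :=
        freeδ_X D A n _ a
      rw [← h]
      refine (congrArg ((jet D A).δ n) (ih (Fin.last n))).trans ?_
      exact δ_elt _ le_rfl _
    | cast i =>
      have h : freeIncl R A n (MvPolynomial.X (i, a)) = MvPolynomial.X (i.castSucc, a) := by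
        simp [freeIncl]
      rw [← h]
      refine (congrArg ((jet D A).incl n) (ih i)).trans ?_
      exact incl_elt _ (Nat.lt_succ_iff.mp i.2) _

/-- The jet algebra of order `n` is generated by the elements `δ ^ i a` for `i ≤ n`. -/
theorem jet_adjoin_elt (n : ℕ) :
    Algebra.adjoin R {x : (jet D A).obj n | ∃ i ≤ n, ∃ a, x = (jet D A).elt n i (toJet D A a)} =
      ⊤ := by
  refine top_unique ?_
  rintro x -
  obtain ⟨x, rfl⟩ := jetMk_surjective n x
  induction x using MvPolynomial.induction_on with
  | C r =>
    rw [← MvPolynomial.algebraMap_eq, AlgHom.commutes]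
    exact Subalgebra.algebraMap_mem _ r
  | add f g hf hg =>
    rw [map_add]
    exact add_mem hf hg
  | mul_X f ia hf =>
    rw [map_mul]
    refine mul_mem hf (Algebra.subset_adjoin ⟨ia.1, Nat.lt_succ_iff.mp ia.1.2, ia.2, ?_⟩)
    exact jetMk_X n ia.1 ia.2

theorem jet_algHom_ext {B : Type} [CommRing B] [Algebra R B] {n : ℕ}
    {f g : (jet D A).obj n →ₐ[R] B}
    (h : ∀ i ≤ n, ∀ a, f ((jet D A).elt n i (toJet D A a)) = g ((jet D A).elt n i (toJet D A a))) :
    f = g := by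
  refine AlgHom.ext_of_adjoin_eq_top (jet_adjoin_elt n) ?_
  rintro _ ⟨i, hi, a, rfl⟩
  exact h i hi a

/-- Uniqueness in the universal property: the generators `δ ^ i a` are determined by order `0`. -/
theorem jetHom_ext {S : Prolongation D} {f g : Hom (jet D A) S}
    (h : ∀ a, f.hom 0 (toJet D A a) = g.hom 0 (toJet D A a)) : f = g := by
  refine Hom.ext (funext fun n => jet_algHom_ext fun i _ a => ?_)
  rw [f.hom_elt, g.hom_elt, h]

end Universal

/-! ### Completions -/

namespace Prolongation

section ComplRing

variable {R : Type} [CommRing R] {p : ℕ} {A B : Type} [CommRing A] [Algebra R A] [CommRing B]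
  [Algebra R B]

/-- The canonical map to the `p`-adic completion. -/
def complOf (R : Type) [CommRing R] (p : ℕ) (A : Type) [CommRing A] [Algebra R A] :
    A →ₐ[R] Compl p A :=
  IsScalarTower.toAlgHom R A (Compl p A)

theorem complEval_complOf (m : ℕ) (a : A) :
    complEval p m A (complOf R p A a) = Ideal.Quotient.mk _ a :=
  AdicCompletion.evalₐ_of _ m _

theorem complMap_complOf (f : A →ₐ[R] B) (a : A) :
    complMap p f (complOf R p A a) = complOf R p B (f a) :=
  compl_ext fun m => by
    rw [complEval_complMap f m (complEval_complOf m a), complEval_complOf]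

/-- Completing along a finitely generated ideal gives a complete module; the ideal `(p)` of `A` is
then replaced by its extension to the completion. -/
instance compl_isAdicComplete : IsAdicComplete (Ideal.span {(p : Compl p A)}) (Compl p A) := by
  have h := AdicCompletion.isAdicComplete (I := Ideal.span {(p : A)}) (M := A)
    ⟨{(p : A)}, by simp⟩
  have h2 := (IsAdicComplete.map_algebraMap_iff (I := Ideal.span {(p : A)}) (M := Compl p A)
    (S := Compl p A)).mpr h
  rwa [Ideal.map_span, Set.image_singleton, map_natCast] at h2

/-- For a finitely generated ideal `I` the kernel of the projection modulo `I ^ m` is `I ^ m` times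
the completion. -/
theorem exists_eq_of_complEval_eq_zero {m : ℕ} {x : Compl p A} (h : complEval p m A x = 0) :
    ∃ y, x = (p : Compl p A) ^ m * y := by
  have h1 := AdicCompletion.pow_smul_top_eq_ker_eval (I := Ideal.span {(p : A)}) (M := A)
    (n := m) ⟨{(p : A)}, by simp⟩
  have h2 : x ∈ (AdicCompletion.eval (Ideal.span {(p : A)}) A m).ker := by
    rw [LinearMap.mem_ker]
    have := AdicCompletion.factor_evalₐ_eq_eval (I := Ideal.span {(p : A)}) (n := m) x (by simp)
    rw [← this]
    erw [h]
    simp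
  rw [← h1, Ideal.span_singleton_pow, Submodule.ideal_span_singleton_smul] at h2
  obtain ⟨y, -, hy⟩ := h2
  refine ⟨y, hy.symm.trans ?_⟩
  change (p : A) ^ m • y = _
  rw [Algebra.smul_def, map_pow, map_natCast]

theorem compl_exists_eq_add (R : Type) [CommRing R] [Algebra R A] (x : Compl p A) (m : ℕ) :
    ∃ (a : A) (y : Compl p A), x = complOf R p A a + (p : Compl p A) ^ m * y := by
  obtain ⟨a, ha⟩ := compl_exists_rep x m
  obtain ⟨y, hy⟩ := exists_eq_of_complEval_eq_zero (m := m) (x := x - complOf R p A a) (by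
    rw [map_sub, complEval_complOf, ha m le_rfl, sub_self])
  exact ⟨a, y, by rw [← hy]; ring⟩

theorem eq_zero_of_forall_pow_dvd [h : IsHausdorff (Ideal.span {(p : B)}) B] {x : B}
    (hx : ∀ m, (p : B) ^ m ∣ x) : x = 0 :=
  h.haus' x fun m => by
    rw [SModEq.zero, smul_eq_mul, Ideal.mul_top, Ideal.span_singleton_pow,
      Ideal.mem_span_singleton]
    exact hx m

/-- Ring homomorphisms to `p`-adically separated rings are continuous. -/
theorem compl_ringHom_ext [IsHausdorff (Ideal.span {(p : B)}) B] {f g : Compl p A →+* B}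
    (h : ∀ a, f (complOf A p A a) = g (complOf A p A a)) : f = g := by
  ext x
  rw [← sub_eq_zero]
  refine eq_zero_of_forall_pow_dvd (p := p) fun m => ?_
  obtain ⟨a, y, rfl⟩ := compl_exists_eq_add A x m
  refine ⟨f y - g y, ?_⟩
  simp only [map_add, map_mul, map_pow, map_natCast, h]
  ring

theorem complOf_bijective [IsAdicComplete (Ideal.span {(p : A)}) A] :
    Function.Bijective (complOf R p A) :=
  AdicCompletion.of_bijective (Ideal.span {(p : A)}) A

/-- The extension of a homomorphism to a `p`-adically complete ring. -/
def complLift [IsAdicComplete (Ideal.span {(p : B)}) B] (f : A →ₐ[R] B) : Compl p A →ₐ[R] B :=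
  (AlgEquiv.ofBijective (complOf R p B) complOf_bijective).symm.toAlgHom.comp (complMap p f)

theorem complLift_complOf [IsAdicComplete (Ideal.span {(p : B)}) B] (f : A →ₐ[R] B) (a : A) :
    complLift f (complOf R p A a) = f a := by
  change (AlgEquiv.ofBijective (complOf R p B) complOf_bijective).symm (complMap p f _) = _
  rw [complMap_complOf]
  exact (AlgEquiv.ofBijective (complOf R p B) complOf_bijective).symm_apply_apply _

/-- The map of `p`-adic completions is surjective if the map is surjective modulo `p`. -/
theorem complMap_surjective (f : A →ₐ[R] B) (h : ∀ b, ∃ a c, b = f a + p * c) :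
    Function.Surjective (complMap p f) := by
  have hc : IsAdicComplete (Ideal.span {(p : Compl p A)}) (Compl p A) := inferInstance
  have hB : IsHausdorff ((Ideal.span {(p : Compl p A)}).map (complMap p f).toRingHom)
      (Compl p B) := by
    rw [Ideal.map_span, Set.image_singleton, map_natCast]
    infer_instance
  -- Successive approximation: with a complete source and a separated target, surjectivity modulo
  -- `p` suffices.
  refine surjective_of_mk_map_comp_surjective (I := Ideal.span {(p : Compl p A)})
    (complMap p f).toRingHom ?_
  intro y
  obtain ⟨y, rfl⟩ := Ideal.Quotient.mk_surjective y
  obtain ⟨b, z, rfl⟩ := compl_exists_eq_add R y 1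
  obtain ⟨a, c, rfl⟩ := h b
  refine ⟨complOf R p A a, Ideal.Quotient.eq.mpr ?_⟩
  rw [Ideal.map_span, Set.image_singleton, map_natCast, Ideal.mem_span_singleton]
  refine ⟨-(complOf R p B c + z), ?_⟩
  change complMap p f _ - _ = _
  rw [complMap_complOf, map_add, map_mul, map_natCast]
  ring

end ComplRing

variable {p : ℕ} [Fact p.Prime] {R : Type} [CommRing R] {D : FrobeniusBase p R}

/-- The morphism from a prolongation sequence to its completion. -/
def toCompletion (S : Prolongation D) : Hom S S.completion where
  hom n := complOf R p (S.obj n)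
  hom_incl n x := (complMap_complOf (S.incl n) x).symm
  hom_δ n x := compl_ext fun m =>
    (complEval_complOf (R := R) m _).trans
      (complEval_complδ S n m (complEval_complOf (R := R) (m + 1) x)).symm

/-- The extension of a morphism to the completion, if the target is complete. -/
def completionLift {S T : Prolongation D}
    (hT : ∀ n, IsAdicComplete (Ideal.span {(p : T.obj n)}) (T.obj n)) (f : Hom S T) :
    Hom S.completion T :=
  (Hom.inv (toCompletion T) fun _ => complOf_bijective).comp (completionMap f)

theorem completionLift_complOf {S T : Prolongation D}
    (hT : ∀ n, IsAdicComplete (Ideal.span {(p : T.obj n)}) (T.obj n)) (f : Hom S T) (n : ℕ)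
    (x : S.obj n) : (completionLift hT f).hom n (complOf R p (S.obj n) x) = f.hom n x := by
  change (Hom.inv (toCompletion T) fun _ => complOf_bijective).hom n (complMap p (f.hom n) (complOf R p (S.obj n) x)) = _
  rw [complMap_complOf]
  exact Hom.hom_inv (toCompletion T) _ n _

end Prolongation

end ArithJet
end
noncomputable section
set_option linter.unusedSectionVars false
namespace ArithJet

/-! ### Localization of prolongation sequences -/

namespace Prolongation

variable {p : ℕ} [Fact p.Prime] {R : Type} [CommRing R] {D : FrobeniusBase p R}

/-- The map from order `0` to order `n`. -/
def inclIter (S : Prolongation D) : ∀ n, S.obj 0 →ₐ[R] S.obj n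
  | 0 => AlgHom.id R _
  | n + 1 => (S.incl n).comp (S.inclIter n)

theorem inclIter_eq_elt (S : Prolongation D) (n : ℕ) (x : S.obj 0) :
    S.inclIter n x = S.elt n 0 x := by
  induction n with
  | zero => rfl
  | succ n ih => rw [← S.incl_elt (Nat.zero_le n), ← ih]; rfl

theorem Hom.hom_inclIter {S T : Prolongation D} (f : Hom S T) (n : ℕ) (x : S.obj 0) :
    f.hom n (S.inclIter n x) = T.inclIter n (f.hom 0 x) := by
  rw [inclIter_eq_elt, inclIter_eq_elt, f.hom_elt]

theorem unif_mul_δ (S : Prolongation D) (n : ℕ) (x : S.obj n) :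
    algebraMap R _ D.unif * S.δ n x = S.frob n x - S.incl n x ^ p := by
  change _ = S.incl n x ^ p + algebraMap R _ D.unif * S.δ n x - S.incl n x ^ p
  ring

/-- `δ` is not additive, but the correction terms of the sum and product formulas are multiples of
images under `incl`, which already lie in `J`. Hence stability can be checked on generators. -/
theorem δ_mem_of_mem_span (S : Prolongation D) (n : ℕ) {s : Set (S.obj n)}
    {J : Ideal (S.obj (n + 1))} (h : ∀ b ∈ s, S.incl n b ∈ J) (h' : ∀ b ∈ s, S.δ n b ∈ J)
    {x : S.obj n} (hx : x ∈ Ideal.span s) : S.δ n x ∈ J := by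
  have hi : Ideal.span s ≤ J.comap (S.incl n) := Ideal.span_le.mpr h
  induction hx using Submodule.span_induction with
  | mem x hx => exact h' x hx
  | zero => rw [S.δ_zero]; exact J.zero_mem
  | add x y hx hy ihx ihy =>
    rw [S.δ_add]
    exact J.add_mem (J.add_mem ihx ihy) (J.mul_mem_left _ (carry_mem J _ (hi hy)))
  | smul a x hx ih =>
    rw [smul_eq_mul, S.δ_mul]
    refine J.add_mem (J.add_mem (J.mul_mem_left _ ih) (J.mul_mem_right _ ?_)) (J.mul_mem_left _ ih)
    exact J.pow_mem_of_mem (hi hx) _ (Fact.out : p.Prime).pos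

/-- The morphism to the quotient of a prolongation sequence. -/
def toQuot (S : Prolongation D) (I : ∀ n, Ideal (S.obj n)) (hI hI') : Hom S (S.quot I hI hI') where
  hom n := (Ideal.Quotient.mkₐ R (I n) : S.obj n →ₐ[R] S.obj n ⧸ I n)
  hom_incl _ _ := rfl
  hom_δ _ _ := rfl

section Localization

variable (S : Prolongation D)
  (hreg : ∀ n, algebraMap R (S.obj n) D.unif ∈ nonZeroDivisors (S.obj n))
  (M : ∀ n, Submonoid (S.obj n)) (hMi : ∀ n, M n ≤ (M (n + 1)).comap (S.incl n))
  (hMf : ∀ n, M n ≤ (M (n + 1)).comap (S.frob n))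

/-- The lift of Frobenius of a localization. -/
def localizationFrob (n : ℕ) : Localization (M n) →+* Localization (M (n + 1)) :=
  IsLocalization.map _ (S.frob n) (hMf n)

/-- The inclusion maps of a localization. -/
def localizationIncl (n : ℕ) : Localization (M n) →ₐ[R] Localization (M (n + 1)) where
  toRingHom := IsLocalization.map _ (S.incl n).toRingHom (hMi n)
  commutes' r := by
    rw [IsScalarTower.algebraMap_apply R (S.obj n) (Localization (M n)),
      IsScalarTower.algebraMap_apply R (S.obj (n + 1)) (Localization (M (n + 1))),
      ← (S.incl n).commutes]
    exact IsLocalization.map_eq (hMi n) _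

theorem localizationFrob_algebraMap (n : ℕ) (x : S.obj n) :
    localizationFrob S M hMf n (algebraMap _ _ x) = algebraMap _ _ (S.frob n x) :=
  IsLocalization.map_eq (hMf n) _

theorem localizationIncl_algebraMap (n : ℕ) (x : S.obj n) :
    localizationIncl S M hMi n (algebraMap _ _ x) = algebraMap _ _ (S.incl n x) :=
  IsLocalization.map_eq (hMi n) _

/-- The images of a denominator `s` are units, and clearing them reduces the claim to `φ a * s ^ p ≡
a ^ p * φ s`, which follows from `φ y ≡ y ^ p` modulo `unif`. -/
theorem localizationFrob_dvd (n : ℕ) (x : Localization (M n)) :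
    algebraMap R (Localization (M (n + 1))) D.unif ∣
      localizationFrob S M hMf n x - localizationIncl S M hMi n x ^ p := by
  obtain ⟨a, s, rfl⟩ := IsLocalization.exists_mk'_eq (M n) x
  have hs : IsUnit (algebraMap (S.obj (n + 1)) (Localization (M (n + 1))) (S.frob n s)) :=
    IsLocalization.map_units (Localization (M (n + 1))) ⟨S.frob n s, hMf n s.2⟩
  have hs' : IsUnit (algebraMap (S.obj (n + 1)) (Localization (M (n + 1))) (S.incl n s)) :=
    IsLocalization.map_units (Localization (M (n + 1))) ⟨S.incl n s, hMi n s.2⟩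
  have h1 : localizationFrob S M hMf n (IsLocalization.mk' (Localization (M n)) a s) *
      algebraMap (S.obj (n + 1)) (Localization (M (n + 1))) (S.frob n s) =
      algebraMap _ (Localization (M (n + 1))) (S.frob n a) := by
    rw [← localizationFrob_algebraMap S M hMf n s, ← map_mul, IsLocalization.mk'_spec,
      localizationFrob_algebraMap]
  have h2 : localizationIncl S M hMi n (IsLocalization.mk' (Localization (M n)) a s) *
      algebraMap (S.obj (n + 1)) (Localization (M (n + 1))) (S.incl n s) =
      algebraMap _ (Localization (M (n + 1))) (S.incl n a) := by
    rw [← localizationIncl_algebraMap S M hMi n s, ← map_mul, IsLocalization.mk'_spec,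
      localizationIncl_algebraMap]
  have e : ∀ y, S.frob n y = S.incl n y ^ p + algebraMap R _ D.unif * S.δ n y := fun y => rfl
  refine ((hs.mul (hs'.pow p)).dvd_mul_right).mp ?_
  set u := localizationFrob S M hMf n (IsLocalization.mk' (Localization (M n)) a s)
  set v := localizationIncl S M hMi n (IsLocalization.mk' (Localization (M n)) a s)
  have h3 : (u - v ^ p) * (algebraMap (S.obj (n + 1)) (Localization (M (n + 1))) (S.frob n s) *
      algebraMap (S.obj (n + 1)) (Localization (M (n + 1))) (S.incl n s) ^ p) =
      algebraMap (S.obj (n + 1)) (Localization (M (n + 1)))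
        (S.frob n a * S.incl n s ^ p - S.incl n a ^ p * S.frob n s) := by
    rw [map_sub, map_mul, map_mul, map_pow, map_pow, ← h1, ← h2]
    ring
  rw [h3, IsScalarTower.algebraMap_apply R (S.obj (n + 1)) (Localization (M (n + 1)))]
  refine map_dvd _ ⟨S.δ n a * S.incl n s ^ p - S.incl n a ^ p * S.δ n s, ?_⟩
  rw [e, e]
  ring

/-- The localization of a prolongation sequence without `unif`-torsion. -/
def localization : Prolongation D :=
  ofFrobenius (fun n => Localization (M n)) (localizationIncl S M hMi) (localizationFrob S M hMf)
    (fun n => by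
      rw [IsScalarTower.algebraMap_apply R (S.obj n) (Localization (M n))]
      exact IsLocalization.map_nonZeroDivisors_le (M n) (Localization (M n))
        (Submonoid.mem_map_of_mem _ (hreg n)))
    (fun n r => by
      rw [IsScalarTower.algebraMap_apply R (S.obj n) (Localization (M n)),
        localizationFrob_algebraMap, frob_algebraMap, ← IsScalarTower.algebraMap_apply])
    (fun n x => by
      refine congrArg (fun f : Localization (M n) →+* Localization (M (n + 1 + 1)) => f x)
        (a₁ := (localizationFrob S M hMf (n + 1)).comp (localizationIncl S M hMi n).toRingHom)
        (a₂ := (localizationIncl S M hMi (n + 1)).toRingHom.comp (localizationFrob S M hMf n)) ?_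
      refine IsLocalization.ringHom_ext (M n) (RingHom.ext fun a => ?_)
      change localizationFrob S M hMf (n + 1) (localizationIncl S M hMi n (algebraMap _ _ a)) =
        localizationIncl S M hMi (n + 1) (localizationFrob S M hMf n (algebraMap _ _ a))
      rw [localizationIncl_algebraMap, localizationFrob_algebraMap, localizationFrob_algebraMap,
        localizationIncl_algebraMap, S.frob_incl])
    (fun n x => (localizationFrob_dvd S M hMi hMf n x).choose)
    (fun n x => (localizationFrob_dvd S M hMi hMf n x).choose_spec.symm)

/-- The morphism to a localization. -/
def toLocalization : Hom S (localization S hreg M hMi hMf) where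
  hom n := IsScalarTower.toAlgHom R (S.obj n) (Localization (M n))
  hom_incl n x := (localizationIncl_algebraMap S M hMi n x).symm
  hom_δ n x := by
    have h : algebraMap R (Localization (M (n + 1))) D.unif ∈
        nonZeroDivisors (Localization (M (n + 1))) := by
      rw [IsScalarTower.algebraMap_apply R (S.obj (n + 1)) (Localization (M (n + 1)))]
      exact IsLocalization.map_nonZeroDivisors_le (M (n + 1)) (Localization (M (n + 1)))
        (Submonoid.mem_map_of_mem _ (hreg (n + 1)))
    refine (mul_cancel_left_mem_nonZeroDivisors h).mp ?_
    refine Eq.trans ?_ (localizationFrob_dvd S M hMi hMf n (algebraMap _ _ x)).choose_spec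
    rw [localizationFrob_algebraMap, localizationIncl_algebraMap, ← map_pow, ← map_sub,
      ← unif_mul_δ, map_mul, ← IsScalarTower.algebraMap_apply]
    rfl

end Localization

end Prolongation

/-! ### Jets of localizations -/

section JetLocalization

open Prolongation

variable {p : ℕ} [Fact p.Prime] {R : Type} [CommRing R] {D : FrobeniusBase p R}
  {A B : Type} [CommRing A] [Algebra R A] [CommRing B] [Algebra R B]

theorem jetMap_toJet (f : A →ₐ[R] B) (a : A) :
    (jetMap D f).hom 0 (toJet D A a) = toJet D B (f a) := by
  change jetMk D B 0 (MvPolynomial.rename (Prod.map id f) (MvPolynomial.X (0, a))) = _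
  rw [MvPolynomial.rename_X]
  rfl

variable (D) in
/-- Functions as functions on the jet space of order `n`. -/
def jetIncl (A : Type) [CommRing A] [Algebra R A] (n : ℕ) : A →ₐ[R] (jet D A).obj n :=
  ((jet D A).inclIter n).comp (toJetₐ D A)

theorem incl_jetIncl (n : ℕ) (a : A) :
    (jet D A).incl n (jetIncl D A n a) = jetIncl D A (n + 1) a := rfl

section

variable (D) (g : A) (m : ℕ)

/-- The ring `(A^n / p ^ m)[1 / g]`. -/
abbrev JetAway (n : ℕ) : Type :=
  Localization.Away (Ideal.Quotient.mk (Ideal.span {(p : (jet D A).obj n)} ^ m) (jetIncl D A n g))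

/-- The map from the jet algebra `A^n` to `(A^n / p ^ m)[1 / g]`. -/
def jetToAway (n : ℕ) : (jet D A).obj n →+* JetAway D g m n :=
  (algebraMap _ _).comp (Ideal.Quotient.mk (Ideal.span {(p : (jet D A).obj n)} ^ m))

/-- The map `(A^n / p ^ m)[1 / g] → (A^(n+1) / p ^ m)[1 / g]`. -/
def jetAwayIncl (n : ℕ) : JetAway D g m n →+* JetAway D g m (n + 1) :=
  IsLocalization.Away.lift
    (g := (algebraMap ((jet D A).obj (n + 1) ⧸ Ideal.span {(p : (jet D A).obj (n + 1))} ^ m)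
      (JetAway D g m (n + 1))).comp
      (Ideal.quotientMap _ ((jet D A).incl n).toRingHom (complMap_le p m _)))
    (Ideal.Quotient.mk (Ideal.span {(p : (jet D A).obj n)} ^ m) (jetIncl D A n g)) (by
      rw [RingHom.comp_apply, Ideal.quotientMap_mk]
      exact IsLocalization.Away.algebraMap_isUnit (S := JetAway D g m (n + 1))
        (Ideal.Quotient.mk (Ideal.span {(p : (jet D A).obj (n + 1))} ^ m) (jetIncl D A (n + 1) g)))

theorem jetAwayIncl_jetToAway (n : ℕ) (x : (jet D A).obj n) :
    jetAwayIncl D g m n (jetToAway D g m n x) = jetToAway D g m (n + 1) ((jet D A).incl n x) :=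
  IsLocalization.Away.lift_eq _ _ _

theorem jetToAway_eq_zero {n : ℕ} {x : (jet D A).obj n}
    (h : x ∈ Ideal.span {(p : (jet D A).obj n)} ^ m) : jetToAway D g m n x = 0 := by
  rw [jetToAway, RingHom.comp_apply, Ideal.Quotient.eq_zero_iff_mem.mpr h, map_zero]

theorem exists_pow_mul_mem {n : ℕ} {x : (jet D A).obj n} (h : jetToAway D g m n x = 0) :
    ∃ N, jetIncl D A n (g ^ N) * x ∈ Ideal.span {(p : (jet D A).obj n)} ^ m := by
  obtain ⟨⟨_, N, rfl⟩, hN⟩ := (IsLocalization.map_eq_zero_iff (Submonoid.powers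
    (Ideal.Quotient.mk (Ideal.span {(p : (jet D A).obj n)} ^ m) (jetIncl D A n g)))
    (JetAway D g m n) _).mp h
  refine ⟨N, ?_⟩
  rw [← Ideal.Quotient.eq_zero_iff_mem, map_mul, map_pow, map_pow]
  exact hN

/-- The polynomials in the symbols `δ ^ i a` which become invertible in `(A^n / p ^ m)[1 / g]`. -/
def freeUnits (n : ℕ) : Submonoid ((freeProlongation D A).obj n) :=
  (IsUnit.submonoid (JetAway D g m n)).comap
    ((jetToAway D g m n).comp (jetMk D A n).toRingHom : FreeObj R A n →+* JetAway D g m n)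

theorem freeUnits_incl (n : ℕ) :
    freeUnits D g m n ≤ (freeUnits D g m (n + 1)).comap ((freeProlongation D A).incl n) :=
  fun x (hx : IsUnit (jetToAway D g m n (jetMk D A n x))) => by
    have h := hx.map (jetAwayIncl D g m n)
    rw [jetAwayIncl_jetToAway] at h
    exact h

/-- As `p` divides a power of `unif`, the latter is nilpotent modulo `p ^ m`. So `φ x` differs from
the unit `x ^ p` by a nilpotent. -/
theorem freeUnits_frob (hD : ∃ e, (p : R) ∣ D.unif ^ e) (n : ℕ) :
    freeUnits D g m n ≤ (freeUnits D g m (n + 1)).comap ((freeProlongation D A).frob n) :=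
  fun x hx => by
    have h : IsUnit (jetToAway D g m (n + 1) (jetMk D A (n + 1) (freeIncl R A n x))) :=
      freeUnits_incl D g m n hx
    change IsUnit (jetToAway D g m (n + 1) (jetMk D A (n + 1)
      (freeIncl R A n x ^ p + algebraMap R (FreeObj R A (n + 1)) D.unif * freeδ D A n x)))
    rw [map_add, map_add, map_pow, map_pow, map_mul, map_mul]
    refine IsNilpotent.isUnit_add_left_of_commute ?_ (h.pow p) (Commute.all _ _)
    refine Commute.isNilpotent_mul_right (Commute.all _ _) ?_
    obtain ⟨e, c, hc⟩ := hD
    refine ⟨e * m, ?_⟩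
    rw [← map_pow, ← map_pow, ← map_pow, pow_mul, hc, AlgHom.commutes]
    refine jetToAway_eq_zero D g m ?_
    rw [mul_pow, map_mul, map_pow, map_natCast]
    exact Ideal.mul_mem_right _ _ (Ideal.pow_mem_pow (Ideal.mem_span_singleton_self _) m)

end

/-- An element of the jet algebra of `A` that vanishes modulo `p ^ m` on the jet space of the
open `g ≠ 0` is annihilated by a power of `g` modulo `p ^ m`. -/
theorem exists_pow_mul_mem_of_jetMap_mem (hD : ∃ e, (p : R) ∣ D.unif ^ e) (g : A)
    (β : A →ₐ[R] B) (hβ : @IsLocalization.Away A _ g B _ β.toRingHom.toAlgebra) (m : ℕ) {n : ℕ}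
    {x : (jet D A).obj n}
    (hx : (jetMap D β).hom n x ∈ Ideal.span {(p : (jet D B).obj n)} ^ m) :
    ∃ N, jetIncl D A n (g ^ N) * x ∈ Ideal.span {(p : (jet D A).obj n)} ^ m := by
  let : Algebra A B := β.toRingHom.toAlgebra
  let F := freeProlongation D A
  -- The jets of `A` may have `unif`-torsion, in which case Frobenius does not determine `δ`. The
  -- localization is therefore performed on the free sequence, and the relations are imposed
  -- afterwards.
  let L : Prolongation D := localization F (free_reg D A) (freeUnits D g m)
    (freeUnits_incl D g m) (freeUnits_frob D g m hD)
  let ℓ : Hom F L := toLocalization F (free_reg D A) (freeUnits D g m)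
    (freeUnits_incl D g m) (freeUnits_frob D g m hD)
  let I : ∀ n, Ideal (F.obj n) := jetIdeal D A
  have hI1 : ∀ n, ∀ x ∈ I n, F.incl n x ∈ I (n + 1) :=
    fun _ x hx => Ideal.subset_span (Or.inl ⟨x, hx, rfl⟩)
  have hI2 : ∀ n, ∀ x ∈ I n, F.δ n x ∈ I (n + 1) :=
    fun _ x hx => Ideal.subset_span (Or.inr ⟨x, hx, rfl⟩)
  let IL : ∀ n, Ideal (L.obj n) := fun n => (I n).map (ℓ.hom n).toRingHom
  have hmem : ∀ n, ∀ x ∈ I n, ℓ.hom n x ∈ IL n := fun n x hx => Ideal.mem_map_of_mem _ hx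
  have h1 : ∀ n, ∀ x ∈ IL n, L.incl n x ∈ IL (n + 1) := fun n => by
    change IL n ≤ (IL (n + 1)).comap (L.incl n)
    refine Ideal.map_le_iff_le_comap.mpr fun x hx => ?_
    have : L.incl n (ℓ.hom n x) ∈ IL (n + 1) := by
      rw [← ℓ.hom_incl]
      exact hmem _ _ (hI1 n x hx)
    exact this
  have h2 : ∀ n, ∀ x ∈ IL n, L.δ n x ∈ IL (n + 1) := fun n x hx => by
    refine δ_mem_of_mem_span L n (s := (ℓ.hom n).toRingHom '' I n) ?_ ?_ hx
    · rintro _ ⟨b, hb, rfl⟩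
      exact h1 n _ (hmem n b hb)
    · rintro _ ⟨b, hb, rfl⟩
      have : L.δ n (ℓ.hom n b) ∈ IL (n + 1) := by
        rw [← ℓ.hom_δ]
        exact hmem _ _ (hI2 n b hb)
      exact this
  let T : Prolongation D := L.quot IL h1 h2
  let τ : Hom (jet D A) T := quotMap ℓ I IL _ _ _ _ hmem
  -- the map from `T` to `(A^n / p ^ m)[1 / g]`
  let κ : F.obj n →+* JetAway D g m n := (jetToAway D g m n).comp (jetMk D A n).toRingHom
  let lift : L.obj n →+* JetAway D g m n :=
    IsLocalization.lift (M := freeUnits D g m n) (S := Localization (freeUnits D g m n))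
      (g := κ) (fun y => y.2)
  have hlift : ∀ y, lift (ℓ.hom n y) = κ y := fun y =>
    IsLocalization.lift_eq (M := freeUnits D g m n) (S := Localization (freeUnits D g m n)) _ y
  let ψ : T.obj n →+* JetAway D g m n := Ideal.Quotient.lift (IL n) lift (by
    change IL n ≤ RingHom.ker lift
    refine Ideal.map_le_iff_le_comap.mpr fun y hy => ?_
    have hy' : jetMk D A n y = 0 := jetMk_eq_zero_iff.mpr hy
    have : lift (ℓ.hom n y) = 0 := by
      rw [hlift]
      change jetToAway D g m n (jetMk D A n y) = 0
      rw [hy', map_zero]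
    exact this)
  have hψ : ∀ y, ψ (τ.hom n y) = jetToAway D g m n y := fun y => by
    obtain ⟨y, rfl⟩ := jetMk_surjective n y
    exact hlift y
  -- the map from `B`
  let α : A →ₐ[R] T.obj 0 := (τ.hom 0).comp (toJetₐ D A)
  have hα : IsUnit (α.toRingHom g) := by
    have hg : (MvPolynomial.X (0, g) : FreeObj R A 0) ∈ freeUnits D g m 0 :=
      IsLocalization.Away.algebraMap_isUnit (S := JetAway D g m 0)
        (Ideal.Quotient.mk (Ideal.span {(p : (jet D A).obj 0)} ^ m) (jetIncl D A 0 g))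
    have hu : ∀ y : freeUnits D g m 0, IsUnit (ℓ.hom 0 y) := fun y =>
      IsLocalization.map_units (Localization (freeUnits D g m 0)) y
    exact (hu ⟨_, hg⟩).map ((toQuot L IL h1 h2).hom 0)
  let αB : B →ₐ[R] T.obj 0 :=
    { toRingHom := IsLocalization.Away.lift (S := B) g hα
      commutes' := fun r => by
        have e : algebraMap R B r = algebraMap A B (algebraMap R A r) := (β.commutes r).symm
        rw [e]
        exact (IsLocalization.Away.lift_eq g hα _).trans (α.commutes r) }
  have hαB : ∀ a, αB (β a) = α a := fun a => IsLocalization.Away.lift_eq g hα a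
  -- By universality `τ` factors through the jets of `B`. Vanishing of `x` modulo `p ^ m` on the
  -- jets of `B` thus forces vanishing in `(A^n / p ^ m)[1 / g]`.
  have hcomp : (jetLift T αB).comp (jetMap D β) = τ := jetHom_ext fun a => by
    change (jetLift T αB).hom 0 ((jetMap D β).hom 0 (toJet D A a)) = _
    rw [jetMap_toJet, jetLift_toJet, hαB]
    rfl
  refine exists_pow_mul_mem D g m ?_
  rw [← hψ, ← hcomp]
  change ψ ((jetLift T αB).hom n ((jetMap D β).hom n x)) = 0
  rw [Ideal.span_singleton_pow, Ideal.mem_span_singleton] at hx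
  obtain ⟨y, hy⟩ := hx
  rw [hy, map_mul, map_mul, map_pow, map_pow, map_natCast, map_natCast]
  have h0 := jetToAway_eq_zero D g m (n := n) (x := (p : (jet D A).obj n) ^ m)
    (Ideal.pow_mem_pow (Ideal.mem_span_singleton_self _) m)
  rw [map_pow, map_natCast] at h0
  rw [h0, zero_mul]

/-- Functions on the completed jet spaces vanish if they vanish on an affine open cover. -/
theorem eq_zero_of_forall_completionMap_eq_zero (hD : ∃ e, (p : R) ∣ D.unif ^ e) {ι : Type}
    (g : ι → A) (hg : Ideal.span (Set.range g) = ⊤) (B : ι → Type) [∀ i, CommRing (B i)]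
    [∀ i, Algebra R (B i)] (β : ∀ i, A →ₐ[R] B i)
    (hβ : ∀ i, @IsLocalization.Away A _ (g i) (B i) _ (β i).toRingHom.toAlgebra) {n : ℕ}
    (x : (jet D A).completion.obj n)
    (hx : ∀ i, (completionMap (jetMap D (β i))).hom n x = 0) : x = 0 := by
  refine compl_ext fun m => ?_
  obtain ⟨a, ha⟩ := compl_exists_rep x m
  refine Eq.trans ?_ (map_zero (complEval p m ((jet D A).obj n))).symm
  rw [ha m le_rfl, Ideal.Quotient.eq_zero_iff_mem]
  -- The functions on `A` that kill the given element modulo `p ^ m` form an ideal. It contains a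
  -- power of every `g i`, so its radical, and hence the ideal itself, is everything.
  let J : Ideal A := (Submodule.colon (Ideal.span {(p : (jet D A).obj n)} ^ m) {a}).comap
    (jetIncl D A n)
  have hJ : ∀ b, b ∈ J ↔ jetIncl D A n b * a ∈ Ideal.span {(p : (jet D A).obj n)} ^ m := by
    intro b
    rw [Ideal.mem_comap, Submodule.mem_colon_singleton, smul_eq_mul]
  have h1 : J = ⊤ := by
    rw [← Ideal.radical_eq_top, ← top_le_iff, ← hg, Ideal.span_le]
    rintro _ ⟨i, rfl⟩
    have h := congrArg (complEval p m _) (hx i)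
    have h' : complEval p m ((jet D (B i)).obj n) (complMap p ((jetMap D (β i)).hom n) x) = 0 :=
      h.trans (map_zero _)
    rw [complEval_complMap _ m (ha m le_rfl), Ideal.Quotient.eq_zero_iff_mem] at h'
    obtain ⟨N, hN⟩ := exists_pow_mul_mem_of_jetMap_mem hD (g i) (β i) (hβ i) m h'
    exact ⟨N, (hJ _).mpr hN⟩
  have h2 := (hJ 1).mp (h1 ▸ Submodule.mem_top)
  rwa [map_one, one_mul] at h2

end JetLocalization

end ArithJet
end
noncomputable section
set_option linter.unusedSectionVars false
namespace ArithJet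

/-! ### Generators of jet algebras -/

/-- A family of elements `x` of an `R`-algebra determines derivations if derivations over `R` that
vanish on `x` vanish. -/
def DeterminesDerivations (R : Type) [CommRing R] {A ι : Type} [CommRing A] [Algebra R A]
    (x : ι → A) : Prop :=
  ∀ (Q : Type) [AddCommGroup Q] [Module A Q] (d : A →+ Q),
    (∀ a b, d (a * b) = a • d b + b • d a) → (∀ r, d (algebraMap R A r) = 0) →
      (∀ j, d (x j) = 0) → ∀ a, d a = 0

/-- A derivation vanishing on the coordinates is linear over the polynomial ring, so it factors
through the relative Kähler differentials, which are zero. -/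
theorem determinesDerivations_of_formallyUnramified {R A ι : Type} [CommRing R] [CommRing A]
    [Algebra R A] [Algebra (MvPolynomial ι R) A] [IsScalarTower R (MvPolynomial ι R) A]
    [Algebra.FormallyUnramified (MvPolynomial ι R) A] :
    DeterminesDerivations R (fun j : ι => algebraMap (MvPolynomial ι R) A (MvPolynomial.X j)) := by
  intro Q _ _ d hmul hR hx a
  let : Module (MvPolynomial ι R) Q := Module.compHom Q (algebraMap (MvPolynomial ι R) A)
  have : IsScalarTower (MvPolynomial ι R) A Q :=
    ⟨fun r a q => by rw [Algebra.smul_def, mul_smul]; rfl⟩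
  have hP : ∀ f : MvPolynomial ι R, d (algebraMap _ A f) = 0 := by
    intro f
    induction f using MvPolynomial.induction_on with
    | C r =>
      rw [← MvPolynomial.algebraMap_eq, ← IsScalarTower.algebraMap_apply]
      exact hR r
    | add f g hf hg => rw [map_add, map_add, hf, hg, add_zero]
    | mul_X f j hf => rw [map_mul, hmul, hf, hx, smul_zero, smul_zero, add_zero]
  let d' : Derivation (MvPolynomial ι R) A Q := Derivation.mk'
    { toFun := d
      map_add' := map_add d
      map_smul' := fun f a => by
        rw [Algebra.smul_def, hmul, hP, smul_zero, add_zero]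
        rfl } hmul
  change d' a = 0
  rw [← Derivation.liftKaehlerDifferential_comp_D d' a,
    Subsingleton.elim (KaehlerDifferential.D (MvPolynomial ι R) A a) 0, map_zero]

/-- Transfers coordinates to a base change: a derivation of `A'` restricts along `f` to a derivation
of `A`, which vanishes, and `A'` is generated by `R'` and the image of `f`. -/
theorem DeterminesDerivations.of_adjoin_eq_top {R R' A A' ι : Type} [CommRing R] [CommRing R']
    [CommRing A] [CommRing A'] [Algebra R A] [Algebra R R'] [Algebra R' A'] [Algebra R A']
    [IsScalarTower R R' A'] {x : ι → A} (hx : DeterminesDerivations R x) (f : A →ₐ[R] A')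
    (hf : Algebra.adjoin R' (Set.range f) = ⊤) : DeterminesDerivations R' fun j => f (x j) := by
  intro Q _ _ d hmul hR hxj a
  let : Module A Q := Module.compHom Q f.toRingHom
  have h0 : ∀ b, d (f b) = 0 := hx Q (d.comp f.toRingHom.toAddMonoidHom)
    (fun a b => by
      change d (f (a * b)) = f a • d (f b) + f b • d (f a)
      rw [map_mul, hmul])
    (fun r => by
      change d (f (algebraMap R A r)) = 0
      rw [f.commutes, IsScalarTower.algebraMap_apply R R' A']
      exact hR _) hxj
  have ha : a ∈ Algebra.adjoin R' (Set.range f) := hf ▸ Algebra.mem_top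
  induction ha using Algebra.adjoin_induction with
  | mem b hb =>
    obtain ⟨b, rfl⟩ := hb
    exact h0 b
  | algebraMap r => exact hR r
  | add b c _ _ hb hc => rw [map_add, hb, hc, add_zero]
  | mul b c _ _ hb hc => rw [hmul, hb, hc, smul_zero, smul_zero, add_zero]

/-- The `p`-power map of a ring of characteristic `p`. -/
def powHom (p : ℕ) [Fact p.Prime] {C : Type} [CommRing C] (h : (p : C) = 0) : C →+* C where
  toFun x := x ^ p
  map_one' := one_pow p
  map_mul' x y := mul_pow x y p
  map_zero' := zero_pow (Fact.out : p.Prime).ne_zero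
  map_add' x y := by
    have := mul_carry (p := p) x y
    rw [h, zero_mul] at this
    linear_combination this

section Generators

open Prolongation

variable {p : ℕ} [Fact p.Prime] {R : Type} [CommRing R] (D : FrobeniusBase p R)
  {A : Type} [CommRing A] [Algebra R A] {ι : Type} (x : ι → A)

/-- The map from the polynomial ring over `A` in the symbols `δ ^ i x_j`, for `1 ≤ i ≤ n`, to the
jet algebra of order `n`. -/
def genMap (n : ℕ) : MvPolynomial (Fin n × ι) A →ₐ[R] (jet D A).obj n :=
  MvPolynomial.aevalTower (jetIncl D A n)
    fun ij => (jet D A).elt n (ij.1 + 1) (toJet D A (x ij.2))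

theorem genMap_C (n : ℕ) (a : A) : genMap D x n (MvPolynomial.C a) = jetIncl D A n a :=
  MvPolynomial.aevalTower_C _ _ _

theorem genMap_X (n : ℕ) (ij : Fin n × ι) :
    genMap D x n (MvPolynomial.X ij) = (jet D A).elt n (ij.1 + 1) (toJet D A (x ij.2)) :=
  MvPolynomial.aevalTower_X _ _ _

theorem incl_genMap (n : ℕ) (c : MvPolynomial (Fin n × ι) A) :
    (jet D A).incl n (genMap D x n c) =
      genMap D x (n + 1) (MvPolynomial.rename (Prod.map Fin.castSucc id) c) := by
  induction c using MvPolynomial.induction_on with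
  | C a => rw [MvPolynomial.rename_C, genMap_C, genMap_C, incl_jetIncl]
  | add f g hf hg => simp only [map_add, hf, hg]
  | mul_X f ij hf =>
    rw [map_mul, map_mul, map_mul, map_mul, hf, MvPolynomial.rename_X, genMap_X, genMap_X,
      incl_elt _ (by omega)]
    rfl

/-- The subalgebra of elements which are generated modulo `unif` by `A` and the `δ ^ i x_j`. -/
def genSub (n : ℕ) : Subalgebra R ((jet D A).obj n) :=
  ((genMap D x n).range.map
    (Ideal.Quotient.mkₐ R (Ideal.span {algebraMap R ((jet D A).obj n) D.unif}))).comap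
      (Ideal.Quotient.mkₐ R (Ideal.span {algebraMap R ((jet D A).obj n) D.unif}))

theorem mem_genSub {n : ℕ} {b : (jet D A).obj n} :
    b ∈ genSub D x n ↔ ∃ c d, b = genMap D x n c + algebraMap R _ D.unif * d := by
  constructor
  · rintro ⟨_, ⟨c, rfl⟩, hc⟩
    obtain ⟨d, hd⟩ := Ideal.mem_span_singleton.mp (Ideal.Quotient.eq.mp hc.symm)
    exact ⟨c, d, by rw [← hd]; simp⟩
  · rintro ⟨c, d, rfl⟩
    refine ⟨_, ⟨c, rfl⟩, Ideal.Quotient.eq.mpr (Ideal.mem_span_singleton.mpr ⟨-d, ?_⟩)⟩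
    simp

theorem genMap_mem (n : ℕ) (c : MvPolynomial (Fin n × ι) A) : genMap D x n c ∈ genSub D x n :=
  (mem_genSub D x).mpr ⟨c, 0, by simp⟩

theorem unif_mul_mem (n : ℕ) (d : (jet D A).obj n) :
    algebraMap R _ D.unif * d ∈ genSub D x n :=
  (mem_genSub D x).mpr ⟨0, d, by simp⟩

theorem incl_mem_genSub {n : ℕ} {b : (jet D A).obj n} (hb : b ∈ genSub D x n) :
    (jet D A).incl n b ∈ genSub D x (n + 1) := by
  obtain ⟨c, d, rfl⟩ := (mem_genSub D x).mp hb
  rw [map_add, incl_genMap, map_mul, AlgHom.commutes]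
  exact add_mem (genMap_mem D x _ _) (unif_mul_mem D x _ _)

variable {x}

section Step

variable {n : ℕ} (hn : ∀ u, (jet D A).incl n u ∈ genSub D x (n + 1))
include hn

/-- The correction term is the image under `incl` of an element of order `n`, up to a factor from
the base. -/
theorem δ_add_mem {u v : (jet D A).obj n} (hu : (jet D A).δ n u ∈ genSub D x (n + 1))
    (hv : (jet D A).δ n v ∈ genSub D x (n + 1)) : (jet D A).δ n (u + v) ∈ genSub D x (n + 1) := by
  rw [(jet D A).δ_add]
  refine add_mem (add_mem hu hv) (mul_mem (Subalgebra.algebraMap_mem _ _) ?_)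
  have := map_carry (p := p) ((jet D A).incl n).toRingHom u v
  exact this ▸ hn _

theorem δ_mul_mem {u v : (jet D A).obj n} (hu : (jet D A).δ n u ∈ genSub D x (n + 1))
    (hv : (jet D A).δ n v ∈ genSub D x (n + 1)) : (jet D A).δ n (u * v) ∈ genSub D x (n + 1) := by
  rw [(jet D A).δ_mul]
  exact add_mem (add_mem (mul_mem (pow_mem (hn _) _) hv) (mul_mem (pow_mem (hn _) _) hu))
    (mul_mem (mul_mem (Subalgebra.algebraMap_mem _ _) hu) hv)

/-- Modulo `unif` the last term of the product formula disappears, and modulo `genSub` the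
correction to additivity does. So `a ↦ δ a` becomes a derivation into a module twisted by the
`p`-power map. It kills `R` and the `x j`, hence everything. -/
theorem δ_jetIncl_mem (hx : DeterminesDerivations R x) (a : A) :
    (jet D A).δ n (jetIncl D A n a) ∈ genSub D x (n + 1) := by
  let S := jet D A
  let C : Type := S.obj (n + 1) ⧸ Ideal.span {algebraMap R (S.obj (n + 1)) D.unif}
  let q : S.obj (n + 1) →+* C := Ideal.Quotient.mk _
  have hqu : q (algebraMap R _ D.unif) = 0 :=
    Ideal.Quotient.eq_zero_iff_mem.mpr (Ideal.mem_span_singleton_self _)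
  have hpC : (p : C) = 0 := by
    have := congrArg q (unif_dvd_p (D := D) (S.obj (n + 1)))
    rw [map_mul, hqu, mul_zero, map_natCast] at this
    exact this.symm
  -- `a` acts as multiplication by `a ^ p`, so that `δ (a b) = a ^ p δ b + b ^ p δ a` is the Leibniz
  -- rule. The power map is additive because `p = 0` in `C`.
  let : Algebra A C := ((powHom p hpC).comp (q.comp (jetIncl D A (n + 1)).toRingHom)).toAlgebra
  have hsmul : ∀ (a : A) (c : C), a • c = q (jetIncl D A (n + 1) a) ^ p * c := fun a c => rfl
  let N : Submodule A C :=
    { carrier := q '' (genSub D x (n + 1))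
      add_mem' := by
        rintro _ _ ⟨u, hu, rfl⟩ ⟨v, hv, rfl⟩
        exact ⟨u + v, add_mem hu hv, map_add _ _ _⟩
      zero_mem' := ⟨0, zero_mem _, map_zero _⟩
      smul_mem' := by
        rintro a _ ⟨u, hu, rfl⟩
        refine ⟨jetIncl D A (n + 1) a ^ p * u, mul_mem (pow_mem (hn _) _) hu, ?_⟩
        rw [hsmul, map_mul, map_pow] }
  have hN : ∀ u, q u ∈ N ↔ u ∈ genSub D x (n + 1) := by
    refine fun u => ⟨?_, fun hu => ⟨u, hu, rfl⟩⟩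
    rintro ⟨v, hv, hvu⟩
    obtain ⟨d, hd⟩ := Ideal.mem_span_singleton.mp (Ideal.Quotient.eq.mp hvu.symm)
    have : u = v + algebraMap R _ D.unif * d := by rw [← hd]; ring
    rw [this]
    exact add_mem hv (unif_mul_mem D x _ _)
  let d : A →+ C ⧸ N :=
    { toFun := fun a => N.mkQ (q (S.δ n (jetIncl D A n a)))
      map_zero' := by rw [map_zero, S.δ_zero, map_zero, map_zero]
      map_add' := fun a b => by
        rw [← map_add N.mkQ, ← map_add q, ← sub_eq_zero, ← map_sub, ← map_sub,
          Submodule.mkQ_apply, Submodule.Quotient.mk_eq_zero, hN, map_add, S.δ_add]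
        have h := map_carry (p := p) (S.incl n).toRingHom (jetIncl D A n a) (jetIncl D A n b)
        have h1 : algebraMap R _ D.ratio * carry p (S.incl n (jetIncl D A n a))
            (S.incl n (jetIncl D A n b)) ∈ genSub D x (n + 1) :=
          mul_mem (Subalgebra.algebraMap_mem _ _) (h ▸ hn _)
        convert h1 using 1
        ring }
  have hd : ∀ a, d a = 0 ↔ S.δ n (jetIncl D A n a) ∈ genSub D x (n + 1) := fun a => by
    rw [← hN, ← Submodule.Quotient.mk_eq_zero]
    rfl
  rw [← hd]
  refine hx (C ⧸ N) d (fun a b => ?_) (fun r => ?_) (fun j => ?_) a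
  · change N.mkQ _ = a • N.mkQ _ + b • N.mkQ _
    rw [map_mul, S.δ_mul, ← map_smul N.mkQ, ← map_smul N.mkQ, ← map_add N.mkQ, hsmul, hsmul]
    congr 1
    rw [map_add, map_add, map_mul, map_mul, map_mul, map_mul, hqu, zero_mul, zero_mul, add_zero,
      map_pow, map_pow]
    rfl
  · rw [hd, AlgHom.commutes, S.δ_algebraMap]
    exact Subalgebra.algebraMap_mem _ _
  · rw [hd]
    have h : S.δ n (jetIncl D A n (x j)) =
        genMap D x (n + 1) (MvPolynomial.X (0, j)) := by
      change S.δ n (S.inclIter n (toJet D A (x j))) = _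
      rw [inclIter_eq_elt, δ_elt _ (Nat.zero_le n), genMap_X]
      rfl
    rw [h]
    exact genMap_mem D x _ _

end Step

/-- By induction on the order: once order `n` is generated modulo `unif`, it is enough to apply `δ`
to the generators and to multiples of `unif`. -/
theorem genSub_eq_top (hx : DeterminesDerivations R x) (n : ℕ) : genSub D x n = ⊤ := by
  induction n with
  | zero =>
    rw [← top_le_iff, ← jet_adjoin_elt, Algebra.adjoin_le_iff]
    rintro _ ⟨i, hi, a, rfl⟩
    have := genMap_mem D x 0 (MvPolynomial.C a)
    rw [genMap_C] at this
    exact this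
  | succ n ih =>
    have hn : ∀ u, (jet D A).incl n u ∈ genSub D x (n + 1) := fun u =>
      incl_mem_genSub D x (ih ▸ Algebra.mem_top)
    have hgen : ∀ c, (jet D A).δ n (genMap D x n c) ∈ genSub D x (n + 1) := by
      intro c
      induction c using MvPolynomial.induction_on with
      | C a =>
        rw [genMap_C]
        exact δ_jetIncl_mem D hn hx a
      | add f g hf hg =>
        rw [map_add]
        exact δ_add_mem D hn hf hg
      | mul_X f ij hf =>
        rw [map_mul]
        refine δ_mul_mem D hn hf ?_
        rw [genMap_X, δ_elt _ (by omega)]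
        have := genMap_mem D x (n + 1) (MvPolynomial.X (ij.1.succ, ij.2))
        rw [genMap_X] at this
        simpa using this
    have hδ : ∀ u, (jet D A).δ n u ∈ genSub D x (n + 1) := by
      intro u
      obtain ⟨c, d, rfl⟩ := (mem_genSub D x (b := u)).mp (ih ▸ Algebra.mem_top)
      refine δ_add_mem D hn (hgen c) ?_
      -- In `δ (unif * d)` two of the three terms are multiples of `unif`; the third is `d ^ p`
      -- times an element of the base.
      rw [(jet D A).δ_mul, (jet D A).δ_algebraMap, AlgHom.commutes]
      refine add_mem (add_mem ?_ (mul_mem (pow_mem (hn _) _) (Subalgebra.algebraMap_mem _ _))) ?_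
      · rw [← mul_pow_sub_one (Fact.out : p.Prime).ne_zero, mul_assoc]
        exact unif_mul_mem D x _ _
      · rw [mul_assoc]
        exact unif_mul_mem D x _ _
    rw [← top_le_iff, ← jet_adjoin_elt, Algebra.adjoin_le_iff]
    rintro _ ⟨i, hi, a, rfl⟩
    by_cases h : i ≤ n
    · rw [SetLike.mem_coe, ← incl_elt _ h]
      exact hn _
    · rw [SetLike.mem_coe, elt, if_neg h]
      exact hδ _

/-- Generation modulo `unif` is iterated to generation modulo `unif ^ e`, a multiple of `p`. -/
theorem exists_eq_genMap_add (hD : ∃ e, (p : R) ∣ D.unif ^ e) (hx : DeterminesDerivations R x)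
    (n : ℕ) (b : (jet D A).obj n) : ∃ c d, b = genMap D x n c + p * d := by
  have key : ∀ (k : ℕ) (b : (jet D A).obj n),
      ∃ c d, b = genMap D x n c + algebraMap R _ D.unif ^ k * d := by
    intro k
    induction k with
    | zero => exact fun b => ⟨0, b, by simp⟩
    | succ k ih =>
      intro b
      obtain ⟨c, d, rfl⟩ := ih b
      obtain ⟨c', d', rfl⟩ := (mem_genSub D x (b := d)).mp (genSub_eq_top D hx n ▸ Algebra.mem_top)
      refine ⟨c + algebraMap R _ D.unif ^ k * c', d', ?_⟩
      rw [map_add, map_mul, map_pow, AlgHom.commutes]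
      ring
  obtain ⟨e, u, hu⟩ := hD
  obtain ⟨c, d, rfl⟩ := key e b
  refine ⟨c, algebraMap R _ u * d, ?_⟩
  rw [← map_pow, hu, map_mul, map_natCast]
  ring

/-- The completed jet algebra of order `n` is topologically generated by `A` and the `δ ^ i x_j`. -/
theorem complMap_genMap_surjective (hD : ∃ e, (p : R) ∣ D.unif ^ e)
    (hx : DeterminesDerivations R x) (n : ℕ) : Function.Surjective (complMap p (genMap D x n)) :=
  complMap_surjective _ (exists_eq_genMap_add D hD hx n)

end Generators

end ArithJet
end
noncomputable section
set_option linter.unusedSectionVars false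
namespace ArithJet

open Prolongation

/-! ### Jets in étale coordinates -/

section Lift

variable {p : ℕ} [Fact p.Prime]

/-- Frobenius lifts to complete rings extend along formally smooth algebras. -/
theorem exists_frobenius_lift {P A T : Type} [CommRing P] [CommRing A] [CommRing T] [Algebra P A]
    [Algebra.FormallySmooth P A] [IsAdicComplete (Ideal.span {(p : T)}) T] (θ : P →+* T)
    (f : A →+* T) (h : ∀ q, (p : T) ∣ θ q - f (algebraMap P A q) ^ p) :
    ∃ φ : A →+* T, (∀ q, φ (algebraMap P A q) = θ q) ∧ ∀ a, (p : T) ∣ φ a - f a ^ p := by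
  let : Algebra P T := θ.toAlgebra
  have h0 : ((p : ℕ) : T ⧸ Ideal.span {(p : T)}) = 0 := by
    rw [← map_natCast (Ideal.Quotient.mk (Ideal.span {(p : T)})), Ideal.Quotient.eq_zero_iff_mem]
    exact Ideal.mem_span_singleton_self _
  -- The map `a ↦ f a ^ p` modulo `p` is linear over `P` acting through `θ`; this is the content of
  -- `h`. Formal smoothness lifts it to the complete ring `T`.
  let F : A →ₐ[P] T ⧸ Ideal.span {(p : T)} :=
    { toRingHom := (powHom p h0).comp ((Ideal.Quotient.mk _).comp f)
      commutes' := fun q => by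
        change (Ideal.Quotient.mk (Ideal.span {(p : T)}) (f (algebraMap P A q))) ^ p =
          Ideal.Quotient.mk (Ideal.span {(p : T)}) (θ q)
        rw [← map_pow]
        refine (Ideal.Quotient.eq.mpr (Ideal.mem_span_singleton.mpr (h q))).symm }
  obtain ⟨φ, hφ⟩ := Algebra.FormallySmooth.exists_mkₐ_comp_eq_of_isAdicComplete F
  refine ⟨φ.toRingHom, fun q => φ.commutes q, fun a => ?_⟩
  have := congrArg (fun g : A →ₐ[P] T ⧸ Ideal.span {(p : T)} => g a) hφ
  rw [← Ideal.mem_span_singleton, ← Ideal.Quotient.eq, map_pow]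
  exact this

/-- The continuous extension of a ring homomorphism to the completion. -/
def complLiftRing {A B : Type} [CommRing A] [CommRing B] [IsAdicComplete (Ideal.span {(p : B)}) B]
    (f : A →+* B) : Compl p A →+* B :=
  (complLift (R := ℤ) f.toIntAlgHom).toRingHom

theorem complLiftRing_complOf (R : Type) [CommRing R] {A B : Type} [CommRing A] [CommRing B]
    [Algebra R A] [IsAdicComplete (Ideal.span {(p : B)}) B] (f : A →+* B) (a : A) :
    complLiftRing f (complOf R p A a) = f a :=
  complLift_complOf (R := ℤ) f.toIntAlgHom a

/-- The `p`-adic completion of a ring without `p`-torsion has no `p`-torsion. -/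
theorem compl_torsionFree {A : Type} [CommRing A] (hA : ∀ a : A, (p : A) * a = 0 → a = 0)
    (x : Compl p A) (hx : (p : Compl p A) * x = 0) : x = 0 := by
  refine compl_ext fun m => ?_
  -- One extra power of `p` is needed, since cancelling `p` loses one.
  obtain ⟨a, ha⟩ := compl_exists_rep x (m + 1)
  rw [map_zero, ha m (Nat.le_succ m), Ideal.Quotient.eq_zero_iff_mem]
  have h := congrArg (complEval p (m + 1) A) hx
  rw [map_mul, map_natCast, ha _ le_rfl, map_zero, ← map_natCast (Ideal.Quotient.mk _), ← map_mul,
    Ideal.Quotient.eq_zero_iff_mem, Ideal.span_singleton_pow, Ideal.mem_span_singleton] at h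
  obtain ⟨c, hc⟩ := h
  rw [Ideal.span_singleton_pow, Ideal.mem_span_singleton]
  refine ⟨c, ?_⟩
  rw [← sub_eq_zero]
  refine hA _ ?_
  rw [mul_sub, hc]
  ring

theorem mvPolynomial_torsionFree {A σ : Type} [CommRing A]
    (hA : ∀ a : A, (p : A) * a = 0 → a = 0) (f : MvPolynomial σ A)
    (hf : (p : MvPolynomial σ A) * f = 0) : f = 0 := by
  ext m
  refine hA _ ?_
  have := congrArg (MvPolynomial.coeff m) hf
  rwa [← map_natCast MvPolynomial.C, MvPolynomial.coeff_C_mul, MvPolynomial.coeff_zero] at this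

theorem complMap_rename_injective {A σ τ : Type} [CommRing A] {f : σ → τ}
    (hf : Function.Injective f) :
    Function.Injective (complMap (R := A) p (MvPolynomial.rename f : _ →ₐ[A] MvPolynomial τ A)) := by
  refine Function.LeftInverse.injective (g := complMap p (MvPolynomial.killCompl hf)) fun x => ?_
  refine congrArg (fun g : Compl p (MvPolynomial σ A) →+* _ => g x)
    (a₁ := (complMap (R := A) p (MvPolynomial.killCompl hf)).toRingHom.comp
      (complMap (R := A) p (MvPolynomial.rename f)).toRingHom) (a₂ := RingHom.id _)
    (compl_ringHom_ext fun c => ?_)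
  change complMap (R := A) p (MvPolynomial.killCompl hf)
    (complMap (R := A) p (MvPolynomial.rename f) (complOf A p _ c)) = complOf A p _ c
  rw [complMap_complOf, complMap_complOf, MvPolynomial.killCompl_rename_app]

end Lift

section Coordinates

variable {p : ℕ} [Fact p.Prime] {R : Type} [CommRing R] {D : FrobeniusBase p R}
  {A : Type} [CommRing A] [Algebra R A] {ι : Type}

/-- The ring of functions of the infinite jet space, in étale coordinates. -/
abbrev CoordRing (p : ℕ) (A ι : Type) [CommRing A] : Type := Compl p (MvPolynomial (ℕ × ι) A)

/-- The image of an element of the polynomial ring in its completion. -/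
abbrev coordOf (R : Type) [CommRing R] (p : ℕ) (A ι : Type) [CommRing A] [Algebra R A] :
    MvPolynomial (ℕ × ι) A →ₐ[R] CoordRing p A ι :=
  complOf R p (MvPolynomial (ℕ × ι) A)

theorem coordRing_torsionFree (hA : ∀ a : A, (p : A) * a = 0 → a = 0) (t : CoordRing p A ι)
    (ht : (p : CoordRing p A ι) * t = 0) : t = 0 :=
  compl_torsionFree (mvPolynomial_torsionFree hA) t ht

variable [Algebra (MvPolynomial ι R) A] [IsScalarTower R (MvPolynomial ι R) A]
  [Algebra.FormallySmooth (MvPolynomial ι R) A]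

variable (A ι) in
/-- The lift of Frobenius on the ring of functions of the infinite jet space. -/
theorem exists_coordFrob (hu : D.unif = p) : ∃ φ : CoordRing p A ι →+* CoordRing p A ι,
    (∀ r, φ (algebraMap R _ r) = algebraMap R _ (D.frob r)) ∧
    (∀ t, (p : CoordRing p A ι) ∣ φ t - t ^ p) ∧
    (∀ j, φ (coordOf R p A ι (MvPolynomial.C (algebraMap (MvPolynomial ι R) A
      (MvPolynomial.X j)))) =
        coordOf R p A ι (MvPolynomial.C (algebraMap (MvPolynomial ι R) A (MvPolynomial.X j))) ^ p
        + p * coordOf R p A ι (MvPolynomial.X (0, j))) ∧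
    (∀ i j, φ (coordOf R p A ι (MvPolynomial.X (i, j))) =
      coordOf R p A ι (MvPolynomial.X (i, j)) ^ p
        + p * coordOf R p A ι (MvPolynomial.X (i + 1, j))) := by
  let o := coordOf R p A ι
  let c : A →ₐ[R] CoordRing p A ι := o.comp (IsScalarTower.toAlgHom R A (MvPolynomial (ℕ × ι) A))
  let x : ι → A := fun j => algebraMap (MvPolynomial ι R) A (MvPolynomial.X j)
  -- Frobenius is prescribed on the coordinates by `φ x_j = x_j ^ p + p Z_{0,j}`, which makes
  -- `Z_{0,j}` equal to `δ x_j`. Formal smoothness of `A` over the polynomial ring extends it to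
  -- `A`.
  let θ : MvPolynomial ι R →+* CoordRing p A ι :=
    MvPolynomial.eval₂Hom ((algebraMap R _).comp D.frob)
      fun j => c (x j) ^ p + p * o (MvPolynomial.X (0, j))
  have hθ : ∀ q, (p : CoordRing p A ι) ∣ θ q - c.toRingHom (algebraMap _ A q) ^ p := by
    intro q
    change _ ∣ θ q - c (algebraMap _ A q) ^ p
    induction q using MvPolynomial.induction_on with
    | C r =>
      have h1 : θ (MvPolynomial.C r) = algebraMap R _ (D.frob r) := MvPolynomial.eval₂_C _ _ _
      have h2 : c (algebraMap (MvPolynomial ι R) A (MvPolynomial.C r)) = algebraMap R _ r := by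
        rw [← MvPolynomial.algebraMap_eq, ← IsScalarTower.algebraMap_apply, AlgHom.commutes]
      rw [h1, h2, ← map_pow, ← map_sub, ← D.unif_mul_δ, hu, map_mul, map_natCast]
      exact dvd_mul_right _ _
    | add f g hf hg =>
      have := dvd_add (dvd_add hf hg) (dvd_mul_right (p : CoordRing p A ι)
        (carry p (c (algebraMap _ A f)) (c (algebraMap _ A g))))
      rw [mul_carry] at this
      convert this using 1
      rw [map_add, map_add, map_add]
      ring
    | mul_X f j hf =>
      have h1 : θ (MvPolynomial.X j) = c (x j) ^ p + p * o (MvPolynomial.X (0, j)) :=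
        MvPolynomial.eval₂_X _ _ _
      have h2 : θ (f * MvPolynomial.X j) - c (algebraMap _ A (f * MvPolynomial.X j)) ^ p =
          (θ f - c (algebraMap _ A f) ^ p) * c (x j) ^ p
            + p * (θ f * o (MvPolynomial.X (0, j))) := by
        rw [map_mul, h1, map_mul, map_mul]
        ring
      rw [h2]
      exact dvd_add (hf.mul_right _) (dvd_mul_right _ _)
  obtain ⟨φA, hφA, hφA'⟩ := exists_frobenius_lift θ c.toRingHom hθ
  -- The values on the variables are dictated by `δ Z_{i,j} = Z_{i+1,j}`.
  let φC : MvPolynomial (ℕ × ι) A →+* CoordRing p A ι := MvPolynomial.eval₂Hom φA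
    fun ij => o (MvPolynomial.X ij) ^ p + p * o (MvPolynomial.X (ij.1 + 1, ij.2))
  have hC : ∀ a, φC (MvPolynomial.C a) = φA a := fun a => MvPolynomial.eval₂_C _ _ _
  have hX : ∀ ij, φC (MvPolynomial.X ij) =
      o (MvPolynomial.X ij) ^ p + p * o (MvPolynomial.X (ij.1 + 1, ij.2)) :=
    fun ij => MvPolynomial.eval₂_X _ _ _
  have hφC : ∀ f, (p : CoordRing p A ι) ∣ φC f - o f ^ p := by
    intro f
    induction f using MvPolynomial.induction_on with
    | C a => rw [hC]; exact hφA' a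
    | add f g hf hg =>
      have := dvd_add (dvd_add hf hg) (dvd_mul_right (p : CoordRing p A ι) (carry p (o f) (o g)))
      rw [mul_carry] at this
      convert this using 1
      rw [map_add, map_add]
      ring
    | mul_X f ij hf =>
      have h2 : φC (f * MvPolynomial.X ij) - o (f * MvPolynomial.X ij) ^ p =
          (φC f - o f ^ p) * o (MvPolynomial.X ij) ^ p
            + p * (φC f * o (MvPolynomial.X (ij.1 + 1, ij.2))) := by
        rw [map_mul, hX, map_mul]
        ring
      rw [h2]
      exact dvd_add (hf.mul_right _) (dvd_mul_right _ _)
  have hφ : ∀ f, complLiftRing φC (o f) = φC f := fun f => complLiftRing_complOf R φC f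
  refine ⟨complLiftRing φC, fun r => ?_, fun t => ?_, fun j => ?_, fun i j => ?_⟩
  · rw [← o.commutes r, hφ, MvPolynomial.algebraMap_apply, hC]
    have h1 := hφA (MvPolynomial.C r)
    have h2 : θ (MvPolynomial.C r) = algebraMap R _ (D.frob r) := MvPolynomial.eval₂_C _ _ _
    rw [h2, ← MvPolynomial.algebraMap_eq, ← IsScalarTower.algebraMap_apply] at h1
    exact h1
  · obtain ⟨f, y, rfl⟩ := compl_exists_eq_add R t 1
    rw [pow_one, map_add, map_mul, map_natCast]
    have h1 : complLiftRing φC (complOf R p _ f) = φC f := hφ f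
    have h2 := sub_dvd_pow_sub_pow (complOf R p (MvPolynomial (ℕ × ι) A) f
      + (p : CoordRing p A ι) * y) (complOf R p _ f) p
    rw [add_sub_cancel_left] at h2
    have h3 := dvd_sub (dvd_add (hφC f) (dvd_mul_right (p : CoordRing p A ι)
      (complLiftRing φC y))) ((dvd_mul_right _ _).trans h2)
    convert h3 using 1
    rw [h1]
    ring
  · refine (hφ _).trans ((hC _).trans ((hφA _).trans (MvPolynomial.eval₂_X _ _ _)))
  · exact (hφ _).trans (hX _)

/-- In étale coordinates `x`, the completed jet algebras map to the ring of functions of the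
infinite jet space, and `δ ^ (i + 1) x_j` maps to the `i`-th variable. -/
theorem exists_coordMap (hu : D.unif = p) (hA : ∀ a : A, (p : A) * a = 0 → a = 0) (n : ℕ) :
    ∃ ρ : (jet D A).obj n →ₐ[R] CoordRing p A ι,
      ∀ c, ρ (genMap D (fun j : ι => algebraMap (MvPolynomial ι R) A (MvPolynomial.X j)) n c) =
        coordOf R p A ι (MvPolynomial.rename (Prod.map Fin.val id) c) := by
  obtain ⟨φ, hbase, hdvd, hx, hX⟩ := exists_coordFrob (D := D) A ι hu
  have hreg : ∀ _ : ℕ, algebraMap R (CoordRing p A ι) D.unif ∈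
      nonZeroDivisors (CoordRing p A ι) := fun _ => by
    rw [hu, map_natCast, mem_nonZeroDivisors_iff_right]
    exact fun t ht => coordRing_torsionFree hA t (by rwa [mul_comm])
  have hcancel : ∀ a b : CoordRing p A ι, (p : CoordRing p A ι) * a = p * b → a = b := by
    intro a b h
    rw [← sub_eq_zero]
    exact coordRing_torsionFree hA _ (by rw [mul_sub, h, sub_self])
  -- With infinitely many variables `δ` is an operator on a single ring, which serves in all orders,
  -- with identities as inclusions.
  let S : Prolongation D := ofFrobenius (fun _ => CoordRing p A ι) (fun _ => AlgHom.id R _)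
    (fun _ => φ) hreg (fun _ => hbase) (fun _ _ => rfl) (fun _ t => (hdvd t).choose)
    (fun _ t => by
      rw [hu, map_natCast]
      exact (hdvd t).choose_spec.symm)
  have hδ : ∀ t : CoordRing p A ι, (p : CoordRing p A ι) * (hdvd t).choose = φ t - t ^ p :=
    fun t => (hdvd t).choose_spec.symm
  let α : A →ₐ[R] S.obj 0 :=
    (coordOf R p A ι).comp (IsScalarTower.toAlgHom R A (MvPolynomial (ℕ × ι) A))
  let x : ι → A := fun j => algebraMap (MvPolynomial ι R) A (MvPolynomial.X j)
  have hi : ∀ n, S.inclIter n = AlgHom.id R _ := by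
    intro n
    induction n with
    | zero => rfl
    | succ n ih => rw [inclIter, ih]; rfl
  have helt : ∀ n i j, i < n →
      S.elt n (i + 1) (α (x j)) = coordOf R p A ι (MvPolynomial.X (i, j)) := by
    intro n
    induction n with
    | zero => intro i j h; omega
    | succ n ih =>
      intro i j h
      by_cases hin : i < n
      · rw [← S.incl_elt (by omega), ih i j hin]
        rfl
      · obtain rfl : i = n := by omega
        rw [← S.δ_elt le_rfl]
        refine hcancel _ _ ?_
        refine (hδ _).trans ?_
        cases i with
        | zero =>
          exact sub_eq_of_eq_add' (hx j)
        | succ i =>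
          rw [ih i j (by omega)]
          exact sub_eq_of_eq_add' (hX i j)
  let ρ : (jet D A).obj n →ₐ[R] CoordRing p A ι := (jetLift S α).hom n
  have hρC : ∀ a, ρ (jetIncl D A n a) = coordOf R p A ι (MvPolynomial.C a) := fun a => by
    change (jetLift S α).hom n ((jet D A).inclIter n (toJet D A a)) = _
    rw [Hom.hom_inclIter, jetLift_toJet, hi]
    rfl
  have hρX : ∀ ij : Fin n × ι, ρ ((jet D A).elt n (ij.1 + 1) (toJet D A (x ij.2))) =
      coordOf R p A ι (MvPolynomial.X (ij.1.val, ij.2)) := fun ij => by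
    change (jetLift S α).hom n _ = _
    rw [Hom.hom_elt, jetLift_toJet, helt _ _ _ ij.1.2]
  clear_value ρ
  refine ⟨ρ, fun c => ?_⟩
  induction c using MvPolynomial.induction_on with
  | C a => rw [MvPolynomial.rename_C, genMap_C, hρC]
  | add f g hf hg => simp only [map_add, hf, hg]
  | mul_X f ij hf =>
    rw [map_mul, map_mul, map_mul, map_mul, hf, MvPolynomial.rename_X, genMap_X, hρX]
    rfl

variable (hu : D.unif = p) (hA : ∀ a : A, (p : A) * a = 0 → a = 0)
  (hd : DeterminesDerivations R (fun j : ι => algebraMap (MvPolynomial ι R) A (MvPolynomial.X j)))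
include hu hA hd

/-- In étale coordinates the completed jet algebras are completed polynomial algebras. -/
theorem complMap_genMap_bijective (n : ℕ) : Function.Bijective (complMap p
    (genMap D (fun j : ι => algebraMap (MvPolynomial ι R) A (MvPolynomial.X j)) n)) := by
  refine ⟨?_, complMap_genMap_surjective D ⟨1, by rw [hu, pow_one]⟩ hd n⟩
  obtain ⟨ρ, hρ⟩ := exists_coordMap (ι := ι) hu hA n
  have hinj : Function.Injective (Prod.map Fin.val id : Fin n × ι → ℕ × ι) :=
    Fin.val_injective.prodMap Function.injective_id
  -- Followed by `ρ`, the map of completions becomes the inclusion of the first `n` families of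
  -- variables among all of them.
  refine Function.Injective.of_comp (f := complLift (p := p) ρ) ?_
  convert complMap_rename_injective (p := p) (A := A) hinj using 1
  funext y
  refine congrArg (fun g : Compl p (MvPolynomial (Fin n × ι) A) →+* CoordRing p A ι => g y)
    (a₁ := (complLift (p := p) ρ).toRingHom.comp (complMap p (genMap D _ n)).toRingHom)
    (a₂ := (complMap (R := A) p (MvPolynomial.rename (Prod.map Fin.val id))).toRingHom)
    (compl_ringHom_ext fun c => ?_)
  change complLift (p := p) ρ (complMap p (genMap D _ n) (complOf R p _ c)) =
    complMap (R := A) p (MvPolynomial.rename (Prod.map Fin.val id)) (complOf A p _ c)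
  rw [complMap_complOf, complMap_complOf, complLift_complOf, hρ]
  rfl

theorem jet_completion_torsionFree_of_coordinates (n : ℕ) (y : Compl p ((jet D A).obj n))
    (hy : (p : Compl p ((jet D A).obj n)) * y = 0) : y = 0 := by
  obtain ⟨z, rfl⟩ := (complMap_genMap_bijective hu hA hd n).2 y
  rw [← map_natCast (complMap p (genMap D _ n)), ← map_mul,
    ← map_zero (complMap p (genMap D _ n))] at hy
  rw [compl_torsionFree (mvPolynomial_torsionFree hA) z
    ((complMap_genMap_bijective hu hA hd n).1 hy), map_zero]

end Coordinates

end ArithJet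
end
noncomputable section
set_option linter.unusedSectionVars false
namespace ArithJet

open Prolongation

/-! ### Comparison of the coordinates `δ_ϖ ^ i x` and `δ_p ^ i x` -/

section Scaling

/-- The substitution of `t * X` for `X`. -/
def scaleX {K σ : Type} [CommRing K] (t : K) : MvPolynomial σ K →ₐ[K] MvPolynomial σ K :=
  MvPolynomial.aeval fun i => MvPolynomial.C t * MvPolynomial.X i

theorem scaleX_monomial {K σ : Type} [CommRing K] (t : K) (m : σ →₀ ℕ) (c : K) :
    scaleX t (MvPolynomial.monomial m c) = MvPolynomial.monomial m (t ^ m.degree * c) := by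
  rw [scaleX, MvPolynomial.aeval_monomial]
  simp only [mul_pow, Finsupp.prod_mul, MvPolynomial.algebraMap_eq]
  rw [MvPolynomial.monomial_eq, map_mul]
  have : (m.prod fun _ k => (MvPolynomial.C t : MvPolynomial σ K) ^ k) =
      MvPolynomial.C (t ^ m.degree) := by
    rw [map_pow, Finsupp.degree_apply, Finsupp.prod, Finset.prod_pow_eq_pow_sum]
  rw [this]
  ring

theorem coeff_scaleX {K σ : Type} [CommRing K] (t : K) (m : σ →₀ ℕ) (f : MvPolynomial σ K) :
    (scaleX t f).coeff m = t ^ m.degree * f.coeff m := by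
  classical
  induction f using MvPolynomial.induction_on' with
  | monomial m' c =>
    rw [scaleX_monomial, MvPolynomial.coeff_monomial, MvPolynomial.coeff_monomial]
    split_ifs with h
    · rw [h]
    · rw [mul_zero]
  | add f g hf hg => rw [map_add, MvPolynomial.coeff_add, MvPolynomial.coeff_add, hf, hg, mul_add]

/-- A polynomial without constant term becomes integral by scaling the variables. -/
theorem exists_map_eq_scaleX {R K σ : Type} [CommRing R] [CommRing K] [Algebra R K] (q : R)
    [IsLocalization.Away q K] (f : MvPolynomial σ K) (hf : MvPolynomial.constantCoeff f = 0) :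
    ∃ M₀ : ℕ, ∀ M ≥ M₀, ∃ ξ : MvPolynomial σ R,
      MvPolynomial.map (algebraMap R K) ξ = scaleX (algebraMap R K q ^ M) f := by
  classical
  rw [MvPolynomial.as_sum f]
  refine Finset.sum_induction _ (fun f : MvPolynomial σ K => ∃ M₀ : ℕ, ∀ M ≥ M₀,
    ∃ ξ : MvPolynomial σ R, MvPolynomial.map (algebraMap R K) ξ = scaleX (algebraMap R K q ^ M) f)
    ?_ ⟨0, fun M _ => ⟨0, by simp⟩⟩ ?_
  · rintro f g ⟨M₁, h₁⟩ ⟨M₂, h₂⟩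
    refine ⟨max M₁ M₂, fun M hM => ?_⟩
    obtain ⟨ξ₁, e₁⟩ := h₁ M ((le_max_left _ _).trans hM)
    obtain ⟨ξ₂, e₂⟩ := h₂ M ((le_max_right _ _).trans hM)
    exact ⟨ξ₁ + ξ₂, by rw [map_add, map_add, e₁, e₂]⟩
  · intro m hm
    have hm0 : m ≠ 0 := by
      rintro rfl
      rw [MvPolynomial.mem_support_iff] at hm
      exact hm (by rw [← MvPolynomial.constantCoeff_eq]; exact hf)
    obtain ⟨k, r, hr⟩ := IsLocalization.Away.surj q (MvPolynomial.coeff m f)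
    refine ⟨k, fun M hM => ⟨MvPolynomial.monomial m (q ^ (M * m.degree - k) * r), ?_⟩⟩
    -- A monomial of positive degree acquires at least the factor `q ^ M`, which absorbs the
    -- denominator `q ^ k` as soon as `M ≥ k`. A constant term would acquire nothing.
    have hdeg : 1 ≤ m.degree := by
      rw [Nat.one_le_iff_ne_zero, Ne, Finsupp.degree_eq_zero_iff]
      exact hm0
    have hk : k ≤ M * m.degree := hM.trans (Nat.le_mul_of_pos_right _ hdeg)
    rw [MvPolynomial.map_monomial, scaleX_monomial, map_mul, map_pow, ← hr, ← pow_mul]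
    congr 1
    rw [mul_comm (MvPolynomial.coeff m f), ← mul_assoc, ← pow_add, Nat.sub_add_cancel hk]

variable {p : ℕ} [Fact p.Prime] {R : Type} [CommRing R] (D : FrobeniusBase p R)

/-- The lift of Frobenius with `φ Z_i = Z_i ^ p + p * Z_{i+1}`. -/
def polyFrob : MvPolynomial ℕ R →+* MvPolynomial ℕ R :=
  MvPolynomial.eval₂Hom (MvPolynomial.C.comp D.frob)
    fun i => MvPolynomial.X i ^ p + (p : MvPolynomial ℕ R) * MvPolynomial.X (i + 1)

theorem polyFrob_C (r : R) : polyFrob D (MvPolynomial.C r) = MvPolynomial.C (D.frob r) :=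
  MvPolynomial.eval₂_C _ _ _

theorem polyFrob_X (i : ℕ) : polyFrob D (MvPolynomial.X i) =
    MvPolynomial.X i ^ p + (p : MvPolynomial ℕ R) * MvPolynomial.X (i + 1) :=
  MvPolynomial.eval₂_X _ _ _

/-- The variables satisfy a congruence modulo `p`, but the coefficients only one modulo `unif`, so
divisibility by `unif` is what remains. -/
theorem polyFrob_dvd (f : MvPolynomial ℕ R) : MvPolynomial.C D.unif ∣ polyFrob D f - f ^ p := by
  have hp : (MvPolynomial.C D.unif : MvPolynomial ℕ R) ∣ (p : MvPolynomial ℕ R) := by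
    rw [← map_natCast MvPolynomial.C, ← D.ratio_mul_unif, map_mul]
    exact dvd_mul_left _ _
  induction f using MvPolynomial.induction_on with
  | C r =>
    rw [polyFrob_C, ← map_pow, ← map_sub, ← D.unif_mul_δ, map_mul]
    exact dvd_mul_right _ _
  | add f g hf hg =>
    have := dvd_add (dvd_add hf hg) (hp.mul_right (carry p f g))
    rw [mul_carry] at this
    convert this using 1
    rw [map_add]
    ring
  | mul_X f i hf =>
    have h2 : polyFrob D (f * MvPolynomial.X i) - (f * MvPolynomial.X i) ^ p =
        (polyFrob D f - f ^ p) * MvPolynomial.X i ^ p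
          + (p : MvPolynomial ℕ R) * (polyFrob D f * MvPolynomial.X (i + 1)) := by
      rw [map_mul, polyFrob_X]
      ring
    rw [h2]
    exact dvd_add (hf.mul_right _) (hp.mul_right _)

/-- The polynomials expressing `δ ^ (i + 1) x`, for the Fermat quotient `δ` of the base, in terms of
the iterates of the Fermat quotient with respect to `p`. -/
def jetPoly : ℕ → MvPolynomial ℕ R
  | 0 => MvPolynomial.C D.ratio * MvPolynomial.X 0
  | i + 1 => (polyFrob_dvd D (jetPoly i)).choose

theorem unif_mul_jetPoly_succ (i : ℕ) : MvPolynomial.C D.unif * jetPoly D (i + 1) =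
    polyFrob D (jetPoly D i) - jetPoly D i ^ p :=
  (polyFrob_dvd D (jetPoly D i)).choose_spec.symm

theorem polyFrob_mem_supported {n : ℕ} {f : MvPolynomial ℕ R}
    (hf : f ∈ MvPolynomial.supported R (Set.Iio n)) :
    polyFrob D f ∈ MvPolynomial.supported R (Set.Iio (n + 1)) := by
  rw [MvPolynomial.supported] at hf
  induction hf using Algebra.adjoin_induction with
  | mem f hf =>
    obtain ⟨j, hj, rfl⟩ := hf
    rw [Set.mem_Iio] at hj
    rw [polyFrob_X]
    refine add_mem (pow_mem ?_ _) (mul_mem (natCast_mem _ _) ?_)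
    · exact Algebra.subset_adjoin ⟨j, Set.mem_Iio.mpr (by omega), rfl⟩
    · exact Algebra.subset_adjoin ⟨j + 1, Set.mem_Iio.mpr (by omega), rfl⟩
  | algebraMap r =>
    rw [MvPolynomial.algebraMap_eq, polyFrob_C]
    exact Subalgebra.algebraMap_mem _ _
  | add f g _ _ hf hg => rw [map_add]; exact add_mem hf hg
  | mul f g _ _ hf hg => rw [map_mul]; exact mul_mem hf hg

/-- Frobenius introduces one new variable at each stage, and dividing by the non-zero-divisor `unif`
does not change the set of monomials. -/
theorem jetPoly_mem_supported (i : ℕ) :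
    jetPoly D i ∈ MvPolynomial.supported R (Set.Iio (i + 1)) := by
  induction i with
  | zero =>
    refine mul_mem (Subalgebra.algebraMap_mem _ _) ?_
    exact Algebra.subset_adjoin ⟨0, Set.mem_Iio.mpr (by omega), rfl⟩
  | succ i ih =>
    have h : MvPolynomial.C D.unif * jetPoly D (i + 1) ∈
        MvPolynomial.supported R (Set.Iio (i + 1 + 1)) := by
      rw [unif_mul_jetPoly_succ]
      refine sub_mem (polyFrob_mem_supported D ih) (pow_mem ?_ _)
      exact MvPolynomial.supported_mono (Set.Iio_subset_Iio (by omega)) ih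
    rw [MvPolynomial.mem_supported] at h ⊢
    refine subset_trans ?_ h
    intro j hj
    rw [Finset.mem_coe, MvPolynomial.mem_vars_iff_mem_support] at hj ⊢
    obtain ⟨d, hd, hjd⟩ := hj
    refine ⟨d, ?_, hjd⟩
    rw [MvPolynomial.mem_support_iff] at hd ⊢
    rw [MvPolynomial.coeff_C_mul]
    intro h0
    exact hd ((mem_nonZeroDivisors_iff_right.mp D.unif_mem) _ (by rwa [mul_comm] at h0))

theorem eqOn_supported {B : Type} [CommRing B] {s : Set ℕ} {F G : MvPolynomial ℕ R →+* B}
    (hC : ∀ r, F (MvPolynomial.C r) = G (MvPolynomial.C r))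
    (hX : ∀ j ∈ s, F (MvPolynomial.X j) = G (MvPolynomial.X j)) {f : MvPolynomial ℕ R}
    (hf : f ∈ MvPolynomial.supported R s) : F f = G f := by
  rw [MvPolynomial.supported] at hf
  induction hf using Algebra.adjoin_induction with
  | mem f hf =>
    obtain ⟨j, hj, rfl⟩ := hf
    exact hX j hj
  | algebraMap r => exact hC r
  | add f g _ _ hf hg => rw [map_add, map_add, hf, hg]
  | mul f g _ _ hf hg => rw [map_mul, map_mul, hf, hg]

/-- For each `n` there is a substitution for the variables which transforms the polynomials
`jetPoly D i`, for `i < n`, into multiples of variables. -/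
theorem exists_aeval_jetPoly (hD : ∃ e, (p : R) ∣ D.unif ^ e) (n : ℕ) :
    ∃ (M : ℕ) (ξ : ℕ → MvPolynomial ℕ R), ∀ i < n,
      MvPolynomial.aeval ξ (jetPoly D i) = (p : MvPolynomial ℕ R) ^ M * MvPolynomial.X i := by
  -- Once `p` is inverted, `unif` and `ratio` are units and the change of variables `jetPoly` can be
  -- inverted.
  obtain ⟨K, _, _, _⟩ : ∃ (K : Type) (_ : CommRing K) (_ : Algebra R K),
      IsLocalization.Away (p : R) K := ⟨Localization.Away (p : R), _, _, inferInstance⟩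
  have hpK : IsUnit (algebraMap R K (p : R)) := IsLocalization.Away.algebraMap_isUnit _
  have hreg : (p : R) ∈ nonZeroDivisors R := by
    obtain ⟨e, c, hc⟩ := hD
    have h : (p : R) * c ∈ nonZeroDivisors R := hc ▸ pow_mem D.unif_mem e
    exact (mul_mem_nonZeroDivisors.mp h).1
  have hinj : Function.Injective (algebraMap R K) :=
    IsLocalization.injective K (Submonoid.powers_le.mpr hreg)
  have huK : IsUnit (algebraMap R K D.unif) := by
    rw [← D.ratio_mul_unif, map_mul] at hpK
    exact isUnit_of_mul_isUnit_right hpK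
  have hrK : IsUnit (algebraMap R K D.ratio) := by
    rw [← D.ratio_mul_unif, map_mul] at hpK
    exact isUnit_of_mul_isUnit_left hpK
  let frobK : K →+* K := IsLocalization.Away.lift (p : R) (g := (algebraMap R K).comp D.frob)
    (by rw [RingHom.comp_apply, map_natCast]; exact hpK)
  have hfrobK : ∀ r, frobK (algebraMap R K r) = algebraMap R K (D.frob r) :=
    fun r => IsLocalization.Away.lift_eq _ _ r
  let φ : MvPolynomial ℕ K →+* MvPolynomial ℕ K := MvPolynomial.eval₂Hom (MvPolynomial.C.comp frobK)
    fun i => MvPolynomial.X i ^ p + MvPolynomial.C (algebraMap R K D.unif) * MvPolynomial.X (i + 1)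
  have hφC : ∀ c, φ (MvPolynomial.C c) = MvPolynomial.C (frobK c) :=
    fun c => MvPolynomial.eval₂_C _ _ _
  have hφX : ∀ i, φ (MvPolynomial.X i) = MvPolynomial.X i ^ p
      + MvPolynomial.C (algebraMap R K D.unif) * MvPolynomial.X (i + 1) :=
    fun i => MvPolynomial.eval₂_X _ _ _
  obtain ⟨cr, hcr⟩ := hrK.exists_right_inv
  obtain ⟨cp, hcp⟩ := hpK.exists_right_inv
  -- The inverse change of variables: `Ξ i` expresses the iterated Fermat quotient with respect to
  -- `p` through those with respect to `unif`. The recursion divides by `p`, while `φ` introduces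
  -- new variables with coefficient `unif`.
  let Ξ : ℕ → MvPolynomial ℕ K := fun i => Nat.rec
    (MvPolynomial.C cr * MvPolynomial.X 0)
    (fun _ Y => MvPolynomial.C cp * (φ Y - Y ^ p)) i
  have hΞ0 : MvPolynomial.C (algebraMap R K D.ratio) * Ξ 0 = MvPolynomial.X 0 := by
    change MvPolynomial.C (algebraMap R K D.ratio) *
      (MvPolynomial.C cr * MvPolynomial.X 0) = _
    rw [← mul_assoc, ← map_mul, hcr, map_one, one_mul]
  have hΞ : ∀ i, (p : MvPolynomial ℕ K) * Ξ (i + 1) = φ (Ξ i) - Ξ i ^ p := by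
    intro i
    change (p : MvPolynomial ℕ K) * (MvPolynomial.C cp * (φ (Ξ i) - Ξ i ^ p)) = _
    have : (p : MvPolynomial ℕ K) = MvPolynomial.C (algebraMap R K (p : R)) := by
      rw [map_natCast, map_natCast]
    rw [this, ← mul_assoc, ← map_mul, hcp, map_one, one_mul]
  -- Absence of a constant term allows the denominators to be cleared by scaling the variables.
  have hconst : ∀ i, MvPolynomial.constantCoeff (Ξ i) = 0 := by
    have hφ : ∀ f, MvPolynomial.constantCoeff (φ f) = frobK (MvPolynomial.constantCoeff f) := by
      intro f
      refine congrArg (fun F : MvPolynomial ℕ K →+* K => F f)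
        (a₁ := MvPolynomial.constantCoeff.comp φ) (a₂ := frobK.comp MvPolynomial.constantCoeff)
        (MvPolynomial.ringHom_ext (fun c => ?_) fun i => ?_)
      · rw [RingHom.comp_apply, RingHom.comp_apply, hφC]
        simp
      · rw [RingHom.comp_apply, RingHom.comp_apply, hφX]
        simp [(Fact.out : p.Prime).ne_zero]
    intro i
    induction i with
    | zero =>
      change MvPolynomial.constantCoeff (MvPolynomial.C cr * MvPolynomial.X 0) = 0
      simp
    | succ i ih =>
      change MvPolynomial.constantCoeff
        (MvPolynomial.C cp * (φ (Ξ i) - Ξ i ^ p)) = 0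
      rw [map_mul, map_sub, hφ, map_pow, ih]
      simp [(Fact.out : p.Prime).ne_zero]
  let g : MvPolynomial ℕ R →+* MvPolynomial ℕ K :=
    MvPolynomial.eval₂Hom (MvPolynomial.C.comp (algebraMap R K)) Ξ
  have hgC : ∀ r, g (MvPolynomial.C r) = MvPolynomial.C (algebraMap R K r) :=
    fun r => MvPolynomial.eval₂_C _ _ _
  have hgX : ∀ i, g (MvPolynomial.X i) = Ξ i := fun i => MvPolynomial.eval₂_X _ _ _
  have hgφ : ∀ f, g (polyFrob D f) = φ (g f) := by
    intro f
    refine congrArg (fun F : MvPolynomial ℕ R →+* MvPolynomial ℕ K => F f)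
      (a₁ := g.comp (polyFrob D)) (a₂ := φ.comp g)
      (MvPolynomial.ringHom_ext (fun c => ?_) fun i => ?_)
    · rw [RingHom.comp_apply, RingHom.comp_apply, polyFrob_C, hgC, hgC, hφC, hfrobK]
    · rw [RingHom.comp_apply, RingHom.comp_apply, polyFrob_X, map_add, map_mul, map_pow, hgX, hgX,
        map_natCast, hΞ]
      ring
  have hgΘ : ∀ i, g (jetPoly D i) = MvPolynomial.X i := by
    intro i
    induction i with
    | zero => rw [jetPoly, map_mul, hgC, hgX, hΞ0]
    | succ i ih =>
      have h := congrArg g (unif_mul_jetPoly_succ D i)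
      rw [map_mul, hgC, map_sub, map_pow, hgφ, ih, hφX, add_sub_cancel_left] at h
      exact (huK.map MvPolynomial.C).mul_left_cancel h
  have hM : ∀ i, ∃ M₀ : ℕ, ∀ M ≥ M₀, ∃ ξ : MvPolynomial ℕ R,
      MvPolynomial.map (algebraMap R K) ξ = scaleX (algebraMap R K p ^ M) (Ξ i) :=
    fun i => exists_map_eq_scaleX (p : R) (Ξ i) (hconst i)
  choose M₀ hM₀ using hM
  -- A common exponent for all `i < n`, so that every variable is scaled by the same power of `p`.
  let M := (Finset.range n).sup M₀
  have hξ : ∀ i, ∃ ξ : MvPolynomial ℕ R, i < n →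
      MvPolynomial.map (algebraMap R K) ξ = scaleX (algebraMap R K p ^ M) (Ξ i) := by
    intro i
    by_cases hi : i < n
    · obtain ⟨ξ, h⟩ := hM₀ i M (Finset.le_sup (f := M₀) (Finset.mem_range.mpr hi))
      exact ⟨ξ, fun _ => h⟩
    · exact ⟨0, fun h => absurd h hi⟩
  choose ξ hξ using hξ
  refine ⟨M, ξ, fun i hi => MvPolynomial.map_injective (algebraMap R K) hinj ?_⟩
  -- `ξ j` is controlled only for `j < n`. This is enough because `jetPoly D i` involves only the
  -- variables with index at most `i`.
  have key := eqOn_supported (s := Set.Iio (i + 1))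
    (F := (MvPolynomial.map (algebraMap R K)).comp (MvPolynomial.aeval ξ).toRingHom)
    (G := (scaleX (algebraMap R K p ^ M)).toRingHom.comp g)
    (fun r => by
      change MvPolynomial.map (algebraMap R K) (MvPolynomial.aeval ξ (MvPolynomial.C r)) =
        scaleX (algebraMap R K p ^ M) (g (MvPolynomial.C r))
      rw [MvPolynomial.aeval_C, hgC, MvPolynomial.algebraMap_eq, MvPolynomial.map_C, scaleX,
        MvPolynomial.aeval_C]
      rfl)
    (fun j hj => by
      rw [Set.mem_Iio] at hj
      change MvPolynomial.map (algebraMap R K) (MvPolynomial.aeval ξ (MvPolynomial.X j)) =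
        scaleX (algebraMap R K p ^ M) (g (MvPolynomial.X j))
      rw [MvPolynomial.aeval_X, hgX, hξ j (by omega)])
    (jetPoly_mem_supported D i)
  refine key.trans ?_
  change scaleX (algebraMap R K p ^ M) (g (jetPoly D i)) = _
  rw [hgΘ, scaleX, MvPolynomial.aeval_X]
  simp

/-- Scaling of variables is injective on completed polynomial rings. -/
theorem complMap_scale_injective {A σ τ : Type} [CommRing A]
    (hA : ∀ a : A, (p : A) * a = 0 → a = 0) {f : σ → τ} (hf : Function.Injective f) (M : ℕ) :
    Function.Injective (complMap (R := A) p ((MvPolynomial.rename f).comp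
      (scaleX ((p : A) ^ M)) : MvPolynomial σ A →ₐ[A] MvPolynomial τ A)) := by
  rw [injective_iff_map_eq_zero]
  intro x hx
  refine compl_ext fun m => ?_
  obtain ⟨c, hc⟩ := compl_exists_rep x m
  rw [map_zero, hc m le_rfl, Ideal.Quotient.eq_zero_iff_mem, Ideal.span_singleton_pow,
    Ideal.mem_span_singleton, ← map_natCast MvPolynomial.C, ← map_pow,
    MvPolynomial.C_dvd_iff_dvd_coeff]
  intro μ
  have hpow : ∀ (k : ℕ) (a : A), (p : A) ^ k * a = 0 → a = 0 := by
    intro k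
    induction k with
    | zero => intro a h; simpa using h
    | succ k ih => intro a h; exact hA a (ih _ (by rw [← mul_assoc, ← pow_succ]; exact h))
  -- Scaling multiplies the coefficient at `μ` by `p ^ (M * μ.degree)`. The degrees are unbounded,
  -- so the precision of the representative has to depend on `μ` in order to leave divisibility by
  -- `p ^ m` after cancellation.
  obtain ⟨c', hc'⟩ := compl_exists_rep x (M * μ.degree + m)
  have h1 : (p : A) ^ m ∣ MvPolynomial.coeff μ (c - c') := by
    have h := (hc m le_rfl).symm.trans (hc' m (Nat.le_add_left _ _))
    rw [Ideal.Quotient.eq, Ideal.span_singleton_pow, Ideal.mem_span_singleton,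
      ← map_natCast MvPolynomial.C, ← map_pow, MvPolynomial.C_dvd_iff_dvd_coeff] at h
    exact h μ
  have h2 : (p : A) ^ m ∣ MvPolynomial.coeff μ c' := by
    have h := congrArg (complEval p (M * μ.degree + m) _) hx
    rw [complEval_complMap _ _ (hc' _ le_rfl), map_zero, Ideal.Quotient.eq_zero_iff_mem,
      Ideal.span_singleton_pow, Ideal.mem_span_singleton, ← map_natCast MvPolynomial.C, ← map_pow,
      MvPolynomial.C_dvd_iff_dvd_coeff] at h
    obtain ⟨b, hb⟩ := h (μ.mapDomain f)
    rw [AlgHom.comp_apply, MvPolynomial.coeff_rename_mapDomain f hf, coeff_scaleX, ← pow_mul,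
      pow_add, mul_assoc] at hb
    refine ⟨b, ?_⟩
    rw [← sub_eq_zero]
    exact hpow (M * μ.degree) _ (by rw [mul_sub, hb, sub_self])
  have := dvd_add h1 h2
  rwa [MvPolynomial.coeff_sub, sub_add_cancel] at this

end Scaling

end ArithJet
end
noncomputable section
set_option linter.unusedSectionVars false
namespace ArithJet

open Prolongation

/-! ### `p`-adic completeness of finite free extensions -/

section Complete

/-- `p`-adic completeness of an abelian group. -/
def PComplete (p : ℕ) (M : Type) [AddCommGroup M] : Prop :=
  (∀ x : M, (∀ m : ℕ, ∃ y, x = p ^ m • y) → x = 0) ∧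
    ∀ f : ℕ → M, (∀ m n : ℕ, m ≤ n → ∃ y, f m - f n = p ^ m • y) →
      ∃ L, ∀ m, ∃ y, f m - L = p ^ m • y

theorem pComplete_iff {p : ℕ} {B : Type} [CommRing B] :
    PComplete p B ↔ IsAdicComplete (Ideal.span {(p : B)}) B := by
  have hmem : ∀ (m : ℕ) (x : B), x ∈ (Ideal.span {(p : B)} ^ m • ⊤ : Submodule B B) ↔
      ∃ y, x = p ^ m • y := by
    intro m x
    rw [smul_eq_mul, Ideal.mul_top, Ideal.span_singleton_pow, Ideal.mem_span_singleton]
    simp only [nsmul_eq_mul, Nat.cast_pow]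
    rfl
  constructor
  · rintro ⟨h1, h2⟩
    refine @IsAdicComplete.mk _ _ _ _ _ _ ⟨fun x hx => h1 x fun m => ?_⟩ ⟨fun f hf => ?_⟩
    · rw [← hmem, ← SModEq.zero]
      exact hx m
    · obtain ⟨L, hL⟩ := h2 f fun m n hmn => by
        rw [← hmem, ← SModEq.sub_mem]
        exact hf hmn
      exact ⟨L, fun m => by rw [SModEq.sub_mem, hmem]; exact hL m⟩
  · intro h
    refine ⟨fun x hx => h.haus' x fun m => ?_, fun f hf => ?_⟩
    · rw [SModEq.zero, hmem]
      exact hx m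
    · obtain ⟨L, hL⟩ := h.prec' f fun {m n} hmn => by
        rw [SModEq.sub_mem, hmem]
        exact hf m n hmn
      exact ⟨L, fun m => by rw [← hmem, ← SModEq.sub_mem]; exact hL m⟩

theorem PComplete.of_equiv {p : ℕ} {M N : Type} [AddCommGroup M] [AddCommGroup N] (e : M ≃+ N)
    (h : PComplete p M) : PComplete p N := by
  refine ⟨fun x hx => ?_, fun f hf => ?_⟩
  · refine e.symm.injective ?_
    rw [map_zero]
    refine h.1 _ fun m => ?_
    obtain ⟨y, rfl⟩ := hx m
    exact ⟨e.symm y, map_nsmul _ _ _⟩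
  · obtain ⟨L, hL⟩ := h.2 (fun m => e.symm (f m)) fun m n hmn => by
      obtain ⟨y, hy⟩ := hf m n hmn
      exact ⟨e.symm y, by rw [← map_sub, hy, map_nsmul]⟩
    refine ⟨e L, fun m => ?_⟩
    obtain ⟨y, hy⟩ := hL m
    refine ⟨e y, e.symm.injective ?_⟩
    rw [map_sub, e.symm_apply_apply, hy, map_nsmul, e.symm_apply_apply]

theorem PComplete.pi {p : ℕ} {ι M : Type} [AddCommGroup M] (h : PComplete p M) :
    PComplete p (ι → M) := by
  refine ⟨fun x hx => funext fun i => h.1 _ fun m => ?_, fun f hf => ?_⟩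
  · obtain ⟨y, rfl⟩ := hx m
    exact ⟨y i, rfl⟩
  · choose L hL using fun i => h.2 (fun m => f m i) fun m n hmn => by
      obtain ⟨y, hy⟩ := hf m n hmn
      exact ⟨y i, congrFun hy i⟩
    refine ⟨L, fun m => ?_⟩
    choose y hy using fun i => hL i m
    exact ⟨y, funext hy⟩

/-- A basis of `R'` identifies the tensor product additively with a power of `C`. `PComplete` refers
to the additive group alone, so it can be transported along this isomorphism. -/
theorem tensor_isAdicComplete {p : ℕ} {R R' C : Type} [CommRing R] [CommRing R'] [CommRing C]
    [Algebra R R'] [Algebra R C] [Module.Free R R'] [Module.Finite R R']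
    [h : IsAdicComplete (Ideal.span {(p : C)}) C] :
    IsAdicComplete (Ideal.span {(p : R' ⊗[R] C)}) (R' ⊗[R] C) := by
  rw [← pComplete_iff] at h ⊢
  let b := Module.Free.chooseBasis R R'
  let e : R' ⊗[R] C ≃ₗ[R] (Module.Free.ChooseBasisIndex R R' → C) :=
    (TensorProduct.equivFinsuppOfBasisLeft b).trans (Finsupp.linearEquivFunOnFinite R C _)
  have e' := e.symm.toAddEquiv
  exact h.pi.of_equiv e'

end Complete

end ArithJet
end
noncomputable section
set_option linter.unusedSectionVars false
namespace ArithJet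

open Prolongation

/-! ### The canonical morphism to a base change -/

section Canonical

variable {p : ℕ} [Fact p.Prime] {R R' : Type} [CommRing R] [CommRing R'] [Algebra R R']
  {D : FrobeniusBase p R} {D' : FrobeniusBase p R'}
  (hφ : ∀ r, D'.frob (algebraMap R R' r) = algebraMap R R' (D.frob r))
  (hu : D'.unif ∣ algebraMap R R' D.unif)
  {S : Prolongation D} (hS : ∀ n, Module.Flat R (S.obj n))

/-- The map `x ↦ 1 ⊗ x` to a base change. -/
def baseChangeOf (n : ℕ) : S.obj n →+* (baseChange D' hφ hu S hS).obj n :=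
  (Algebra.TensorProduct.includeRight : S.obj n →ₐ[R] R' ⊗[R] S.obj n).toRingHom

theorem baseChange_incl_of (n : ℕ) (x : S.obj n) :
    (baseChange D' hφ hu S hS).incl n (baseChangeOf hφ hu hS n x) =
      baseChangeOf hφ hu hS (n + 1) (S.incl n x) :=
  Algebra.TensorProduct.map_tmul (AlgHom.id R' R') (S.incl n) 1 x

theorem baseChange_frob (n : ℕ) (z : R' ⊗[R] S.obj n) :
    (baseChange D' hφ hu S hS).frob n z = tensorFrob D' hφ S n z := by
  have h := (baseChange D' hφ hu S hS).unif_mul_δ n z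
  have h' := (tensorFrob_dvd D' hφ hu S n z).choose_spec
  exact sub_left_injective (h.symm.trans h'.symm)

theorem baseChange_frob_of (n : ℕ) (x : S.obj n) :
    (baseChange D' hφ hu S hS).frob n (baseChangeOf hφ hu hS n x) =
      baseChangeOf hφ hu hS (n + 1) (S.frob n x) := by
  refine (baseChange_frob hφ hu hS n _).trans ?_
  refine (Algebra.TensorProduct.mapRingHom_tmul ..).trans ?_
  rw [map_one]
  rfl

theorem baseChange_unif_cancel {n : ℕ} {x y : (baseChange D' hφ hu S hS).obj n}
    (h : algebraMap R' _ D'.unif * x = algebraMap R' _ D'.unif * y) : x = y := by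
  have := hS n
  have h' : IsSMulRegular (R' ⊗[R] S.obj n) D'.unif :=
    Module.Flat.isSMulRegular_of_nonZeroDivisors D'.unif_mem
  refine h' ?_
  change D'.unif • (show R' ⊗[R] S.obj n from x) = D'.unif • (show R' ⊗[R] S.obj n from y)
  rw [Algebra.smul_def, Algebra.smul_def]
  exact h

section Hom

variable [Module.Free R R'] [Module.Finite R R']

theorem baseChange_isAdicComplete
    (hc : ∀ n, IsAdicComplete (Ideal.span {(p : S.obj n)}) (S.obj n)) (n : ℕ) :
    IsAdicComplete (Ideal.span {(p : (baseChange D' hφ hu S hS).obj n)})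
      ((baseChange D' hφ hu S hS).obj n) :=
  have := hc n
  (tensor_isAdicComplete : IsAdicComplete (Ideal.span {(p : R' ⊗[R] S.obj n)}) (R' ⊗[R] S.obj n))

variable (hc : ∀ n, IsAdicComplete (Ideal.span {(p : S.obj n)}) (S.obj n))
  {A A' : Type} [CommRing A] [Algebra R A] [CommRing A'] [Algebra R' A']
  (e : R' ⊗[R] A ≃ₐ[R'] A') (γ : A →ₐ[R] S.obj 0)

/-- The canonical morphism from the jets of a base change. -/
def canonHom : Hom (jet D' A').completion (baseChange D' hφ hu S hS) :=
  completionLift (baseChange_isAdicComplete hφ hu hS hc)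
    (jetLift _ ((Algebra.TensorProduct.map (AlgHom.id R' R') γ).comp e.symm.toAlgHom))

theorem canonHom_complOf (a : A) :
    (canonHom hφ hu hS hc e γ).hom 0 (complOf R' p _ (toJet D' A' (e (1 ⊗ₜ a)))) =
      baseChangeOf hφ hu hS 0 (γ a) := by
  rw [canonHom, completionLift_complOf]
  refine (jetLift_toJet _ _ _).trans ?_
  change Algebra.TensorProduct.map (AlgHom.id R' R') γ (e.symm (e (1 ⊗ₜ a))) = _
  rw [e.symm_apply_apply]
  rfl

/-- A separated target makes the morphisms determined by the uncompleted jets, where order `0`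
suffices. -/
theorem hom_ext_of_complete {A' : Type} [CommRing A'] [Algebra R' A'] {N : Prolongation D'}
    (hN : ∀ n, IsHausdorff (Ideal.span {(p : N.obj n)}) (N.obj n))
    {T₁ T₂ : Hom (jet D' A').completion N}
    (h : ∀ a, T₁.hom 0 (complOf R' p _ (toJet D' A' a)) =
      T₂.hom 0 (complOf R' p _ (toJet D' A' a))) : T₁ = T₂ := by
  have h' : T₁.comp (toCompletion _) = T₂.comp (toCompletion _) := jetHom_ext h
  refine Hom.ext (funext fun n => AlgHom.ext fun x => ?_)
  refine DFunLike.congr_fun (compl_ringHom_ext (f := (T₁.hom n).toRingHom)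
    (g := (T₂.hom n).toRingHom) fun a => ?_) x
  exact DFunLike.congr_fun (congrFun (congrArg Hom.hom h') n) a

/-- By `R'`-linearity, agreement on the elements `1 ⊗ a` gives agreement on the whole of `R' ⊗ A`.
-/
theorem canonHom_unique {N : Prolongation D'}
    (hN : ∀ n, IsHausdorff (Ideal.span {(p : N.obj n)}) (N.obj n))
    {T₁ T₂ : Hom (jet D' A').completion N}
    (h : ∀ a, T₁.hom 0 (complOf R' p _ (toJet D' A' (e (1 ⊗ₜ a)))) =
      T₂.hom 0 (complOf R' p _ (toJet D' A' (e (1 ⊗ₜ a))))) : T₁ = T₂ := by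
  refine hom_ext_of_complete hN fun a => ?_
  obtain ⟨z, rfl⟩ := e.surjective a
  set g₁ := (((T₁.hom 0).comp (complOf R' p _)).comp (toJetₐ D' A')).comp e.toAlgHom with hg₁
  set g₂ := (((T₂.hom 0).comp (complOf R' p _)).comp (toJetₐ D' A')).comp e.toAlgHom with hg₂
  change g₁ z = g₂ z
  induction z with
  | zero => rw [map_zero, map_zero]
  | add z w hz hw => rw [map_add, map_add, hz, hw]
  | tmul r a =>
    have hr : r ⊗ₜ[R] a = r • ((1 : R') ⊗ₜ[R] a) := by
      rw [TensorProduct.smul_tmul', smul_eq_mul, mul_one]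
    rw [hr, map_smul, map_smul]
    exact congrArg _ (h a)

end Hom

/-- The value at `Z_i = δ^(i+1) x` of a polynomial. -/
def evalElt (n : ℕ) (x : S.obj 0) :
    MvPolynomial ℕ R' →ₐ[R'] (baseChange D' hφ hu S hS).obj n :=
  MvPolynomial.aeval fun i => baseChangeOf hφ hu hS n (S.elt n (i + 1) x)

/-- Both operators are Fermat quotients of the same Frobenius. Evaluation at the `δ ^ (j + 1) x`
intertwines this Frobenius with `polyFrob`, so the recursion defining `jetPoly` becomes the one for
the iterated operator of the base change, after cancelling `unif`. -/
theorem elt_baseChangeOf (hD : D.unif = p) (n i : ℕ) (hi : i < n) (x : S.obj 0) :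
    (baseChange D' hφ hu S hS).elt n (i + 1) (baseChangeOf hφ hu hS 0 x) =
      evalElt hφ hu hS n x (jetPoly D' i) := by
  have hfrob : ∀ n j, j ≤ n → S.frob n (S.elt n j x) =
      S.elt (n + 1) j x ^ p + p * S.elt (n + 1) (j + 1) x := by
    intro n j hj
    rw [eq_add_of_sub_eq (S.unif_mul_δ n _).symm, incl_elt _ hj, δ_elt _ hj, hD, map_natCast]
    exact add_comm _ _
  have hof : ∀ n, (baseChange D' hφ hu S hS).elt n 0 (baseChangeOf hφ hu hS 0 x) =
      baseChangeOf hφ hu hS n (S.elt n 0 x) := by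
    intro n
    induction n with
    | zero => rfl
    | succ n ih =>
      rw [← incl_elt _ (Nat.zero_le n), ih, baseChange_incl_of, incl_elt _ (Nat.zero_le n)]
  -- For `j ≥ n` the value `elt n (j + 1)` is a default, so the compatibilities hold only for
  -- polynomials in the first `n` variables.
  have hincl : ∀ n f, f ∈ MvPolynomial.supported R' (Set.Iio n) →
      (baseChange D' hφ hu S hS).incl n (evalElt hφ hu hS n x f) =
        evalElt hφ hu hS (n + 1) x f := by
    intro n f hf
    refine eqOn_supported (F := ((baseChange D' hφ hu S hS).incl n).toRingHom.comp
      (evalElt hφ hu hS n x).toRingHom) (G := (evalElt hφ hu hS (n + 1) x).toRingHom)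
      (fun r => ?_) (fun j hj => ?_) hf
    · change (baseChange D' hφ hu S hS).incl n (evalElt hφ hu hS n x (algebraMap R' _ r)) =
        evalElt hφ hu hS (n + 1) x (algebraMap R' _ r)
      rw [AlgHom.commutes, AlgHom.commutes, AlgHom.commutes]
    · change (baseChange D' hφ hu S hS).incl n (evalElt hφ hu hS n x (MvPolynomial.X j)) =
        evalElt hφ hu hS (n + 1) x (MvPolynomial.X j)
      rw [evalElt, evalElt, MvPolynomial.aeval_X, MvPolynomial.aeval_X, baseChange_incl_of,
        incl_elt _ (Set.mem_Iio.mp hj)]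
  have hfr : ∀ n f, f ∈ MvPolynomial.supported R' (Set.Iio n) →
      (baseChange D' hφ hu S hS).frob n (evalElt hφ hu hS n x f) =
        evalElt hφ hu hS (n + 1) x (polyFrob D' f) := by
    intro n f hf
    refine eqOn_supported (F := ((baseChange D' hφ hu S hS).frob n).comp
      (evalElt hφ hu hS n x).toRingHom) (G := (evalElt hφ hu hS (n + 1) x).toRingHom.comp
        (polyFrob D')) (fun r => ?_) (fun j hj => ?_) hf
    · change (baseChange D' hφ hu S hS).frob n (evalElt hφ hu hS n x (algebraMap R' _ r)) =
        evalElt hφ hu hS (n + 1) x (polyFrob D' (MvPolynomial.C r))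
      rw [AlgHom.commutes, polyFrob_C, frob_algebraMap]
      exact ((evalElt hφ hu hS (n + 1) x).commutes _).symm
    · change (baseChange D' hφ hu S hS).frob n (evalElt hφ hu hS n x (MvPolynomial.X j)) =
        evalElt hφ hu hS (n + 1) x (polyFrob D' (MvPolynomial.X j))
      rw [polyFrob_X, map_add, map_pow, map_mul, map_natCast, evalElt, evalElt,
        MvPolynomial.aeval_X, MvPolynomial.aeval_X, MvPolynomial.aeval_X, baseChange_frob_of,
        hfrob n _ (Set.mem_Iio.mp hj), map_add, map_pow, map_mul, map_natCast]
  induction i generalizing n with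
  | zero =>
    obtain ⟨n, rfl⟩ := Nat.exists_eq_add_of_lt hi
    rw [Nat.zero_add, ← δ_elt _ (Nat.zero_le n), hof]
    refine baseChange_unif_cancel hφ hu hS ?_
    rw [Prolongation.unif_mul_δ, baseChange_frob_of, baseChange_incl_of, hfrob n 0 (Nat.zero_le n),
      incl_elt _ (Nat.zero_le n), map_add, map_pow, add_sub_cancel_left, map_mul, map_natCast]
    rw [jetPoly, map_mul, ← MvPolynomial.algebraMap_eq, AlgHom.commutes, ← mul_assoc, ← map_mul,
      mul_comm D'.unif, D'.ratio_mul_unif, map_natCast, evalElt, MvPolynomial.aeval_X]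
  | succ i ih =>
    obtain ⟨n, rfl⟩ := Nat.exists_eq_add_of_lt hi
    have hi' : i + 1 ≤ i + 1 + n := by omega
    rw [← δ_elt _ hi', ih (i + 1 + n) (by omega)]
    refine baseChange_unif_cancel hφ hu hS ?_
    have hs : jetPoly D' i ∈ MvPolynomial.supported R' (Set.Iio (i + 1 + n)) :=
      MvPolynomial.supported_mono (Set.Iio_subset_Iio hi') (jetPoly_mem_supported D' i)
    rw [Prolongation.unif_mul_δ, hfr _ _ hs, hincl _ _ hs, ← map_pow, ← map_sub,
      ← unif_mul_jetPoly_succ, map_mul, ← MvPolynomial.algebraMap_eq, AlgHom.commutes]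

end Canonical

end ArithJet
end
noncomputable section
set_option linter.unusedSectionVars false
namespace ArithJet

open Prolongation

/-! ### Injectivity in the presence of étale coordinates -/

section Injective

variable {p : ℕ} [Fact p.Prime] {R R' : Type} [CommRing R] [CommRing R'] [Algebra R R']
  {D : FrobeniusBase p R} {D' : FrobeniusBase p R'}
  (hφ : ∀ r, D'.frob (algebraMap R R' r) = algebraMap R R' (D.frob r))
  (hu : D'.unif ∣ algebraMap R R' D.unif)

theorem baseChange_inclIter_of {S : Prolongation D} (hS : ∀ n, Module.Flat R (S.obj n)) (n : ℕ)
    (x : S.obj 0) :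
    (baseChange D' hφ hu S hS).inclIter n (baseChangeOf hφ hu hS 0 x) =
      baseChangeOf hφ hu hS n (S.inclIter n x) := by
  induction n with
  | zero => rfl
  | succ n ih =>
    change (baseChange D' hφ hu S hS).incl n ((baseChange D' hφ hu S hS).inclIter n _) = _
    rw [ih, baseChange_incl_of]
    rfl

/-- The substitution of `ξ i (W_j)` for `Z_{i,j}`. -/
def coordSubst (A ι : Type) [CommRing A] [Algebra R A] (n : ℕ) (ξ : ℕ → MvPolynomial ℕ R') :
    MvPolynomial (Fin n × ι) A →ₐ[R] MvPolynomial (ℕ × ι) (R' ⊗[R] A) :=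
  { MvPolynomial.eval₂Hom (MvPolynomial.C.comp
      (Algebra.TensorProduct.includeRight : A →ₐ[R] R' ⊗[R] A).toRingHom)
      (fun ij : Fin n × ι => MvPolynomial.rename (fun k : ℕ => (k, ij.2))
        (MvPolynomial.map (algebraMap R' (R' ⊗[R] A)) (ξ ij.1))) with
    commutes' := fun r => by
      change MvPolynomial.eval₂ _ _ (MvPolynomial.C (algebraMap R A r)) = _
      rw [MvPolynomial.eval₂_C]
      change MvPolynomial.C (Algebra.TensorProduct.includeRight (algebraMap R A r)) = _
      rw [AlgHom.commutes]
      rfl }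

theorem coordSubst_C (A ι : Type) [CommRing A] [Algebra R A] (n : ℕ) (ξ : ℕ → MvPolynomial ℕ R')
    (a : A) : coordSubst A ι n ξ (MvPolynomial.C a) = MvPolynomial.C ((1 : R') ⊗ₜ[R] a) :=
  MvPolynomial.eval₂_C _ _ _

theorem coordSubst_X (A ι : Type) [CommRing A] [Algebra R A] (n : ℕ) (ξ : ℕ → MvPolynomial ℕ R')
    (ij : Fin n × ι) : coordSubst (R := R) A ι n ξ (MvPolynomial.X ij) =
      MvPolynomial.rename (fun k : ℕ => (k, ij.2))
        (MvPolynomial.map (algebraMap R' (R' ⊗[R] A)) (ξ ij.1)) :=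
  MvPolynomial.eval₂_X _ _ _

variable {A ι : Type} [CommRing A] [Algebra R A]
  [Algebra (MvPolynomial ι R) A] [IsScalarTower R (MvPolynomial ι R) A]
  [Algebra.FormallySmooth (MvPolynomial ι R) A]

/-- The composite from completed polynomials in the `δ' ^ i x_j` to the jets over `R'`, then by `T`
to the base change, then by the substitution `ξ` to completed polynomials, is the scaling by `p ^
M`. It is injective and its first factor is surjective, hence `T` is injective. The kernel of the
first factor need not be known in advance. -/
theorem canonical_injective_of_coordinates (hD : D.unif = p) (hD' : ∃ e, (p : R') ∣ D'.unif ^ e)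
    (hA : ∀ a : A, (p : A) * a = 0 → a = 0)
    (hA' : ∀ a : R' ⊗[R] A, (p : R' ⊗[R] A) * a = 0 → a = 0)
    (hd : DeterminesDerivations R
      (fun j : ι => algebraMap (MvPolynomial ι R) A (MvPolynomial.X j)))
    (hS : ∀ n, Module.Flat R ((jet D A).completion.obj n))
    (T : Hom (jet D' (R' ⊗[R] A)).completion (baseChange D' hφ hu (jet D A).completion hS))
    (hT : ∀ a : A, T.hom 0 (complOf R' p _ (toJet D' (R' ⊗[R] A) (1 ⊗ₜ a))) =
      baseChangeOf hφ hu hS 0 (complOf R p _ (toJet D A a))) (n : ℕ) :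
    Function.Injective (T.hom n) := by
  set x : ι → A := fun j => algebraMap (MvPolynomial ι R) A (MvPolynomial.X j) with hxdef
  set x' : ι → R' ⊗[R] A := fun j => (1 : R') ⊗ₜ[R] x j with hx'def
  have hx' : DeterminesDerivations R' x' := by
    refine hd.of_adjoin_eq_top (Algebra.TensorProduct.includeRight : A →ₐ[R] R' ⊗[R] A) ?_
    rw [eq_top_iff]
    rintro z -
    induction z with
    | zero => exact zero_mem _
    | add z w hz hw => exact add_mem hz hw
    | tmul r a =>
      have hr : r ⊗ₜ[R] a = r • ((1 : R') ⊗ₜ[R] a) := by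
        rw [TensorProduct.smul_tmul', smul_eq_mul, mul_one]
      rw [hr]
      exact Subalgebra.smul_mem _ (Algebra.subset_adjoin (Set.mem_range_self a)) r
  obtain ⟨M, ξ, hξ⟩ := exists_aeval_jetPoly D' hD' n
  let E := AlgEquiv.ofBijective _ (complMap_genMap_bijective (ι := ι) hD hA hd n)
  have hE : ∀ c, E.symm (complOf R p _ (genMap D x n c)) = complOf R p _ c := by
    intro c
    rw [AlgEquiv.symm_apply_eq]
    exact (complMap_complOf (genMap D x n) c).symm
  let g := (complMap p (coordSubst A ι n ξ)).comp E.symm.toAlgHom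
  have hg : ∀ c, g (complOf R p _ (genMap D x n c)) = complOf R p _ (coordSubst A ι n ξ c) := by
    intro c
    change complMap p _ (E.symm _) = _
    rw [hE, complMap_complOf]
  -- The coordinates on the jets over `R`, followed by the substitution `ξ` in each of them and
  -- extended `R'`-linearly, so that `δ' ^ (i + 1) x_j` goes to `p ^ M Z_{i,j}`.
  let Ψ : R' ⊗[R] Compl p ((jet D A).obj n) →ₐ[R'] Compl p (MvPolynomial (ℕ × ι) (R' ⊗[R] A)) :=
    Algebra.TensorProduct.lift (Algebra.ofId R' _) g fun _ _ => Commute.all _ _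
  have hΨ : ∀ y, Ψ (baseChangeOf hφ hu hS n y) = g y := by
    intro y
    change Algebra.TensorProduct.lift (Algebra.ofId R' _) g _ ((1 : R') ⊗ₜ[R] y) = _
    refine (Algebra.TensorProduct.lift_tmul ..).trans ?_
    rw [map_one, one_mul]
  let T' := T.comp (toCompletion (jet D' (R' ⊗[R] A)))
  have key : (Ψ.toRingHom.comp (T.hom n).toRingHom).comp
      (complMap p (genMap D' x' n)).toRingHom =
      (complMap (R := R' ⊗[R] A) p ((MvPolynomial.rename (Prod.map Fin.val id)).comp
      (scaleX ((p : R' ⊗[R] A) ^ M)) : MvPolynomial (Fin n × ι) (R' ⊗[R] A) →ₐ[R' ⊗[R] A]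
        MvPolynomial (ℕ × ι) (R' ⊗[R] A))).toRingHom := by
    refine compl_ringHom_ext fun c => ?_
    change Ψ (T.hom n (complMap p (genMap D' x' n) (complOf R' p _ c))) =
      complMap (R := R' ⊗[R] A) p _ (complOf (R' ⊗[R] A) p _ c)
    rw [complMap_complOf, complMap_complOf]
    change (((Ψ.comp (T'.hom n)).comp (genMap D' x' n)).toRingHom c) =
      ((complOf (R' ⊗[R] A) p (MvPolynomial (ℕ × ι) (R' ⊗[R] A))).comp
        ((MvPolynomial.rename (Prod.map Fin.val id)).comp
      (scaleX ((p : R' ⊗[R] A) ^ M)))).toRingHom c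
    refine DFunLike.congr_fun (MvPolynomial.ringHom_ext (fun a => ?_) (fun ij => ?_)) c
    · change Ψ (T'.hom n (genMap D' x' n (MvPolynomial.C a))) =
        complOf (R' ⊗[R] A) p _ (MvPolynomial.rename (Prod.map Fin.val id)
          (scaleX ((p : R' ⊗[R] A) ^ M) (algebraMap _ _ a)))
      rw [genMap_C, AlgHom.commutes, AlgHom.commutes]
      change (Ψ.comp ((T'.hom n).comp (jetIncl D' (R' ⊗[R] A) n))) a =
        ((complOf R' p (MvPolynomial (ℕ × ι) (R' ⊗[R] A))).comp
          (IsScalarTower.toAlgHom R' (R' ⊗[R] A) _)) a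
      refine DFunLike.congr_fun (Algebra.TensorProduct.ext (by ext) (AlgHom.ext fun a => ?_)) a
      change Ψ (T'.hom n ((jet D' (R' ⊗[R] A)).inclIter n (toJet D' (R' ⊗[R] A) (1 ⊗ₜ a)))) =
        complOf R' p _ (MvPolynomial.C ((1 : R') ⊗ₜ[R] a))
      rw [Hom.hom_inclIter]
      refine (congrArg (fun t => Ψ (inclIter _ n t)) (hT a)).trans ?_
      refine (congrArg Ψ (baseChange_inclIter_of hφ hu hS n _)).trans ?_
      rw [hΨ, ← coordSubst_C A ι n ξ]
      refine Eq.trans (congrArg g ?_) (hg _)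
      rw [genMap_C]
      exact (Hom.hom_inclIter (toCompletion (jet D A)) n (toJet D A a)).symm
    · change Ψ (T'.hom n (genMap D' x' n (MvPolynomial.X ij))) =
        complOf (R' ⊗[R] A) p _ (MvPolynomial.rename (Prod.map Fin.val id)
          (scaleX ((p : R' ⊗[R] A) ^ M) (MvPolynomial.X ij)))
      obtain ⟨i, j⟩ := ij
      rw [genMap_X, Hom.hom_elt]
      refine (congrArg (fun t => Ψ (elt _ n (i + 1) t)) (hT (x j))).trans ?_
      refine (congrArg Ψ (elt_baseChangeOf hφ hu hS hD n i i.2 _)).trans ?_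
      have h1 : Ψ (evalElt hφ hu hS n (complOf R p _ (toJet D A (x j))) (jetPoly D' i)) =
          complOf R' p _ (MvPolynomial.rename (fun k : ℕ => (k, j)) (MvPolynomial.map
            (algebraMap R' (R' ⊗[R] A)) (MvPolynomial.aeval ξ (jetPoly D' i)))) := by
        refine eqOn_supported (F := Ψ.toRingHom.comp (evalElt hφ hu hS n
          (complOf R p _ (toJet D A (x j)))).toRingHom) (G := (complOf R' p _).toRingHom.comp
          ((MvPolynomial.rename (R := R' ⊗[R] A) (fun k : ℕ => (k, j))).toRingHom.comp
            ((MvPolynomial.map (algebraMap R' (R' ⊗[R] A))).comp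
              (MvPolynomial.aeval ξ).toRingHom))) (s := Set.Iio n) (fun r => ?_) (fun k hk => ?_)
          (MvPolynomial.supported_mono (Set.Iio_subset_Iio i.2) (jetPoly_mem_supported D' i))
        · change Ψ (evalElt hφ hu hS n _ (algebraMap _ _ r)) = complOf R' p _ (MvPolynomial.rename
            (fun k : ℕ => (k, j)) (MvPolynomial.map (algebraMap R' (R' ⊗[R] A))
              (MvPolynomial.aeval ξ (MvPolynomial.C r))))
          rw [MvPolynomial.aeval_C, MvPolynomial.algebraMap_eq, MvPolynomial.map_C,
            MvPolynomial.rename_C]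
          refine (congrArg Ψ ((evalElt hφ hu hS n _).commutes r)).trans ?_
          refine (Ψ.commutes r).trans ?_
          exact ((complOf R' p (MvPolynomial (ℕ × ι) (R' ⊗[R] A))).commutes r).symm
        · change Ψ (evalElt hφ hu hS n _ (MvPolynomial.X k)) = complOf R' p _ (MvPolynomial.rename
            (fun k : ℕ => (k, j)) (MvPolynomial.map (algebraMap R' (R' ⊗[R] A))
              (MvPolynomial.aeval ξ (MvPolynomial.X k))))
          refine (congrArg Ψ (MvPolynomial.aeval_X _ k)).trans ?_
          rw [hΨ, MvPolynomial.aeval_X]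
          rw [← coordSubst_X (R := R) A ι n ξ (⟨k, hk⟩, j)]
          refine Eq.trans (congrArg g ?_) (hg _)
          rw [genMap_X]
          exact (Hom.hom_elt (toCompletion (jet D A)) n (k + 1) (toJet D A (x j))).symm
      rw [h1, hξ i i.2, scaleX, MvPolynomial.aeval_X, map_mul, map_pow, map_natCast,
        MvPolynomial.map_X, map_mul, map_pow, map_natCast, MvPolynomial.rename_X,
        map_mul (MvPolynomial.rename _), MvPolynomial.rename_X, MvPolynomial.rename_C, map_pow,
        map_natCast]
      rfl
  have hinj := complMap_scale_injective (p := p) hA'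
    (f := (Prod.map Fin.val id : Fin n × ι → ℕ × ι))
    (Function.Injective.prodMap Fin.val_injective Function.injective_id) M
  intro y z hyz
  obtain ⟨y, rfl⟩ := complMap_genMap_surjective D' hD' hx' n y
  obtain ⟨z, rfl⟩ := complMap_genMap_surjective D' hD' hx' n z
  congr 1
  refine hinj ?_
  have h1 := DFunLike.congr_fun key y
  have h2 := DFunLike.congr_fun key z
  exact h1.symm.trans ((congrArg Ψ hyz).trans h2)

end Injective

end ArithJet
end
noncomputable section
set_option linter.unusedSectionVars false
namespace ArithJet

open Prolongation

/-! ### Smooth algebras -/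

section BaseChangeMap

variable {p : ℕ} [Fact p.Prime] {R R' : Type} [CommRing R] [CommRing R'] [Algebra R R']
  {D : FrobeniusBase p R} {D' : FrobeniusBase p R'}
  (hφ : ∀ r, D'.frob (algebraMap R R' r) = algebraMap R R' (D.frob r))
  (hu : D'.unif ∣ algebraMap R R' D.unif)
  {S T : Prolongation D} (hS : ∀ n, Module.Flat R (S.obj n)) (hT : ∀ n, Module.Flat R (T.obj n))

theorem Hom.hom_frob {S T : Prolongation D} (g : Hom S T) (n : ℕ) (x : S.obj n) :
    g.hom (n + 1) (S.frob n x) = T.frob n (g.hom n x) := by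
  change g.hom (n + 1) (S.incl n x ^ p + algebraMap R _ D.unif * S.δ n x) =
    T.incl n (g.hom n x) ^ p + algebraMap R _ D.unif * T.δ n (g.hom n x)
  rw [map_add, map_mul, map_pow, g.hom_incl, g.hom_δ, AlgHom.commutes]

/-- The base change of a morphism of prolongation sequences. -/
def baseChangeMap (g : Hom S T) : Hom (baseChange D' hφ hu S hS) (baseChange D' hφ hu T hT) :=
  have hincl : ∀ n (x : R' ⊗[R] S.obj n),
      Algebra.TensorProduct.map (AlgHom.id R' R') (g.hom (n + 1))
        (Algebra.TensorProduct.map (AlgHom.id R' R') (S.incl n) x) =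
      Algebra.TensorProduct.map (AlgHom.id R' R') (T.incl n)
        (Algebra.TensorProduct.map (AlgHom.id R' R') (g.hom n) x) := fun n x => by
    induction x with
    | zero => simp
    | add x y hx hy => simp only [map_add, hx, hy]
    | tmul r x => simp only [Algebra.TensorProduct.map_tmul, g.hom_incl]
  have hfrob : ∀ n (x : R' ⊗[R] S.obj n),
      Algebra.TensorProduct.map (AlgHom.id R' R') (g.hom (n + 1)) (tensorFrob D' hφ S n x) =
      tensorFrob D' hφ T n (Algebra.TensorProduct.map (AlgHom.id R' R') (g.hom n) x) :=
    fun n x => by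
    induction x with
    | zero => simp
    | add x y hx hy => simp only [map_add, hx, hy]
    | tmul r x =>
      have h1 : tensorFrob D' hφ S n (r ⊗ₜ x) = D'.frob r ⊗ₜ S.frob n x :=
        Algebra.TensorProduct.mapRingHom_tmul ..
      have h2 : tensorFrob D' hφ T n (r ⊗ₜ g.hom n x) = D'.frob r ⊗ₜ T.frob n (g.hom n x) :=
        Algebra.TensorProduct.mapRingHom_tmul ..
      rw [h1, Algebra.TensorProduct.map_tmul, Algebra.TensorProduct.map_tmul, AlgHom.id_apply,
        AlgHom.id_apply, h2, Hom.hom_frob]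
  { hom := fun n => (Algebra.TensorProduct.map (AlgHom.id R' R') (g.hom n) :
      R' ⊗[R] S.obj n →ₐ[R'] R' ⊗[R] T.obj n)
    hom_incl := hincl
    hom_δ := fun n x => by
      let F : ∀ n, (baseChange D' hφ hu S hS).obj n →ₐ[R'] (baseChange D' hφ hu T hT).obj n :=
        fun n => (Algebra.TensorProduct.map (AlgHom.id R' R') (g.hom n) :
          R' ⊗[R] S.obj n →ₐ[R'] R' ⊗[R] T.obj n)
      refine baseChange_unif_cancel hφ hu hT ?_
      change _ * F (n + 1) _ = _ * (baseChange D' hφ hu T hT).δ n (F n x)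
      rw [Prolongation.unif_mul_δ, ← (F (n + 1)).commutes, ← map_mul, Prolongation.unif_mul_δ,
        map_sub, map_pow]
      refine congrArg₂ (fun a b => a - b ^ p) ?_ (hincl n x)
      refine (congrArg (F (n + 1)) (baseChange_frob hφ hu hS n x)).trans ?_
      exact (hfrob n x).trans (baseChange_frob hφ hu hT n _).symm }

theorem baseChangeMap_of (g : Hom S T) (n : ℕ) (x : S.obj n) :
    (baseChangeMap hφ hu hS hT g).hom n (baseChangeOf hφ hu hS n x) =
      baseChangeOf hφ hu hT n (g.hom n x) :=
  Algebra.TensorProduct.map_tmul (AlgHom.id R' R') (g.hom n) 1 x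

end BaseChangeMap

section Smooth

/-- Near each prime a smooth algebra is standard étale over a polynomial ring. One function is
chosen for each prime, and these functions lie in no common maximal ideal. -/
theorem exists_coordinate_cover (R A : Type) [CommRing R] [CommRing A] [Algebra R A]
    [Algebra.Smooth R A] : ∃ g : PrimeSpectrum A → A, Ideal.span (Set.range g) = ⊤ ∧
      ∀ i, ∃ (n : ℕ) (_ : Algebra (MvPolynomial (Fin n) R) (Localization.Away (g i))),
        IsScalarTower R (MvPolynomial (Fin n) R) (Localization.Away (g i)) ∧
        Algebra.FormallyEtale (MvPolynomial (Fin n) R) (Localization.Away (g i)) := by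
  have (m : PrimeSpectrum A) : ∃ f ∉ m.asIdeal,
      ∃ (n : ℕ) (_ : Algebra (MvPolynomial (Fin n) R) (Localization.Away f)),
        IsScalarTower R (MvPolynomial (Fin n) R) (Localization.Away f) ∧
        Algebra.FormallyEtale (MvPolynomial (Fin n) R) (Localization.Away f) := by
    obtain ⟨f, hfm, n, h1, h2, h3⟩ :=
      Algebra.IsSmoothAt.exists_isStandardEtale_mvPolynomial (R := R) (p := m.asIdeal)
    exact ⟨f, hfm, n, h1, h2, inferInstance⟩
  choose g hgm hg using this
  refine ⟨g, ?_, hg⟩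
  by_contra H
  obtain ⟨m, hm, e⟩ := Ideal.exists_le_maximal _ H
  exact hgm ⟨m, inferInstance⟩ (e (Ideal.subset_span (Set.mem_range_self ⟨m, inferInstance⟩)) :)

theorem isLocalization_toAlgHom (R : Type) {A B : Type} [CommRing R] [CommRing A] [CommRing B]
    [Algebra R A] [Algebra R B] [Algebra A B] [IsScalarTower R A B] (g : A)
    [h : IsLocalization.Away g B] :
    @IsLocalization.Away A _ g B _ (IsScalarTower.toAlgHom R A B).toRingHom.toAlgebra := by
  convert h
  exact Algebra.algebra_ext _ _ fun _ => rfl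

theorem isLocalization_tensor {R R' A B : Type} [CommRing R] [CommRing R'] [CommRing A]
    [CommRing B] [Algebra R R'] [Algebra R A] [Algebra R B] (g : A) (β : A →ₐ[R] B)
    (hβ : @IsLocalization.Away A _ g B _ β.toRingHom.toAlgebra) :
    @IsLocalization.Away (R' ⊗[R] A) _ (1 ⊗ₜ g) (R' ⊗[R] B) _
      (Algebra.TensorProduct.map (AlgHom.id R' R') β).toRingHom.toAlgebra := by
  let : Algebra A B := β.toRingHom.toAlgebra
  have : IsScalarTower R A B := .of_algebraMap_eq fun r => (β.commutes r).symm
  let : Algebra (R' ⊗[R] A) (R' ⊗[R] B) :=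
    (Algebra.TensorProduct.map (AlgHom.id R' R') β).toRingHom.toAlgebra
  have : IsScalarTower R' (R' ⊗[R] A) (R' ⊗[R] B) := .of_algebraMap_eq fun r =>
    ((Algebra.TensorProduct.map (AlgHom.id R' R') β).commutes r).symm
  have h := IsLocalization.tensorProduct_tensorProduct_right R R' (Submonoid.powers g) B
    (RingHom.ext fun a => Algebra.TensorProduct.map_tmul (AlgHom.id R' R') β 1 a)
  rw [Submonoid.map_powers] at h
  exact h

theorem span_range_tmul_eq_top {R R' A ι : Type} [CommRing R] [CommRing R'] [CommRing A]
    [Algebra R R'] [Algebra R A] {g : ι → A} (hg : Ideal.span (Set.range g) = ⊤) :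
    Ideal.span (Set.range fun i => (1 : R') ⊗ₜ[R] g i) = ⊤ := by
  have h := congrArg (Ideal.map (Algebra.TensorProduct.includeRight : A →ₐ[R] R' ⊗[R] A)) hg
  rw [Ideal.map_span, Ideal.map_top, ← Set.range_comp] at h
  exact h

variable {p : ℕ} [Fact p.Prime]

section General

variable {R R' : Type} [CommRing R] [CommRing R'] [Algebra R R']
  {D : FrobeniusBase p R} {D' : FrobeniusBase p R'}

theorem torsionFree_of_flat {B : Type} [CommRing B] [Algebra R B] [Module.Flat R B]
    (hp : (p : R) ∈ nonZeroDivisors R) (b : B) (hb : (p : B) * b = 0) : b = 0 := by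
  have h : IsSMulRegular B (p : R) := Module.Flat.isSMulRegular_of_nonZeroDivisors hp
  refine h ?_
  change (p : R) • b = (p : R) • (0 : B)
  rw [smul_zero, Algebra.smul_def, map_natCast, hb]

/-- The completed jet algebras of smooth algebras have no `p`-torsion. -/
theorem jet_completion_torsionFree (hD : D.unif = p) {A : Type} [CommRing A] [Algebra R A]
    [Algebra.Smooth R A] (n : ℕ) (y : Compl p ((jet D A).obj n))
    (hy : (p : Compl p ((jet D A).obj n)) * y = 0) : y = 0 := by
  obtain ⟨g, hg, hc⟩ := exists_coordinate_cover R A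
  refine eq_zero_of_forall_completionMap_eq_zero (D := D) ⟨1, by rw [hD, pow_one]⟩ g hg
    (fun i => Localization.Away (g i)) (fun i => IsScalarTower.toAlgHom R A _) (fun i => ?_) y
    (fun i => ?_)
  · exact isLocalization_toAlgHom R (g i)
  · obtain ⟨m, _, _, _⟩ := hc i
    have : Algebra.Smooth A (Localization.Away (g i)) := ⟨inferInstance, inferInstance⟩
    have : Algebra.Smooth R (Localization.Away (g i)) := Algebra.Smooth.comp R A _
    refine jet_completion_torsionFree_of_coordinates (ι := Fin m) hD
      (torsionFree_of_flat (hD ▸ D.unif_mem))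
      determinesDerivations_of_formallyUnramified n _ ?_
    change (p : Compl p ((jet D (Localization.Away (g i))).obj n)) *
      complMap p ((jetMap D (IsScalarTower.toAlgHom R A (Localization.Away (g i)))).hom n) y = 0
    rw [← map_natCast (complMap p ((jetMap D (IsScalarTower.toAlgHom R A
      (Localization.Away (g i)))).hom n)), ← map_mul, hy, map_zero]

variable (hφ : ∀ r, D'.frob (algebraMap R R' r) = algebraMap R R' (D.frob r))
  (hu : D'.unif ∣ algebraMap R R' D.unif) [Module.Free R R'] [Module.Finite R R']

/-- Both composites have the same effect on the elements `1 ⊗ a` of order `0`, so uniqueness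
applies. -/
theorem canonical_naturality (hS : ∀ (B : Type) [CommRing B] [Algebra R B] [Algebra.Smooth R B],
      ∀ n, Module.Flat R ((jet D B).completion.obj n))
    {A B : Type} [CommRing A] [Algebra R A] [Algebra.Smooth R A] [CommRing B] [Algebra R B]
    [Algebra.Smooth R B] (β : A →ₐ[R] B) {A' B' : Type} [CommRing A'] [Algebra R' A'] [CommRing B']
    [Algebra R' B'] (e : R' ⊗[R] A ≃ₐ[R'] A') (e' : B → B') (β' : A' →ₐ[R'] B')
    (hβ : ∀ a, β' (e (1 ⊗ₜ a)) = e' (β a))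
    (T : Hom (jet D' A').completion (baseChange D' hφ hu (jet D A).completion (hS A)))
    (hT : ∀ a : A, T.hom 0 (complOf R' p _ (toJet D' A' (e (1 ⊗ₜ a)))) =
      baseChangeOf hφ hu (hS A) 0 (complOf R p _ (toJet D A a)))
    (T' : Hom (jet D' B').completion (baseChange D' hφ hu (jet D B).completion (hS B)))
    (hT' : ∀ b : B, T'.hom 0 (complOf R' p _ (toJet D' B' (e' b))) =
      baseChangeOf hφ hu (hS B) 0 (complOf R p _ (toJet D B b))) :
    T'.comp (completionMap (jetMap D' β')) =
      (baseChangeMap hφ hu (hS A) (hS B) (completionMap (jetMap D β))).comp T := by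
  refine canonHom_unique e (fun n => (baseChange_isAdicComplete hφ hu (hS B)
    (fun n => compl_isAdicComplete) n).toIsHausdorff) fun a => ?_
  change T'.hom 0 (complMap p ((jetMap D' β').hom 0) (complOf R' p _ (toJet D' A' (e (1 ⊗ₜ a))))) =
    (baseChangeMap hφ hu (hS A) (hS B) (completionMap (jetMap D β))).hom 0
      (T.hom 0 (complOf R' p _ (toJet D' A' (e (1 ⊗ₜ a)))))
  rw [hT, complMap_complOf, jetMap_toJet, hβ, hT']
  refine Eq.trans ?_ (baseChangeMap_of hφ hu (hS A) (hS B) (completionMap (jetMap D β)) 0 _).symm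
  change _ = baseChangeOf hφ hu (hS B) 0 (complMap p ((jetMap D β).hom 0) (complOf R p _ _))
  rw [complMap_complOf, jetMap_toJet]

theorem completionMap_jetMap_surjective {A B : Type} [CommRing A] [Algebra R A] [CommRing B]
    [Algebra R B] (e : A ≃ₐ[R] B) (n : ℕ) :
    Function.Surjective ((completionMap (jetMap D e.toAlgHom)).hom n) := by
  refine complMap_surjective _ fun b => ⟨(jetMap D e.symm.toAlgHom).hom n b, 0, ?_⟩
  have h : (jetMap D e.toAlgHom).comp (jetMap D e.symm.toAlgHom) = ⟨fun n => AlgHom.id R _,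
      fun _ _ => rfl, fun _ _ => rfl⟩ := jetHom_ext fun b => by
    change (jetMap D e.toAlgHom).hom 0 ((jetMap D e.symm.toAlgHom).hom 0 (toJet D B b)) =
      toJet D B b
    rw [jetMap_toJet, jetMap_toJet]
    exact congrArg _ (e.apply_symm_apply b)
  rw [mul_zero, add_zero]
  exact (DFunLike.congr_fun (congrFun (congrArg Hom.hom h) n) b).symm

/-- An element of the kernel is restricted to a cover on which coordinates exist. By naturality its
restrictions lie in the kernels of the local maps, hence vanish. -/
theorem canonical_injective (hD : D.unif = p) (hD' : ∃ e, (p : R') ∣ D'.unif ^ e)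
    (hS : ∀ (B : Type) [CommRing B] [Algebra R B] [Algebra.Smooth R B],
      ∀ n, Module.Flat R ((jet D B).completion.obj n))
    {A : Type} [CommRing A] [Algebra R A] [Algebra.Smooth R A] {A' : Type} [CommRing A']
    [Algebra R' A'] (e : R' ⊗[R] A ≃ₐ[R'] A')
    (T : Hom (jet D' A').completion (baseChange D' hφ hu (jet D A).completion (hS A)))
    (hT : ∀ a : A, T.hom 0 (complOf R' p _ (toJet D' A' (e (1 ⊗ₜ a)))) =
      baseChangeOf hφ hu (hS A) 0 (complOf R p _ (toJet D A a))) (n : ℕ) :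
    Function.Injective (T.hom n) := by
  -- The identification `e` reduces to the case `A' = R' ⊗ A`.
  suffices h : Function.Injective ((T.comp (completionMap (jetMap D' e.toAlgHom))).hom n) by
    intro x y hxy
    obtain ⟨x, rfl⟩ := completionMap_jetMap_surjective e n x
    obtain ⟨y, rfl⟩ := completionMap_jetMap_surjective e n y
    exact congrArg _ (h hxy)
  set T₁ := T.comp (completionMap (jetMap D' e.toAlgHom)) with hT₁def
  have hT₁ : ∀ a : A, T₁.hom 0 (complOf R' p _ (toJet D' (R' ⊗[R] A) (1 ⊗ₜ a))) =
      baseChangeOf hφ hu (hS A) 0 (complOf R p _ (toJet D A a)) := by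
    intro a
    rw [← hT a]
    change T.hom 0 (complMap p ((jetMap D' e.toAlgHom).hom 0) (complOf R' p _ _)) = _
    rw [complMap_complOf, jetMap_toJet]
    rfl
  rw [injective_iff_map_eq_zero]
  intro x hx
  obtain ⟨g, hg, hc⟩ := exists_coordinate_cover R A
  refine eq_zero_of_forall_completionMap_eq_zero (D := D') hD' (fun i => (1 : R') ⊗ₜ[R] g i)
    (span_range_tmul_eq_top hg)
    (fun i => R' ⊗[R] Localization.Away (g i)) (fun i => Algebra.TensorProduct.map
      (AlgHom.id R' R') (IsScalarTower.toAlgHom R A _)) (fun i => isLocalization_tensor _ _ ?_) x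
    (fun i => ?_)
  · exact isLocalization_toAlgHom R (g i)
  · obtain ⟨m, _, _, _⟩ := hc i
    have : Algebra.Smooth A (Localization.Away (g i)) := ⟨inferInstance, inferInstance⟩
    have : Algebra.Smooth R (Localization.Away (g i)) := Algebra.Smooth.comp R A _
    let T₂ := canonHom hφ hu (hS (Localization.Away (g i))) (fun n => compl_isAdicComplete)
      (AlgEquiv.refl : (R' ⊗[R] Localization.Away (g i)) ≃ₐ[R'] _)
      ((complOf R p _).comp (toJetₐ D (Localization.Away (g i))))
    have hT₂ : ∀ b, T₂.hom 0 (complOf R' p _ (toJet D' (R' ⊗[R] Localization.Away (g i))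
        (1 ⊗ₜ b))) = baseChangeOf hφ hu (hS (Localization.Away (g i))) 0
          (complOf R p _ (toJet D (Localization.Away (g i)) b)) :=
      canonHom_complOf hφ hu (hS (Localization.Away (g i))) (fun n => compl_isAdicComplete)
        AlgEquiv.refl _
    have hp : (p : R) ∈ nonZeroDivisors R := hD ▸ D.unif_mem
    have hinj := canonical_injective_of_coordinates hφ hu (ι := Fin m) hD hD'
      (torsionFree_of_flat hp) (torsionFree_of_flat hp)
      determinesDerivations_of_formallyUnramified (hS (Localization.Away (g i))) T₂ hT₂ n
    refine hinj ?_
    rw [map_zero]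
    have hnat := canonical_naturality hφ hu hS (IsScalarTower.toAlgHom R A (Localization.Away (g i)))
      AlgEquiv.refl (fun b => (1 : R') ⊗ₜ[R] b) (Algebra.TensorProduct.map (AlgHom.id R' R')
        (IsScalarTower.toAlgHom R A (Localization.Away (g i))))
      (fun a => Algebra.TensorProduct.map_tmul (AlgHom.id R' R') _ 1 a) T₁ hT₁ T₂ hT₂
    refine (DFunLike.congr_fun (congrFun (congrArg Hom.hom hnat) n) x).trans ?_
    change (baseChangeMap hφ hu (hS A) _ _).hom n (T₁.hom n x) = 0
    rw [hx, map_zero]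

end General

end Smooth

end ArithJet
end
noncomputable section
set_option linter.unusedSectionVars false
namespace ArithJet

open Prolongation

/-! ### The base rings -/

section Bases

variable (p : ℕ) [Fact p.Prime]

/-- Every non-zero element of `R_p` is a power of `p` times a unit, so absence of `p`-torsion is
absence of torsion, and over a Dedekind domain this is flatness. -/
theorem flat_of_torsionFree {M : Type} [CommRing M] [Algebra (Rp p) M]
    (h : ∀ x : M, (p : M) * x = 0 → x = 0) : Module.Flat (Rp p) M := by
  have hpow : ∀ (m : ℕ) (x : M), (p : M) ^ m * x = 0 → x = 0 := by
    intro m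
    induction m with
    | zero => intro x hx; rwa [pow_zero, one_mul] at hx
    | succ m ih => intro x hx; exact ih x (h _ (by rw [← hx]; ring))
  rw [IsDedekindDomain.flat_iff_torsion_eq_bot, eq_bot_iff]
  rintro x ⟨⟨r, hr⟩, hx⟩
  have hx' : r • x = 0 := hx
  obtain ⟨m, u, rfl⟩ := WittVector.exists_eq_pow_p_mul' r (nonZeroDivisors.ne_zero hr)
  refine hpow m x ?_
  rw [mul_smul, Algebra.smul_def, map_pow, map_natCast] at hx'
  have h1 := hpow m _ hx'
  have h2 : x = (↑u⁻¹ : Rp p) • ((u : Rp p) • x) := by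
    rw [← mul_smul, Units.inv_mul, one_smul]
  rw [h2, h1, smul_zero, mul_zero]

theorem jet_completion_flat (B : Type) [CommRing B] [Algebra (Rp p) B]
    [Algebra.Smooth (Rp p) B] (n : ℕ) :
    Module.Flat (Rp p) ((jet (baseP p) B).completion.obj n) :=
  flat_of_torsionFree p (M := Compl p ((jet (baseP p) B).obj n))
    (jet_completion_torsionFree (D := baseP p) rfl n)

variable {p} {E : ℤ_[p][X]}

theorem free_Rpi (hE : IsRamifiedEisenstein p E) : Module.Free (Rp p) (Rpi p E) := (hE.monic.map _).free_adjoinRoot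

theorem finite_Rpi (hE : IsRamifiedEisenstein p E) : Module.Finite (Rp p) (Rpi p E) := (hE.monic.map _).finite_adjoinRoot

/-- The Eisenstein equation makes `π ^ deg E` a multiple of `p`. -/
theorem exists_p_dvd_pi_pow (hE : IsRamifiedEisenstein p E) : ∃ e, (p : Rpi p E) ∣ piElt p E ^ e := by
  let : Algebra ℤ_[p] (Rpi p E) := ((AdjoinRoot.of _).comp (padicToRp p)).toAlgebra
  have h0 : aeval (piElt p E) E = 0 := by
    rw [aeval_def]
    change eval₂ ((AdjoinRoot.of _).comp (padicToRp p)) _ E = 0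
    rw [← eval₂_map]
    exact AdjoinRoot.eval₂_root _
  obtain ⟨y, -, hy⟩ := hE.eisenstein.isWeaklyEisensteinAt.exists_mem_adjoin_mul_eq_pow_natDegree
    h0 hE.monic
  rw [map_natCast] at hy
  exact ⟨_, Dvd.intro y hy⟩

/-- In `E π = 0` the constant term is `p` times a unit. Because the degree is at least `2`, the
linear coefficient is also divisible by `p`, hence by `π`, so all other terms are divisible by `π ^
2`. -/
theorem pi_sq_dvd_p (hE : IsRamifiedEisenstein p E) : piElt p E ^ 2 ∣ (p : Rpi p E) := by
  obtain ⟨u, ⟨u, rfl⟩, h⟩ := exists_unit_coeff_zero p hE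
  obtain ⟨c, hc⟩ := Ideal.mem_span_singleton.mp
    (hE.eisenstein.mem (n := 1) (by have := hE.two_le; omega))
  let F := E.map (padicToRp p)
  have h1 : AdjoinRoot.mk F F = 0 := AdjoinRoot.mk_self
  have h2 : F = X * (X * F.divX.divX + C (F.coeff 1)) + C (F.coeff 0) := by
    conv_lhs => rw [← Polynomial.X_mul_divX_add F, ← Polynomial.X_mul_divX_add F.divX]
    rw [coeff_divX]
  obtain ⟨d, hd⟩ := pi_dvd_p p hE
  have hc0 : AdjoinRoot.of F (F.coeff 0) = p * AdjoinRoot.of F (padicToRp p u) := by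
    rw [coeff_map, h, map_mul, map_mul, map_natCast, map_natCast]
  have hc1 : AdjoinRoot.of F (F.coeff 1) = piElt p E * d * AdjoinRoot.of F (padicToRp p c) := by
    rw [← hd, coeff_map, hc, map_mul, map_mul, map_natCast, map_natCast]
  have h3 := (congrArg (AdjoinRoot.mk F) h2).symm.trans h1
  rw [map_add, map_mul, map_add, map_mul, AdjoinRoot.mk_X, AdjoinRoot.mk_C, AdjoinRoot.mk_C, hc0,
    hc1] at h3
  have h4 : AdjoinRoot.of F (padicToRp p u) * AdjoinRoot.of F (padicToRp p ↑u⁻¹) = 1 := by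
    rw [← map_mul, ← map_mul, Units.mul_inv, map_one, map_one]
  refine ⟨-(AdjoinRoot.mk F F.divX.divX + d * AdjoinRoot.of F (padicToRp p c)) *
    AdjoinRoot.of F (padicToRp p ↑u⁻¹), ?_⟩
  linear_combination (AdjoinRoot.of F (padicToRp p ↑u⁻¹)) * h3 - (p : Rpi p E) * h4

/-- The reduction map `R_π → k`. -/
def reducePi (hE : IsRamifiedEisenstein p E) : Rpi p E →+* ResidueField p :=
  AdjoinRoot.lift WittVector.constantCoeff 0 (by
    rw [eval₂_at_zero, Polynomial.coeff_map]
    obtain ⟨u, -, h⟩ := exists_unit_coeff_zero p hE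
    rw [h, map_mul, map_mul, map_natCast, map_natCast, CharP.cast_eq_zero, zero_mul])

theorem reducePi_algebraMap (hE : IsRamifiedEisenstein p E) (r : Rp p) :
    reducePi hE (algebraMap (Rp p) (Rpi p E) r) = WittVector.constantCoeff r :=
  AdjoinRoot.lift_of _

theorem reducePi_pi (hE : IsRamifiedEisenstein p E) : reducePi hE (piElt p E) = 0 :=
  AdjoinRoot.lift_root _

/-- Modulo `π` every element is a constant from `R_p`, and a constant reducing to zero is divisible
by `p`. -/
theorem pi_dvd_of_reducePi_eq_zero (hE : IsRamifiedEisenstein p E) {x : Rpi p E}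
    (hx : reducePi hE x = 0) : piElt p E ∣ x := by
  obtain ⟨f, rfl⟩ := AdjoinRoot.mk_surjective x
  have key : AdjoinRoot.mk (E.map (padicToRp p)) f =
      piElt p E * AdjoinRoot.mk _ f.divX + algebraMap (Rp p) (Rpi p E) (f.coeff 0) := by
    nth_rewrite 1 [← Polynomial.X_mul_divX_add f]
    rw [map_add, map_mul, AdjoinRoot.mk_X, AdjoinRoot.mk_C]
    rfl
  rw [key, map_add, map_mul, reducePi_pi, zero_mul, zero_add, reducePi_algebraMap,
    ← RingHom.mem_ker, WittVector.ker_constantCoeff, Ideal.mem_span_singleton] at hx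
  rw [key]
  obtain ⟨c, hc⟩ := hx
  rw [hc, map_mul, map_natCast]
  exact dvd_add (dvd_mul_right _ _) ((pi_dvd_p p hE).mul_right _)

theorem isAdicComplete_Rpi (hE : IsRamifiedEisenstein p E) : IsAdicComplete (Ideal.span {(p : Rpi p E)}) (Rpi p E) := by
  have := free_Rpi hE
  have := finite_Rpi hE
  have h : IsAdicComplete (Ideal.span {(p : Rpi p E ⊗[Rp p] Rp p)}) (Rpi p E ⊗[Rp p] Rp p) :=
    tensor_isAdicComplete
  rw [← pComplete_iff] at h ⊢
  exact h.of_equiv (TensorProduct.rid (Rp p) (Rpi p E)).toAddEquiv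

end Bases

/-- Completeness depends only on the ideal up to powers. -/
theorem isAdicComplete_of_dvd_pow {B : Type} [CommRing B] {q r : B} {a b : ℕ} (hq : q ∣ r ^ a)
    (hr : r ∣ q ^ b) [h : IsAdicComplete (Ideal.span {r}) B] :
    IsAdicComplete (Ideal.span {q}) B := by
  have hmem : ∀ (s : B) (m : ℕ) (x : B), x ∈ (Ideal.span {s} ^ m • ⊤ : Submodule B B) ↔
      s ^ m ∣ x := by
    intro s m x
    rw [smul_eq_mul, Ideal.mul_top, Ideal.span_singleton_pow, Ideal.mem_span_singleton]
  have hq' : ∀ m, q ^ m ∣ r ^ (a * m) := fun m => by rw [pow_mul]; exact pow_dvd_pow_of_dvd hq m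
  have hr' : ∀ m, r ^ m ∣ q ^ (b * m) := fun m => by rw [pow_mul]; exact pow_dvd_pow_of_dvd hr m
  refine @IsAdicComplete.mk _ _ _ _ _ _ ⟨fun x hx => h.haus' x fun m => ?_⟩ ⟨fun f hf => ?_⟩
  · have := hx (b * m)
    rw [SModEq.zero, hmem] at this ⊢
    exact (hr' m).trans this
  · have hf' : ∀ {m n}, m ≤ n → q ^ m ∣ f m - f n := fun {m n} hmn => by
      have := hf hmn
      rwa [SModEq.sub_mem, hmem] at this
    -- Passing to the subsequence of indices `b * m` turns a `q`-adic Cauchy sequence into an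
    -- `r`-adic one.
    obtain ⟨L, hL⟩ := h.prec' (fun m => f (b * m)) fun {m n} hmn => by
      rw [SModEq.sub_mem, hmem]
      exact (hr' m).trans (hf' (Nat.mul_le_mul_left b hmn))
    refine ⟨L, fun m => ?_⟩
    rw [SModEq.sub_mem, hmem]
    -- The summand `a * m` yields divisibility by `q ^ m`. The summand `m` makes the index `b * (m +
    -- a * m)` at least `m`, except when `b = 0`, where `r` and `q` are units.
    have h1 := hL (m + a * m)
    rw [SModEq.sub_mem, hmem] at h1
    have h2 : q ^ m ∣ f (b * (m + a * m)) - L :=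
      ((hq' m).trans (pow_dvd_pow r (Nat.le_add_left _ _))).trans h1
    rcases le_total m (b * (m + a * m)) with h3 | h3
    · have := dvd_add (hf' h3) h2
      rwa [sub_add_sub_cancel] at this
    · rcases Nat.eq_zero_or_pos b with rfl | hb
      · have hu : IsUnit r := isUnit_of_dvd_one (by rwa [pow_zero] at hr)
        have hu' : IsUnit q := isUnit_of_dvd_unit hq (hu.pow a)
        exact (hu'.pow m).dvd
      · have h4 : m = b * (m + a * m) :=
          le_antisymm ((Nat.le_add_right _ _).trans (Nat.le_mul_of_pos_left _ hb)) h3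
        rwa [← h4] at h2

end ArithJet
end
noncomputable section
set_option linter.unusedSectionVars false
namespace ArithJet

open Prolongation

/-! ### Points and tangent vectors -/

section Tangent

/-- An algebra of finite type and positive dimension over an algebraically closed field has a
rational point with a non-zero tangent vector. -/
theorem exists_tangent {k B : Type} [Field k] [IsAlgClosed k] [CommRing B] [Algebra k B]
    [Algebra.FiniteType k B] (h : 0 < ringKrullDim B) :
    ∃ (ev : B →ₐ[k] k) (d : B →ₗ[k] k), (∀ x y, d (x * y) = ev x * d y + ev y * d x) ∧
      ∃ b, d b ≠ 0 := by
  obtain ⟨𝔭, 𝔮, hlt⟩ := Order.krullDim_pos_iff.mp h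
  obtain ⟨m, hm, hqm⟩ := Ideal.exists_le_maximal 𝔮.asIdeal 𝔮.2.ne_top
  have hpm : 𝔭.asIdeal < m := lt_of_lt_of_le hlt hqm
  have : IsNoetherianRing B := Algebra.FiniteType.isNoetherianRing k B
  let : Field (B ⧸ m) := Ideal.Quotient.field m
  have : Module.Finite k (B ⧸ m) := finite_of_finite_type_of_isJacobsonRing k (B ⧸ m)
  have hbij : Function.Bijective (algebraMap k (B ⧸ m)) :=
    IsAlgClosed.algebraMap_bijective_of_isIntegral
  let ι := AlgEquiv.ofBijective (Algebra.ofId k (B ⧸ m)) hbij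
  let ev : B →ₐ[k] k := ι.symm.toAlgHom.comp (Ideal.Quotient.mkₐ k m)
  have hev : ∀ x, x - algebraMap k B (ev x) ∈ m := by
    intro x
    rw [← Ideal.Quotient.eq]
    exact (ι.apply_symm_apply (Ideal.Quotient.mk m x)).symm
  -- If `m = m ^ 2`, then `m` is generated by an idempotent `e`. It lies outside the strictly
  -- smaller prime `𝔭`, so `1 - e` lies in `𝔭`, and `m` contains `1`.
  have hne : ¬ Subsingleton m.Cotangent := by
    rw [Ideal.cotangent_subsingleton_iff, Ideal.isIdempotentElem_iff_of_fg m (IsNoetherian.noetherian m)]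
    rintro ⟨e, he, hme⟩
    have h1 : e ∉ 𝔭.asIdeal := fun h1 => hpm.not_ge (by
      rw [hme]
      exact (Ideal.span_singleton_le_iff_mem _).mpr h1)
    have h2 : e * (1 - e) ∈ 𝔭.asIdeal := by
      rw [mul_sub, mul_one, he.eq, sub_self]
      exact zero_mem _
    have h3 : 1 - e ∈ m := hpm.le ((𝔭.2.mem_or_mem h2).resolve_left h1)
    have h4 : e ∈ m := hme ▸ Ideal.mem_span_singleton_self e
    exact hm.ne_top ((Ideal.eq_top_iff_one m).mpr (by simpa using add_mem h3 h4))
  rw [not_subsingleton_iff_nontrivial] at hne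
  obtain ⟨c, hc⟩ := exists_ne (0 : m.Cotangent)
  obtain ⟨ℓ, hℓ⟩ := not_forall.mp (mt (Module.forall_dual_apply_eq_zero_iff k c).mp hc)
  -- The tangent vector is `x ↦ x - x(m)` followed by a linear form on the cotangent space that does
  -- not vanish at `c`.
  let pr : B →ₗ[k] m :=
    { toFun := fun x => ⟨x - algebraMap k B (ev x), hev x⟩
      map_add' := fun x y => Subtype.ext (by
        change x + y - algebraMap k B (ev (x + y)) = (x - _) + (y - _)
        rw [map_add, map_add]; ring)
      map_smul' := fun c x => Subtype.ext (by
        change c • x - algebraMap k B (ev (c • x)) = c • (x - _)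
        rw [map_smul, smul_eq_mul, map_mul, smul_sub, Algebra.smul_def, Algebra.smul_def]) }
  let cot : m →ₗ[k] m.Cotangent := m.toCotangent.restrictScalars k
  refine ⟨ev, ℓ.comp (cot.comp pr), fun x y => ?_, ?_⟩
  · have h1 : m.toCotangent (pr x * pr y) = 0 := by
      rw [Ideal.toCotangent_eq_zero, pow_two]
      exact Ideal.mul_mem_mul (pr x).2 (pr y).2
    have h2 : pr (x * y) = pr x * pr y + (ev x • pr y + ev y • pr x) := Subtype.ext (by
      change x * y - algebraMap k B (ev (x * y)) =
        (x - algebraMap k B (ev x)) * (y - algebraMap k B (ev y)) +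
          (ev x • (y - algebraMap k B (ev y)) + ev y • (x - algebraMap k B (ev x)))
      rw [map_mul, map_mul, Algebra.smul_def, Algebra.smul_def]
      ring)
    change ℓ (cot (pr (x * y))) = ev x * ℓ (cot (pr y)) + ev y * ℓ (cot (pr x))
    have h3 : cot (pr x * pr y) = 0 := h1
    rw [h2, map_add, h3, zero_add, map_add, map_smul, map_smul, map_add, map_smul, map_smul,
      smul_eq_mul, smul_eq_mul]
  · obtain ⟨b, rfl⟩ := m.toCotangent_surjective c
    refine ⟨b, fun h0 => hℓ ?_⟩
    have hb : ev b = 0 := by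
      change ι.symm (Ideal.Quotient.mk m b) = 0
      rw [Ideal.Quotient.eq_zero_iff_mem.mpr b.2, map_zero]
    have hb' : pr b = b := Subtype.ext (by
      change (b : B) - algebraMap k B (ev b) = b
      rw [hb, map_zero, sub_zero])
    have h1 : ℓ (cot (pr b)) = 0 := h0
    rwa [hb'] at h1

variable {p : ℕ} [Fact p.Prime]

/-- The special fibre is an algebra over the residue field, because the reduction map of `R_p` is
surjective with kernel `(p)`; a tangent vector there is then pulled back to `A`. -/
theorem exists_residue_tangent {A : Type} [CommRing A] [Algebra (Rp p) A]
    [Algebra.FiniteType (Rp p) A] (h : 0 < ringKrullDim (A ⧸ Ideal.span {(p : A)})) :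
    ∃ (ev : A →+* ResidueField p) (d : A →+ ResidueField p),
      (∀ r, ev (algebraMap (Rp p) A r) = WittVector.constantCoeff r) ∧
      (∀ r, d (algebraMap (Rp p) A r) = 0) ∧
      (∀ x y, d (x * y) = ev x * d y + ev y * d x) ∧ ∃ a, d a ≠ 0 := by
  let B := A ⧸ Ideal.span {(p : A)}
  let k := ResidueField p
  let κ : Rp p →+* k := WittVector.constantCoeff
  have hκ : Function.Surjective κ := WittVector.constantCoeff_surjective p
  have hker : RingHom.ker κ ≤ RingHom.ker (algebraMap (Rp p) B) := by
    rw [WittVector.ker_constantCoeff, Ideal.span_singleton_le_iff_mem, RingHom.mem_ker,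
      map_natCast, ← map_natCast (Ideal.Quotient.mk (Ideal.span {(p : A)})),
      Ideal.Quotient.eq_zero_iff_mem]
    exact Ideal.mem_span_singleton_self _
  let : Algebra k B := (κ.liftOfSurjective hκ ⟨algebraMap (Rp p) B, hker⟩).toAlgebra
  let : Algebra (Rp p) k := κ.toAlgebra
  have hk : ∀ r, algebraMap k B (κ r) = algebraMap (Rp p) B r := fun r =>
    κ.liftOfRightInverse_comp_apply _ (Function.rightInverse_surjInv hκ) ⟨algebraMap (Rp p) B, hker⟩ r
  have : IsScalarTower (Rp p) k B := .of_algebraMap_eq fun r => (hk r).symm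
  have : Algebra.FiniteType (Rp p) B :=
    Algebra.FiniteType.of_surjective (Ideal.Quotient.mkₐ (Rp p) (Ideal.span {(p : A)}))
      (Ideal.Quotient.mkₐ_surjective _ _)
  have : Algebra.FiniteType k B := .of_restrictScalars_finiteType (Rp p) k B
  obtain ⟨ev, d, hd, b, hb⟩ := exists_tangent (k := k) (B := B) h
  obtain ⟨a, rfl⟩ := Ideal.Quotient.mk_surjective b
  have hr : ∀ r, Ideal.Quotient.mk (Ideal.span {(p : A)}) (algebraMap (Rp p) A r) =
      algebraMap k B (κ r) := fun r => (hk r).symm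
  refine ⟨ev.toRingHom.comp (Ideal.Quotient.mk _), d.toAddMonoidHom.comp
    (Ideal.Quotient.mk _).toAddMonoidHom, fun r => ?_, fun r => ?_, fun x y => ?_, a, hb⟩
  · change ev (Ideal.Quotient.mk _ _) = κ r
    rw [hr, AlgHom.commutes]
    rfl
  · change d (Ideal.Quotient.mk _ _) = 0
    rw [hr, Algebra.algebraMap_eq_smul_one, map_smul]
    have h1 := hd 1 1
    rw [mul_one, map_one ev, one_mul, left_eq_add] at h1
    rw [h1, smul_zero]
  · change d (Ideal.Quotient.mk _ (x * y)) = _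
    rw [map_mul]
    exact hd _ _

/-- The lift of a tangent vector to a perturbation of a point. -/
theorem exists_perturbation {R A C k : Type} [CommRing R] [CommRing A] [CommRing C] [CommRing k]
    [Algebra R A] [Algebra R C] [Algebra.FormallySmooth R A] (ϖ : C) (κ : C →+* k)
    (hκ : Function.Surjective κ) (hker : ∀ x, κ x = 0 → ϖ ∣ x) (hϖ : κ ϖ = 0) (P₀ : A →ₐ[R] C)
    (d : A →+ k) (hd : ∀ x y, d (x * y) = κ (P₀ x) * d y + κ (P₀ y) * d x)
    (hdR : ∀ r, d (algebraMap R A r) = 0) (N : ℕ) (hN : 1 ≤ N)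
    [IsAdicComplete (Ideal.span {ϖ ^ (N + 1)}) C] :
    ∃ P : A →ₐ[R] C, ∀ a, ∃ t, P a = P₀ a + ϖ ^ N * t ∧ κ t = d a := by
  let s : k → C := Function.surjInv hκ
  have hs : ∀ c, κ (s c) = c := Function.surjInv_eq hκ
  let q := Ideal.Quotient.mk (Ideal.span {ϖ ^ (N + 1)})
  -- `s` is only a set-theoretic section; multiplication by `ϖ ^ N` modulo `ϖ ^ (N + 1)` makes its
  -- failure to be additive or multiplicative invisible.
  have hq : ∀ x y, κ x = κ y → q (ϖ ^ N * x) = q (ϖ ^ N * y) := by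
    intro x y hxy
    obtain ⟨z, hz⟩ := hker (x - y) (by rw [map_sub, hxy, sub_self])
    refine Ideal.Quotient.eq.mpr (Ideal.mem_span_singleton.mpr ⟨z, ?_⟩)
    rw [← mul_sub, hz]; ring
  have hq0 : ∀ x y, q (ϖ ^ N * x) * q (ϖ ^ N * y) = 0 := by
    intro x y
    rw [← map_mul, Ideal.Quotient.eq_zero_iff_mem, Ideal.mem_span_singleton]
    refine ⟨ϖ ^ (N - 1) * x * y, ?_⟩
    obtain ⟨N, rfl⟩ := Nat.exists_eq_add_of_le hN
    rw [Nat.add_sub_cancel_left]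
    ring
  -- `P₀ + ϖ ^ N d` is multiplicative modulo `ϖ ^ (N + 1)` because `2 N ≥ N + 1`; formal smoothness
  -- lifts it.
  let f : A →ₐ[R] C ⧸ Ideal.span {ϖ ^ (N + 1)} :=
    { toFun := fun a => q (P₀ a) + q (ϖ ^ N * s (d a))
      map_one' := by
        have h1 := hd 1 1
        rw [mul_one, map_one P₀, map_one κ, one_mul, left_eq_add] at h1
        rw [h1, hq (s 0) 0 (by rw [hs, map_zero]), mul_zero, map_zero, map_one, map_one, add_zero]
      map_mul' := fun x y => by
        have h1 : q (ϖ ^ N * s (d (x * y))) = q (ϖ ^ N * (P₀ x * s (d y) + P₀ y * s (d x))) :=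
          hq _ _ (by rw [hs, hd, map_add, map_mul, map_mul, hs, hs])
        have h2 := hq0 (s (d x)) (s (d y))
        rw [h1, map_mul P₀]
        simp only [map_mul, map_add] at h2 ⊢
        linear_combination -h2
      map_zero' := by
        rw [map_zero, hq (s (d 0)) 0 (by rw [hs, map_zero, map_zero]), mul_zero, map_zero,
          add_zero]
      map_add' := fun x y => by
        have h1 : q (ϖ ^ N * s (d (x + y))) = q (ϖ ^ N * (s (d x) + s (d y))) :=
          hq _ _ (by rw [hs, map_add, map_add, hs, hs])
        rw [h1, map_add P₀, mul_add, map_add q, map_add q]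
        ring
      commutes' := fun r => by
        change q (P₀ (algebraMap R A r)) + q (ϖ ^ N * s (d (algebraMap R A r))) =
          q (algebraMap R C r)
        rw [hdR, hq (s 0) 0 (by rw [hs, map_zero]), mul_zero, map_zero, add_zero,
          AlgHom.commutes] }
  obtain ⟨P, hP⟩ := Algebra.FormallySmooth.exists_mkₐ_comp_eq_of_isAdicComplete f
  refine ⟨P, fun a => ?_⟩
  have h1 : q (P a) = q (P₀ a) + q (ϖ ^ N * s (d a)) := DFunLike.congr_fun hP a
  rw [← map_add, Ideal.Quotient.eq, Ideal.mem_span_singleton] at h1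
  obtain ⟨z, hz⟩ := h1
  refine ⟨s (d a) + ϖ * z, ?_, ?_⟩
  · linear_combination hz
  · rw [map_add, map_mul, hϖ, zero_mul, add_zero, hs]

/-- A residual point is an algebra map to `R_p / p`, which formal smoothness lifts to the complete
ring `R_p`. -/
theorem exists_lift_point {A : Type} [CommRing A] [Algebra (Rp p) A]
    [Algebra.FormallySmooth (Rp p) A] (ev : A →+* ResidueField p)
    (hev : ∀ r, ev (algebraMap (Rp p) A r) = WittVector.constantCoeff r) :
    ∃ P : A →ₐ[Rp p] Rp p, ∀ a, WittVector.constantCoeff (P a) = ev a := by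
  let κ : Rp p →+* ResidueField p := WittVector.constantCoeff
  have hκ : Function.Surjective κ := WittVector.constantCoeff_surjective p
  let e : Rp p ⧸ Ideal.span {(p : Rp p)} ≃+* ResidueField p :=
    (Ideal.quotEquivOfEq WittVector.ker_constantCoeff.symm).trans
      (RingHom.quotientKerEquivOfSurjective hκ)
  have he : ∀ r, e (Ideal.Quotient.mk _ r) = κ r := fun r => rfl
  let f : A →ₐ[Rp p] Rp p ⧸ Ideal.span {(p : Rp p)} :=
    { toRingHom := e.symm.toRingHom.comp ev
      commutes' := fun r => by
        change e.symm (ev (algebraMap (Rp p) A r)) = Ideal.Quotient.mk _ r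
        rw [hev, RingEquiv.symm_apply_eq]
        rfl }
  obtain ⟨P, hP⟩ := Algebra.FormallySmooth.exists_mkₐ_comp_eq_of_isAdicComplete f
  refine ⟨P, fun a => ?_⟩
  have h1 : Ideal.Quotient.mk _ (P a) = e.symm (ev a) := DFunLike.congr_fun hP a
  rw [RingEquiv.eq_symm_apply] at h1
  exact h1

end Tangent

end ArithJet
end
noncomputable section
set_option linter.unusedSectionVars false
namespace ArithJet

open Prolongation

/-! ### Points of jet spaces -/

section Points

variable {p : ℕ} [Fact p.Prime] {R : Type} [CommRing R] (D : FrobeniusBase p R)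

/-- The base ring as a constant prolongation sequence. -/
def constProlongation : Prolongation D :=
  Prolongation.ofFrobenius (fun _ => R) (fun _ => AlgHom.id R R) (fun _ => D.frob)
    (fun _ => D.unif_mem) (fun _ _ => rfl) (fun _ _ => rfl) (fun _ => D.δ)
    (fun _ x => D.unif_mul_δ x)

theorem constProlongation_elt (n i : ℕ) (hi : i ≤ n) (x : (constProlongation D).obj 0) :
    (constProlongation D).elt n i x = D.δ^[i] x := by
  induction n generalizing i with
  | zero =>
    obtain rfl : i = 0 := by omega
    rfl
  | succ n ih =>
    rcases Nat.lt_or_ge i (n + 1) with h | h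
    · exact (incl_elt _ (Nat.lt_succ_iff.mp h) x).symm.trans (ih i (Nat.lt_succ_iff.mp h))
    · obtain rfl : i = n + 1 := le_antisymm hi h
      refine (δ_elt _ le_rfl x).symm.trans ?_
      refine Eq.trans (congrArg D.δ (ih n le_rfl)) ?_
      exact (Function.iterate_succ_apply' D.δ n (show R from x)).symm

theorem completion_exists_eq_add (S : Prolongation D) {n : ℕ} (x : S.completion.obj n) :
    ∃ a y, x = (toCompletion S).hom n a + (p : S.completion.obj n) * y := by
  obtain ⟨a, y, hx⟩ := compl_exists_eq_add R (A := S.obj n) x 1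
  rw [pow_one] at hx
  exact ⟨a, y, hx⟩

variable {A : Type} [CommRing A] [Algebra R A] [h : IsAdicComplete (Ideal.span {(p : R)}) R]

/-- The point of the jet spaces defined by a point, as a map to the base ring. -/
def pointHom (P : A →ₐ[R] R) : Hom (jet D A).completion (constProlongation D) :=
  completionLift (fun _ => h) (jetLift (constProlongation D) P)

/-- The value at a point of the jet spaces. -/
def pointEval (P : A →ₐ[R] R) (n : ℕ) : (jet D A).completion.obj n →ₐ[R] R :=
  (pointHom D P).hom n

theorem pointEval_incl (P : A →ₐ[R] R) (n : ℕ) (x : (jet D A).completion.obj n) :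
    pointEval D P (n + 1) ((jet D A).completion.incl n x) = pointEval D P n x :=
  (pointHom D P).hom_incl n x

theorem pointEval_elt (P : A →ₐ[R] R) (n i : ℕ) (hi : i ≤ n) (a : A) :
    pointEval D P n ((toCompletion (jet D A)).hom n ((jet D A).elt n i (toJet D A a))) =
      D.δ^[i] (P a) := by
  refine (completionLift_complOf _ _ n _).trans ?_
  rw [Hom.hom_elt]
  exact (congrArg _ (jetLift_toJet (constProlongation D) P a)).trans
    (constProlongation_elt D n i hi _)

/-- Points of the jet spaces coincide modulo an ideal containing `p` if they do so on generators. -/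
theorem pointEval_congr (P Q : A →ₐ[R] R) {k : Type} [CommRing k] (κ : R →+* k)
    (hκ : κ (p : R) = 0) (n : ℕ)
    (hPQ : ∀ i ≤ n, ∀ a, κ (D.δ^[i] (P a)) = κ (D.δ^[i] (Q a)))
    (x : (jet D A).completion.obj n) : κ (pointEval D P n x) = κ (pointEval D Q n x) := by
  let : Algebra R k := κ.toAlgebra
  let F : (A →ₐ[R] R) → ((jet D A).completion.obj n →ₐ[R] k) := fun P =>
    (Algebra.ofId R k).comp (pointEval D P n)
  have h1 : (F P).comp ((toCompletion (jet D A)).hom n) =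
      (F Q).comp ((toCompletion (jet D A)).hom n) := by
    refine jet_algHom_ext fun i hi a => ?_
    change κ (pointEval D P n ((toCompletion (jet D A)).hom n _)) =
      κ (pointEval D Q n ((toCompletion (jet D A)).hom n _))
    rw [pointEval_elt D P n i hi, pointEval_elt D Q n i hi, hPQ i hi]
  obtain ⟨a, y, hx⟩ := completion_exists_eq_add D (jet D A) x
  have hp : (p : k) = 0 := by rw [← map_natCast κ, hκ]
  have h2 : ∀ P, F P x = F P ((toCompletion (jet D A)).hom n a) := fun P => by
    rw [hx, map_add, map_mul, map_natCast, hp, zero_mul, add_zero]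
  change F P x = F Q x
  rw [h2, h2]
  exact DFunLike.congr_fun h1 a

end Points

/-! ### The image of the jets modulo the uniformizer -/

section Image

variable {p : ℕ} [Fact p.Prime] {R : Type} [CommRing R] {D : FrobeniusBase p R}

/-- The elements of order `n + 1` that have order `n` modulo `unif`. -/
def lowOrder (N : Prolongation D) (n : ℕ) : Subalgebra R (N.obj (n + 1)) where
  carrier := {x | ∃ u v, x = N.incl n u + algebraMap R _ D.unif * v}
  mul_mem' := by
    rintro _ _ ⟨u, v, rfl⟩ ⟨u', v', rfl⟩
    refine ⟨u * u', N.incl n u * v' + N.incl n u' * v + algebraMap R _ D.unif * v * v', ?_⟩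
    rw [map_mul]; ring
  add_mem' := by
    rintro _ _ ⟨u, v, rfl⟩ ⟨u', v', rfl⟩
    refine ⟨u + u', v + v', ?_⟩
    rw [map_add]; ring
  algebraMap_mem' r := ⟨algebraMap R _ r, 0, by rw [AlgHom.commutes, mul_zero, add_zero]⟩

theorem unif_mul_mem_lowOrder (N : Prolongation D) (n : ℕ) (v : N.obj (n + 1)) :
    algebraMap R _ D.unif * v ∈ lowOrder N n :=
  ⟨0, v, by rw [map_zero, zero_add]⟩

theorem incl_mem_lowOrder (N : Prolongation D) (n : ℕ) (u : N.obj n) : N.incl n u ∈ lowOrder N n :=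
  ⟨u, 0, by rw [mul_zero, add_zero]⟩

/-- Since `unif` divides `p / unif`, the correction to additivity vanishes modulo `unif`. In `δ
(unif * v)` the only term not divisible by `unif` is the `p`-th power of `incl v` times a constant.
-/
theorem δ_mem_lowOrder (hD : D.unif ∣ D.ratio) (N : Prolongation D) {n : ℕ} {x : N.obj (n + 1)}
    (hx : x ∈ lowOrder N n) : N.δ (n + 1) x ∈ lowOrder N (n + 1) := by
  obtain ⟨u, v, rfl⟩ := hx
  obtain ⟨c, hc⟩ := hD
  rw [N.δ_add, N.δ_incl, hc, map_mul, mul_assoc]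
  refine add_mem (add_mem (incl_mem_lowOrder _ _ _) ?_) (unif_mul_mem_lowOrder _ _ _)
  rw [N.δ_mul, N.δ_algebraMap, AlgHom.commutes, mul_assoc (algebraMap R _ D.unif)]
  refine add_mem (add_mem ?_ ?_) (unif_mul_mem_lowOrder _ _ _)
  · rw [← mul_pow_sub_one (Fact.out : p.Prime).ne_zero, mul_assoc]
    exact unif_mul_mem_lowOrder _ _ _
  · exact mul_mem (pow_mem (incl_mem_lowOrder _ _ _) _) (Subalgebra.algebraMap_mem _ _)

/-- It suffices to treat the generators `δ ^ i a`. For `i ≤ n` they come from order `n`, and the top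
one is handled by induction with `δ_mem_lowOrder`. The completion only adds multiples of `p`, hence
of `unif`. -/
theorem hom_mem_lowOrder (hD : D.unif ∣ D.ratio) {A : Type} [CommRing A] [Algebra R A]
    {N : Prolongation D} (T : Hom (jet D A).completion N)
    (hT : ∀ a, N.δ 0 (T.hom 0 ((toCompletion (jet D A)).hom 0 (toJet D A a))) ∈ lowOrder N 0)
    (n : ℕ) (x : (jet D A).completion.obj (n + 1)) : T.hom (n + 1) x ∈ lowOrder N n := by
  let T' := T.comp (toCompletion (jet D A))
  have h1 : ∀ n, ∀ i ≤ n + 1, ∀ a, N.elt (n + 1) i (T'.hom 0 (toJet D A a)) ∈ lowOrder N n := by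
    intro n
    induction n with
    | zero =>
      intro i hi a
      rcases Nat.eq_zero_or_pos i with rfl | h
      · rw [← incl_elt _ le_rfl]
        exact incl_mem_lowOrder _ _ _
      · obtain rfl : i = 1 := by omega
        exact hT a
    | succ n ih =>
      intro i hi a
      rcases Nat.lt_or_ge i (n + 2) with h | h
      · rw [← incl_elt _ (Nat.lt_succ_iff.mp h)]
        exact incl_mem_lowOrder _ _ _
      · obtain rfl : i = n + 1 + 1 := le_antisymm hi h
        rw [← δ_elt _ le_rfl]
        exact δ_mem_lowOrder hD N (ih _ le_rfl a)
  have h2 : ∀ y, T'.hom (n + 1) y ∈ lowOrder N n := by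
    intro y
    have hy : y ∈ Algebra.adjoin R {x : (jet D A).obj (n + 1) |
        ∃ i ≤ n + 1, ∃ a, x = (jet D A).elt (n + 1) i (toJet D A a)} := by
      rw [jet_adjoin_elt]
      exact Algebra.mem_top
    have h3 : Algebra.adjoin R {x : (jet D A).obj (n + 1) |
        ∃ i ≤ n + 1, ∃ a, x = (jet D A).elt (n + 1) i (toJet D A a)} ≤
        (lowOrder N n).comap (T'.hom (n + 1)) := by
      refine Algebra.adjoin_le ?_
      rintro _ ⟨i, hi, a, rfl⟩
      change T'.hom (n + 1) _ ∈ lowOrder N n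
      rw [Hom.hom_elt]
      exact h1 n i hi a
    exact h3 hy
  obtain ⟨a, y, rfl⟩ := completion_exists_eq_add D (jet D A) x
  rw [map_add, map_mul, map_natCast, ← unif_dvd_p (D := D) (N.obj (n + 1)),
    mul_comm (algebraMap R (N.obj (n + 1)) D.ratio), mul_assoc]
  exact add_mem (h2 a) (unif_mul_mem_lowOrder _ _ _)

end Image
end ArithJet
end
noncomputable section
set_option linter.unusedSectionVars false
namespace ArithJet

open Prolongation

/-! ### Failure of surjectivity, and of injectivity modulo `p` -/

section Negative

variable {p : ℕ} [Fact p.Prime] {R R' : Type} [CommRing R] [CommRing R'] [Algebra R R']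
  {D : FrobeniusBase p R} {D' : FrobeniusBase p R'}
  (hφ : ∀ r, D'.frob (algebraMap R R' r) = algebraMap R R' (D.frob r))
  (hu : D'.unif ∣ algebraMap R R' D.unif)
  {A : Type} [CommRing A] [Algebra R A] {A' : Type} [CommRing A'] [Algebra R' A']
  (e : R' ⊗[R] A ≃ₐ[R'] A') (hS : ∀ n, Module.Flat R ((jet D A).completion.obj n))
  (T : Hom (jet D' A').completion (baseChange D' hφ hu (jet D A).completion hS))
  (hT : ∀ a : A, T.hom 0 ((toCompletion (jet D' A')).hom 0 (toJet D' A' (e (1 ⊗ₜ a)))) =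
      baseChangeOf hφ hu hS 0 ((toCompletion (jet D A)).hom 0 (toJet D A a)))

include hT in
theorem canonical_hom_elt_one (hD : D.unif = p) {n : ℕ} (hn : 1 ≤ n) (a : A) :
    T.hom n ((toCompletion (jet D' A')).hom n
      ((jet D' A').elt n 1 (toJet D' A' (e (1 ⊗ₜ a))))) =
      algebraMap R' _ D'.ratio * baseChangeOf hφ hu hS n
        ((jet D A).completion.elt n 1 ((toCompletion (jet D A)).hom 0 (toJet D A a))) := by
  rw [Hom.hom_elt, Hom.hom_elt, hT, elt_baseChangeOf hφ hu hS hD n 0 hn, jetPoly, map_mul,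
    ← MvPolynomial.algebraMap_eq, AlgHom.commutes, evalElt, MvPolynomial.aeval_X]

include hT in
-- The witness is `unif * δ' a`. Its image is `p` times an element, whereas at the point `P` its
-- value is `φ (P a) - (P a) ^ p`, not divisible by `p`.
theorem not_injective_modP (hD : D.unif = p) [IsAdicComplete (Ideal.span {(p : R')}) R']
    (a : A) (P : A' →ₐ[R'] R')
    (hP : ¬ (p : R') ∣ D'.frob (P (e (1 ⊗ₜ a))) - P (e (1 ⊗ₜ a)) ^ p) {n : ℕ} (hn : 1 ≤ n) :
    ¬ Function.Injective (modP p (T.hom n).toRingHom) := by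
  intro hinj
  set z := algebraMap R' ((jet D' A').completion.obj n) D'.unif *
    (toCompletion (jet D' A')).hom n ((jet D' A').elt n 1 (toJet D' A' (e (1 ⊗ₜ a)))) with hz
  have h1 : modP p (T.hom n).toRingHom (Ideal.Quotient.mk _ z) = 0 := by
    change Ideal.Quotient.mk _ (T.hom n z) = 0
    rw [Ideal.Quotient.eq_zero_iff_mem, Ideal.mem_span_singleton, hz, map_mul, AlgHom.commutes,
      canonical_hom_elt_one hφ hu e hS T hT hD hn, ← mul_assoc, ← map_mul, mul_comm D'.unif,
      D'.ratio_mul_unif, map_natCast]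
    exact dvd_mul_right _ _
  have h2 := hinj (h1.trans (map_zero _).symm)
  rw [Ideal.Quotient.eq_zero_iff_mem, Ideal.mem_span_singleton] at h2
  have h3 := map_dvd (pointEval D' P n) h2
  rw [map_natCast, hz, map_mul, AlgHom.commutes, pointEval_elt D' P n 1 hn,
    Function.iterate_one] at h3
  change (p : R') ∣ D'.unif * _ at h3
  rw [D'.unif_mul_δ] at h3
  exact hP h3

theorem δ_baseChangeOf {S : Prolongation D} (hS : ∀ n, Module.Flat R (S.obj n)) (hD : D.unif = p)
    (n : ℕ) (x : S.obj n) :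
    (baseChange D' hφ hu S hS).δ n (baseChangeOf hφ hu hS n x) =
      algebraMap R' _ D'.ratio * baseChangeOf hφ hu hS (n + 1) (S.δ n x) := by
  refine baseChange_unif_cancel hφ hu hS ?_
  rw [Prolongation.unif_mul_δ, baseChange_frob_of, baseChange_incl_of, ← map_pow, ← map_sub,
    ← Prolongation.unif_mul_δ, hD, map_mul, map_natCast, map_natCast, ← mul_assoc, ← map_mul,
    mul_comm D'.unif, D'.ratio_mul_unif, map_natCast]

/-- `δ` is not linear, so the passage from `1 ⊗ a` to arbitrary tensors uses the sum and product
formulas modulo `unif`. -/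
theorem δ_algHom_tensor_mem_lowOrder (hD' : D'.unif ∣ D'.ratio) {N : Prolongation D'}
    (G : R' ⊗[R] A →ₐ[R'] N.obj 0) (hG : ∀ a : A, N.δ 0 (G (1 ⊗ₜ a)) ∈ lowOrder N 0)
    (z : R' ⊗[R] A) : N.δ 0 (G z) ∈ lowOrder N 0 := by
  obtain ⟨c, hc⟩ := hD'
  induction z with
  | zero => rw [map_zero, Prolongation.δ_zero]; exact zero_mem _
  | add z w hz hw =>
    rw [map_add, Prolongation.δ_add, hc, map_mul, mul_assoc]
    exact add_mem (add_mem hz hw) (unif_mul_mem_lowOrder _ _ _)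
  | tmul r a =>
    have hr : r ⊗ₜ[R] a = algebraMap R' (R' ⊗[R] A) r * ((1 : R') ⊗ₜ[R] a) := by
      rw [← Algebra.smul_def, TensorProduct.smul_tmul', smul_eq_mul, mul_one]
    rw [hr, map_mul, AlgHom.commutes, Prolongation.δ_mul, Prolongation.δ_algebraMap,
      AlgHom.commutes, mul_assoc (algebraMap R' _ D'.unif)]
    exact add_mem (add_mem (mul_mem (pow_mem (Subalgebra.algebraMap_mem _ _) _) (hG a))
      (mul_mem (pow_mem (incl_mem_lowOrder _ _ _) _) (Subalgebra.algebraMap_mem _ _)))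
      (unif_mul_mem_lowOrder _ _ _)

include hT in
theorem canonical_δ_mem_lowOrder (hD : D.unif = p) (hD' : D'.unif ∣ D'.ratio) (a : A') :
    (baseChange D' hφ hu (jet D A).completion hS).δ 0
      (T.hom 0 ((toCompletion (jet D' A')).hom 0 (toJet D' A' a))) ∈
        lowOrder (baseChange D' hφ hu (jet D A).completion hS) 0 := by
  obtain ⟨z, rfl⟩ := e.surjective a
  refine δ_algHom_tensor_mem_lowOrder hD'
    ((((T.hom 0).comp ((toCompletion (jet D' A')).hom 0)).comp (toJetₐ D' A')).comp e.toAlgHom)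
    (fun a => ?_) z
  change (baseChange D' hφ hu (jet D A).completion hS).δ 0
    (T.hom 0 ((toCompletion (jet D' A')).hom 0 (toJet D' A' (e (1 ⊗ₜ a))))) ∈ _
  obtain ⟨c, hc⟩ := hD'
  rw [hT, δ_baseChangeOf hφ hu hS hD, hc, map_mul, mul_assoc]
  exact unif_mul_mem_lowOrder _ _ _

include hT in
-- An element that modulo `unif` has order `n` takes the same residual value at two points with the
-- same residual jets up to order `n`. If `T` were surjective, `δ ^ (n + 1) a` would be such an
-- element, but it separates `P` and `Q`.
theorem not_surjective (hD' : D'.unif ∣ D'.ratio) [IsAdicComplete (Ideal.span {(p : R)}) R]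
    (hD : D.unif = p) {k : Type} [CommRing k] (κ : R' →+* k) (hκ : κ D'.unif = 0)
    (P Q : A →ₐ[R] R) {n : ℕ}
    (hPQ : ∀ i ≤ n, ∀ a, κ (algebraMap R R' (D.δ^[i] (P a))) =
      κ (algebraMap R R' (D.δ^[i] (Q a))))
    (a : A) (ha : κ (algebraMap R R' (D.δ^[n + 1] (P a))) ≠
      κ (algebraMap R R' (D.δ^[n + 1] (Q a)))) :
    ¬ Function.Surjective (T.hom (n + 1)) := by
  intro hsurj
  have hlow : ∀ y, y ∈ lowOrder (baseChange D' hφ hu (jet D A).completion hS) n := by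
    intro y
    obtain ⟨x, rfl⟩ := hsurj y
    refine hom_mem_lowOrder hD' T (fun a => ?_) n x
    exact canonical_δ_mem_lowOrder hφ hu e hS T hT hD hD' a
  let F : ∀ (P : A →ₐ[R] R) (m : ℕ), (R' ⊗[R] (jet D A).completion.obj m) →ₐ[R'] R' := fun P m =>
    Algebra.TensorProduct.lift (Algebra.ofId R' R') ((Algebra.ofId R R').comp (pointEval D P m))
      fun _ _ => Commute.all _ _
  have hF : ∀ P m r x, F P m (r ⊗ₜ x) = r * algebraMap R R' (pointEval D P m x) := fun P m r x =>
    Algebra.TensorProduct.lift_tmul ..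
  have hincl : ∀ P m x, F P (m + 1) (Algebra.TensorProduct.map (AlgHom.id R' R')
      ((jet D A).completion.incl m) x) = F P m x := by
    intro P m x
    induction x with
    | zero => simp only [map_zero]
    | add x y hx hy => rw [map_add, map_add, map_add, hx, hy]
    | tmul r x =>
      rw [Algebra.TensorProduct.map_tmul, hF, hF, pointEval_incl]
      rfl
  have hκp : κ (algebraMap R R' (p : R)) = 0 := by
    rw [map_natCast, ← D'.ratio_mul_unif, map_mul, hκ, mul_zero]
  have hcongr : ∀ x, κ (F P n x) = κ (F Q n x) := by
    intro x
    induction x with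
    | zero => simp only [map_zero]
    | add x y hx hy => rw [map_add, map_add, map_add, map_add, hx, hy]
    | tmul r x =>
      rw [hF, hF, map_mul, map_mul]
      exact congrArg _ (pointEval_congr D P Q (κ.comp (algebraMap R R')) hκp n hPQ x)
  obtain ⟨u, v, huv⟩ := hlow (baseChangeOf hφ hu hS (n + 1)
    ((toCompletion (jet D A)).hom (n + 1) ((jet D A).elt (n + 1) (n + 1) (toJet D A a))))
  have hval : ∀ P, κ (algebraMap R R' (D.δ^[n + 1] (P a))) = κ (F P n u) := by
    intro P
    have h1 := congrArg (fun y => κ (F P (n + 1) y)) huv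
    have h2 : F P (n + 1) (baseChangeOf hφ hu hS (n + 1) ((toCompletion (jet D A)).hom (n + 1)
        ((jet D A).elt (n + 1) (n + 1) (toJet D A a)))) =
        algebraMap R R' (D.δ^[n + 1] (P a)) := by
      rw [← pointEval_elt D P (n + 1) (n + 1) le_rfl a]
      exact (hF P (n + 1) 1 _).trans (one_mul _)
    let F' : (baseChange D' hφ hu (jet D A).completion hS).obj (n + 1) →ₐ[R'] R' := F P (n + 1)
    have h3 : F' ((baseChange D' hφ hu (jet D A).completion hS).incl n u +
        algebraMap R' _ D'.unif * v) = F P n u + D'.unif * F' v := by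
      rw [map_add, map_mul, AlgHom.commutes]
      exact congrArg (· + _) (hincl P n u)
    refine (congrArg κ h2).symm.trans (h1.trans ?_)
    refine (congrArg κ h3).trans ?_
    rw [map_add, map_mul, hκ, zero_mul, add_zero]
  exact ha ((hval P).trans ((hcongr u).trans (hval Q).symm))

end Negative

end ArithJet
end
noncomputable section
set_option linter.unusedSectionVars false
namespace ArithJet

open Prolongation

/-! ### Fermat quotients of perturbed points -/

section NegativeSmooth

variable {p : ℕ} [Fact p.Prime]

theorem add_pow_prime {B : Type} [CommRing B] (y z : B) :
    ∃ c, (y + z) ^ p = y ^ p + z ^ p + p * (z * c) := by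
  obtain ⟨c, hc⟩ := Ideal.mem_span_singleton.mp
    (carry_mem (p := p) (Ideal.span {z}) y (Ideal.mem_span_singleton_self z))
  refine ⟨-c, ?_⟩
  have h := mul_carry (p := p) y z
  rw [hc] at h
  linear_combination h

theorem constantCoeff_frobenius (t : Rp p) :
    WittVector.constantCoeff (WittVector.frobenius t) = WittVector.constantCoeff t ^ p := by
  change (WittVector.frobenius t).coeff 0 = t.coeff 0 ^ p
  rw [WittVector.coeff_frobenius_charP]

/-- Adding `p ^ (m + 1) t` changes the numerator `φ y - y ^ p` by `p ^ (m + 1) φ t` up to multiples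
of `p ^ (m + 2)`: the cross terms carry an extra `p`, and `(m + 1) p ≥ m + 2`. Division by `p`
leaves `p ^ m φ t` as leading term. -/
theorem exists_δ_add (m : ℕ) (y t : Rp p) :
    ∃ t', (baseP p).δ (y + (p : Rp p) ^ (m + 1) * t) = (baseP p).δ y + p ^ m * t' ∧
      WittVector.constantCoeff t' = WittVector.constantCoeff t ^ p := by
  obtain ⟨c, hc⟩ := add_pow_prime (p := p) y ((p : Rp p) ^ (m + 1) * t)
  have hp2 : m + 2 ≤ (m + 1) * p := by
    have := (Fact.out : p.Prime).two_le
    nlinarith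
  obtain ⟨q, hq⟩ := Nat.exists_eq_add_of_le hp2
  refine ⟨WittVector.frobenius t - p * (p ^ q * t ^ p) - p * (t * c), ?_, ?_⟩
  · have hp0 : (p : Rp p) ≠ 0 := WittVector.p_nonzero p _
    refine mul_left_cancel₀ hp0 ?_
    have h1 : (p : Rp p) * (baseP p).δ (y + (p : Rp p) ^ (m + 1) * t) =
      WittVector.frobenius (y + (p : Rp p) ^ (m + 1) * t) - (y + (p : Rp p) ^ (m + 1) * t) ^ p :=
      (baseP p).unif_mul_δ _
    have h2 : (p : Rp p) * (baseP p).δ y = WittVector.frobenius y - y ^ p :=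
      (baseP p).unif_mul_δ _
    rw [h1, hc, map_add, map_mul, map_pow, map_natCast, mul_pow, ← pow_mul, hq, pow_add]
    linear_combination -h2
  · have hp0 : (p : ResidueField p) = 0 := CharP.cast_eq_zero _ _
    rw [map_sub, map_sub, map_mul _ (p : Rp p), map_mul _ (p : Rp p), map_natCast, hp0, zero_mul,
      zero_mul, sub_zero, sub_zero, constantCoeff_frobenius]

/-- Each application of `δ` lowers the exponent of `p` in the perturbation by one and raises its
leading coefficient to the `p`-th power. -/
theorem exists_iterate_δ_add (n i : ℕ) (hi : i ≤ n) (y t : Rp p) :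
    ∃ t', (baseP p).δ^[i] (y + p ^ n * t) = (baseP p).δ^[i] y + p ^ (n - i) * t' ∧
      WittVector.constantCoeff t' = WittVector.constantCoeff t ^ p ^ i := by
  induction i with
  | zero => exact ⟨t, rfl, by rw [pow_zero, pow_one]⟩
  | succ i ih =>
    obtain ⟨t', h1, h2⟩ := ih (by omega)
    have h3 : n - i = n - (i + 1) + 1 := by omega
    rw [Function.iterate_succ_apply', Function.iterate_succ_apply', h1, h3]
    obtain ⟨t'', h4, h5⟩ := exists_δ_add (n - (i + 1)) ((baseP p).δ^[i] y) t'
    refine ⟨t'', h4, ?_⟩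
    rw [h5, h2, ← pow_mul, pow_succ]

variable {E : ℤ_[p][X]} (hE : IsRamifiedEisenstein p E)

theorem pi_dvd_baseP_unif (hE : IsRamifiedEisenstein p E) :
    (basePi p hE).unif ∣ algebraMap (Rp p) (Rpi p E) (baseP p).unif := by
  change piElt p E ∣ AdjoinRoot.of _ (p : Rp p)
  rw [map_natCast]
  exact pi_dvd_p p hE

theorem pi_dvd_ratio (hE : IsRamifiedEisenstein p E) :
    (basePi p hE).unif ∣ (basePi p hE).ratio := by
  obtain ⟨c, hc⟩ := pi_sq_dvd_p hE
  refine ⟨c, (mul_cancel_left_mem_nonZeroDivisors (basePi p hE).unif_mem).mp ?_⟩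
  rw [mul_comm, (basePi p hE).ratio_mul_unif, hc]
  change _ = piElt p E * (piElt p E * c)
  ring

theorem reducePi_surjective : Function.Surjective (reducePi hE) := fun c => by
  obtain ⟨r, hr⟩ := WittVector.constantCoeff_surjective p c
  exact ⟨algebraMap (Rp p) (Rpi p E) r, by rw [reducePi_algebraMap, hr]⟩

theorem frobPi_pi : frobPi p E (piElt p E) = piElt p E := AdjoinRoot.lift_root _

/-- Modulo `π ^ 2` the expression is `π φ t`: the part from `x` and the cross terms are divisible by
`p`, hence by `π ^ 2`, and so is `(π t) ^ p` by `π ^ 2`. Divisibility by `p` would give `π ∣ φ t`,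
while `φ t ≡ t ^ p` is non-zero in the residue field. -/
theorem not_p_dvd_frobPi_sub_pow (x : Rp p) (t : Rpi p E) (ht : reducePi hE t ≠ 0) :
    ¬ (p : Rpi p E) ∣ frobPi p E (algebraMap (Rp p) (Rpi p E) x + piElt p E * t) -
      (algebraMap (Rp p) (Rpi p E) x + piElt p E * t) ^ p := by
  intro h
  obtain ⟨c, hc⟩ := add_pow_prime (p := p) (algebraMap (Rp p) (Rpi p E) x) (piElt p E * t)
  obtain ⟨q, hq⟩ := Nat.exists_eq_add_of_le (Fact.out : p.Prime).two_le
  obtain ⟨d, hd⟩ := pi_sq_dvd_p hE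
  obtain ⟨y, hy⟩ := h
  obtain ⟨w, hw⟩ := p_dvd_frobenius p x
  have hw' := congrArg (algebraMap (Rp p) (Rpi p E)) hw
  rw [map_sub, map_mul, map_natCast, map_pow, ← frobPi_algebraMap] at hw'
  have hpow : (piElt p E * t) ^ p = piElt p E ^ 2 * (piElt p E ^ q * t ^ p) := by
    rw [mul_pow, ← mul_assoc, ← pow_add, ← hq]
  rw [map_add, map_mul, frobPi_pi, hc, hpow] at hy
  have h1 : frobPi p E t = piElt p E * (d * y + piElt p E ^ q * t ^ p + d * (piElt p E * t * c)
      - d * algebraMap (Rp p) (Rpi p E) w) := by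
    refine (mul_cancel_left_mem_nonZeroDivisors (pi_mem_nonZeroDivisors p hE)).mp ?_
    linear_combination hy - hw' + (y + piElt p E * t * c - algebraMap (Rp p) (Rpi p E) w) * hd
  obtain ⟨z, hz⟩ := pi_dvd_frobPi p hE t
  have h2 := congrArg (reducePi hE) hz
  rw [h1, map_sub, map_mul, map_mul, reducePi_pi, zero_mul, zero_mul, map_pow, zero_sub,
    neg_eq_zero] at h2
  exact ht (pow_eq_zero_iff (Fact.out : p.Prime).ne_zero |>.mp h2)

theorem canonical_not_surjective_and_not_injective_modP {A : Type} [CommRing A] [Algebra (Rp p) A]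
    [Algebra.Smooth (Rp p) A] (hdim : 0 < ringKrullDim (A ⧸ Ideal.span {(p : A)})) {A' : Type}
    [CommRing A'] [Algebra (Rpi p E) A'] (e : Rpi p E ⊗[Rp p] A ≃ₐ[Rpi p E] A')
    (hS : ∀ n, Module.Flat (Rp p) ((jet (baseP p) A).completion.obj n))
    (T : Hom (jet (basePi p hE) A').completion (tensorPi p hE (jet (baseP p) A).completion hS))
    (hT : ∀ a : A, T.hom 0 ((toCompletion (jet (basePi p hE) A')).hom 0
        (toJet (basePi p hE) A' (e (1 ⊗ₜ a)))) =
      tmulOne hE _ hS 0 ((toCompletion (jet (baseP p) A)).hom 0 (toJet (baseP p) A a)))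
    {n : ℕ} (hn : 1 ≤ n) :
    ¬ Function.Surjective (T.hom n) ∧ ¬ Function.Injective (modP p (T.hom n).toRingHom) := by
  obtain ⟨ev, d, hev, hdR, hd, a, ha⟩ := exists_residue_tangent hdim
  obtain ⟨Q, hQ⟩ := exists_lift_point ev hev
  have hcp : WittVector.constantCoeff (p : Rp p) = 0 := by
    rw [map_natCast]
    exact CharP.cast_eq_zero _ _
  have hker : ∀ x : Rp p, WittVector.constantCoeff x = 0 → (p : Rp p) ∣ x := fun x hx => by
    rwa [← RingHom.mem_ker, WittVector.ker_constantCoeff, Ideal.mem_span_singleton] at hx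
  constructor
  · obtain ⟨n, rfl⟩ := Nat.exists_eq_add_of_le' hn
    have : IsAdicComplete (Ideal.span {(p : Rp p) ^ (n + 1 + 1)}) (Rp p) :=
      isAdicComplete_of_dvd_pow (r := (p : Rp p)) dvd_rfl (b := 1)
        (by rw [pow_one]; exact dvd_pow_self _ (by omega))
    -- The exponent `n + 1` keeps `δ ^ i` unchanged modulo `p` for `i ≤ n`, while `δ ^ (n + 1) (P
    -- a)` and `δ ^ (n + 1) (Q a)` differ by a power of `d a ≠ 0` in the residue field.
    obtain ⟨P, hP⟩ := exists_perturbation (p : Rp p) WittVector.constantCoeff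
      (WittVector.constantCoeff_surjective p) hker hcp Q d
      (fun x y => by rw [hQ, hQ, hd]) hdR (n + 1) (by omega)
    refine not_surjective (frobPi_algebraMap p E) (pi_dvd_baseP_unif hE) e hS T hT
      (pi_dvd_ratio hE) rfl (reducePi hE) (reducePi_pi hE) P Q (n := n) (fun i hi b => ?_) a ?_
    · obtain ⟨t, h1, -⟩ := hP b
      obtain ⟨t', h3, -⟩ := exists_iterate_δ_add (n + 1) i (by omega) (Q b) t
      rw [reducePi_algebraMap, reducePi_algebraMap, h1, h3, map_add, map_mul, map_pow, hcp,
        zero_pow (by omega), zero_mul, add_zero]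
    · obtain ⟨t, h1, h2⟩ := hP a
      obtain ⟨t', h3, h4⟩ := exists_iterate_δ_add (n + 1) (n + 1) le_rfl (Q a) t
      rw [reducePi_algebraMap, reducePi_algebraMap, h1, h3, map_add, Nat.sub_self, pow_zero,
        one_mul, h4, h2]
      intro h5
      exact ha (eq_zero_of_pow_eq_zero (left_eq_add.mp h5.symm))
  · have hc := isAdicComplete_Rpi hE
    obtain ⟨b, hb⟩ := exists_p_dvd_pi_pow hE
    have : IsAdicComplete (Ideal.span {piElt p E ^ (1 + 1)}) (Rpi p E) :=
      isAdicComplete_of_dvd_pow (r := (p : Rpi p E)) (a := 1) (by rw [pow_one]; exact pi_sq_dvd_p hE)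
        (b := b) (by rw [← pow_mul]; exact hb.trans (pow_dvd_pow _ (by omega)))
    -- Here the perturbation is of first order in `π`, so the point is defined over `R_π` only; `π ^
    -- 2 ∣ p` makes it visible modulo `p`.
    obtain ⟨P, hP⟩ := exists_perturbation (R := Rp p) (piElt p E) (reducePi hE)
      (reducePi_surjective hE) (fun x => pi_dvd_of_reducePi_eq_zero hE) (reducePi_pi hE)
      ((Algebra.ofId (Rp p) (Rpi p E)).comp Q) d
      (fun x y => by
        change _ = reducePi hE (algebraMap (Rp p) (Rpi p E) (Q x)) * _ +
          reducePi hE (algebraMap (Rp p) (Rpi p E) (Q y)) * _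
        rw [reducePi_algebraMap, reducePi_algebraMap, hQ, hQ, hd]) hdR 1 le_rfl
    let P' : A' →ₐ[Rpi p E] Rpi p E :=
      (Algebra.TensorProduct.lift (Algebra.ofId (Rpi p E) (Rpi p E)) P
        fun _ _ => Commute.all _ _).comp e.symm.toAlgHom
    have hP' : P' (e (1 ⊗ₜ a)) = P a := by
      change Algebra.TensorProduct.lift (Algebra.ofId (Rpi p E) (Rpi p E)) P
        (fun _ _ => Commute.all _ _) (e.symm (e (1 ⊗ₜ a))) = P a
      rw [e.symm_apply_apply, Algebra.TensorProduct.lift_tmul, map_one, one_mul]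
    refine not_injective_modP (frobPi_algebraMap p E) (pi_dvd_baseP_unif hE) e hS T hT rfl a P' ?_ hn
    rw [hP']
    obtain ⟨t, h1, h2⟩ := hP a
    rw [h1, pow_one]
    exact not_p_dvd_frobPi_sub_pow hE (Q a) t (h2 ▸ ha)

end NegativeSmooth

end ArithJet
end
noncomputable section
set_option linter.unusedSectionVars false
namespace ArithJet
open Prolongation

/-! ### Sections over affine opens and their base change -/

section Sections

variable {R : Type} [CommRing R] {Y : Scheme.{0}} (f : Y ⟶ Spec (CommRingCat.of R))

theorem structMap_eq (V : Y.Opens) : structMap f V =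
    ((Scheme.ΓSpecIso (CommRingCat.of R)).inv ≫ f.appLE ⊤ V le_top).hom := rfl

theorem sections_smooth [AlgebraicGeometry.Smooth f] (V : Y.affineOpens) :
    Algebra.Smooth R (Sections f V.1) := by
  have h : (f.appLE ⊤ V.1 le_top).hom.Smooth := f.smooth_appLE (isAffineOpen_top _) V.2 le_top
  have h' : (structMap f V.1).Smooth := by
    rw [structMap_eq, CommRingCat.hom_comp]
    exact (RingHom.Smooth.of_bijective
      (ConcreteCategory.bijective_of_isIso (Scheme.ΓSpecIso (CommRingCat.of R)).inv)).comp h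
  exact h'

end Sections

section Pullback

variable {p : ℕ} [Fact p.Prime] (E : ℤ_[p][X])
  {X : Scheme.{0}} (f : X ⟶ Spec (CommRingCat.of (Rp p)))

/-- Over affine opens a fibre product of schemes corresponds to a pushout of rings of sections; the
rest identifies global sections of the two spectra with the base rings. -/
theorem isPushout_sections (U : X.affineOpens) :
    IsPushout (CommRingCat.ofHom (algebraMap (Rp p) (Rpi p E)))
      (CommRingCat.ofHom (structMap f U.1))
      (CommRingCat.ofHom (structMap (structPi f E) (preimagePi f E U).1))
      ((projPi f E).app U.1) := by
  have h := (isIso_pushoutSection_iff (IsPullback.of_hasPullback f (specPi p E))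
    (US := ⊤) (UT := ⊤) (UX := U.1) le_top le_top (UY := (preimagePi f E U).1)
    (by simp [preimagePi])).mp
    (isIso_pushoutSection_of_isAffineOpen _ _ _ _ (isAffineOpen_top _) (isAffineOpen_top _) U.2)
  refine IsPushout.of_iso h.flip (Scheme.ΓSpecIso _) (Scheme.ΓSpecIso _) (Iso.refl _) (Iso.refl _)
    ?_ ?_ ?_ ?_
  · have h' : (specPi p E).appLE ⊤ ⊤ le_top = (specPi p E).appTop := by
      rw [Scheme.Hom.appTop, Scheme.Hom.app_eq_appLE]
      rfl
    rw [h', Scheme.ΓSpecIso_naturality]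
  · rw [structMap_eq, CommRingCat.ofHom_hom]
    simp
  · rw [structMap_eq, CommRingCat.ofHom_hom]
    simp
  · rw [Scheme.Hom.app_eq_appLE]
    exact (Category.comp_id _).trans (Category.id_comp _).symm

theorem exists_sectionsEquiv (U : X.affineOpens) :
    ∃ e : Rpi p E ⊗[Rp p] Sections f U.1 ≃ₐ[Rpi p E] Sections (structPi f E) (preimagePi f E U).1,
      ∀ a, e (1 ⊗ₜ a) = pullbackPi f E U a := by
  let : Algebra (Sections f U.1) (Sections (structPi f E) (preimagePi f E U).1) :=
    ((projPi f E).app U.1).hom.toAlgebra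
  let : Algebra (Rp p) (Sections (structPi f E) (preimagePi f E U).1) :=
    ((structMap (structPi f E) (preimagePi f E U).1).comp (algebraMap (Rp p) (Rpi p E))).toAlgebra
  have h := isPushout_sections E f U
  have : IsScalarTower (Rp p) (Rpi p E) (Sections (structPi f E) (preimagePi f E U).1) :=
    .of_algebraMap_eq fun _ => rfl
  have : IsScalarTower (Rp p) (Sections f U.1) (Sections (structPi f E) (preimagePi f E U).1) :=
    .of_algebraMap_eq fun r => congr($(h.w).hom r)
  have h' : Algebra.IsPushout (Rp p) (Rpi p E) (Sections f U.1)
      (Sections (structPi f E) (preimagePi f E U).1) := CommRingCat.isPushout_iff_isPushout.mp h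
  refine ⟨Algebra.IsPushout.equiv _ _ _ _, fun a => ?_⟩
  rw [Algebra.IsPushout.equiv_tmul, map_one, one_mul]
  rfl

theorem preimagePi_mono {U W : X.affineOpens} (h : U ≤ W) : preimagePi f E U ≤ preimagePi f E W :=
  fun _ hx => h hx

theorem pullbackPi_res {U W : X.affineOpens} (h : U ≤ W) (a : Sections f W.1) :
    Sections.res (structPi f E) (preimagePi_mono E f h) (pullbackPi f E W a) =
      pullbackPi f E U (Sections.res f h a) :=
  congr($((projPi f E).naturality (homOfLE h).op).hom a).symm

end Pullback

end ArithJet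
end
noncomputable section
set_option linter.unusedSectionVars false
namespace ArithJet
open Prolongation

/-! ### The canonical morphism over an affine open -/

section AffineCanonical

variable {p : ℕ} [Fact p.Prime] {E : ℤ_[p][X]} (hE : IsRamifiedEisenstein p E)
  {X : Scheme.{0}} (f : X ⟶ Spec (CommRingCat.of (Rp p))) [AlgebraicGeometry.Smooth f]

theorem affineJet_flat (U : X.affineOpens) (n : ℕ) :
    Module.Flat (Rp p) ((affineJet f (baseP p) U.1).obj n) :=
  have := sections_smooth f U
  jet_completion_flat p (Sections f U.1) n

theorem exists_isCanonicalOn (U : X.affineOpens)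
    (hU : ∀ n, Module.Flat (Rp p) ((affineJet f (baseP p) U.1).obj n)) :
    ∃ TU, IsCanonicalOn hE f U hU TU := by
  have := free_Rpi hE
  have := finite_Rpi hE
  obtain ⟨e, he⟩ := exists_sectionsEquiv E f U
  refine ⟨canonHom (S := affineJet f (baseP p) U.1) (frobPi_algebraMap p E) (pi_dvd_baseP_unif hE)
    hU (fun n => compl_isAdicComplete) e
    ((complOf (Rp p) p _).comp (toJetₐ (baseP p) (Sections f U.1))), fun a => ?_⟩
  rw [← he a]
  exact canonHom_complOf (S := affineJet f (baseP p) U.1) (frobPi_algebraMap p E)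
    (pi_dvd_baseP_unif hE) hU (fun n => compl_isAdicComplete) e _ a

variable {hE f}

theorem IsCanonicalOn.unique {U : X.affineOpens}
    {hU : ∀ n, Module.Flat (Rp p) ((affineJet f (baseP p) U.1).obj n)} {T₁ T₂}
    (h₁ : IsCanonicalOn hE f U hU T₁) (h₂ : IsCanonicalOn hE f U hU T₂) : T₁ = T₂ := by
  have := free_Rpi hE
  have := finite_Rpi hE
  obtain ⟨e, he⟩ := exists_sectionsEquiv E f U
  refine canonHom_unique e (fun n => (baseChange_isAdicComplete (S := affineJet f (baseP p) U.1)
    (frobPi_algebraMap p E) (pi_dvd_baseP_unif hE) hU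
    (fun n => compl_isAdicComplete) n).toIsHausdorff) fun a => ?_
  rw [he]
  exact (h₁ a).trans (h₂ a).symm

theorem IsCanonicalOn.injective {U : X.affineOpens}
    {hU : ∀ n, Module.Flat (Rp p) ((affineJet f (baseP p) U.1).obj n)} {T}
    (h : IsCanonicalOn hE f U hU T) (n : ℕ) : Function.Injective (T.hom n) := by
  have := free_Rpi hE
  have := finite_Rpi hE
  have := sections_smooth f U
  obtain ⟨e, he⟩ := exists_sectionsEquiv E f U
  refine canonical_injective (D := baseP p) (frobPi_algebraMap p E) (pi_dvd_baseP_unif hE) rfl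
    (exists_p_dvd_pi_pow hE) (fun B _ _ _ => jet_completion_flat p B) e T (fun a => ?_) n
  rw [he]
  exact h a

theorem IsCanonicalOn.naturality {U W : X.affineOpens} (hUW : U ≤ W)
    {hU : ∀ n, Module.Flat (Rp p) ((affineJet f (baseP p) U.1).obj n)}
    {hW : ∀ n, Module.Flat (Rp p) ((affineJet f (baseP p) W.1).obj n)} {TU TW}
    (h : IsCanonicalOn hE f U hU TU) (h' : IsCanonicalOn hE f W hW TW) (n : ℕ)
    (x : (affineJet (structPi f E) (basePi p hE) (preimagePi f E W).1).obj n) :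
    tensorPiMap hE hW hU (affineJetRes f (baseP p) hUW) n (TW.hom n x) =
      TU.hom n ((affineJetRes (structPi f E) (basePi p hE) (preimagePi_mono E f hUW)).hom n x) := by
  have := free_Rpi hE
  have := finite_Rpi hE
  have := sections_smooth f U
  have := sections_smooth f W
  obtain ⟨e, he⟩ := exists_sectionsEquiv E f W
  have key := canonical_naturality (D := baseP p) (D' := basePi p hE) (frobPi_algebraMap p E)
    (pi_dvd_baseP_unif hE) (fun B _ _ _ => jet_completion_flat p B) (Sections.res f hUW) e
    (pullbackPi f E U) (Sections.res (structPi f E) (preimagePi_mono E f hUW))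
    (fun a => by rw [he, pullbackPi_res]) TW (fun a => by rw [he]; exact h' a) TU h
  exact (DFunLike.congr_fun (congrFun (congrArg Hom.hom key) n) x).symm

theorem IsCanonicalOn.not_surjective_and_not_injective_modP {U : X.affineOpens}
    {hU : ∀ n, Module.Flat (Rp p) ((affineJet f (baseP p) U.1).obj n)} {T}
    (h : IsCanonicalOn hE f U hU T)
    (hdim : 0 < ringKrullDim (Γ(X, U.1) ⧸ Ideal.span {(p : Γ(X, U.1))})) {n : ℕ} (hn : 1 ≤ n) :
    ¬ Function.Surjective (T.hom n) ∧ ¬ Function.Injective (modP p (T.hom n).toRingHom) := by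
  have := sections_smooth f U
  obtain ⟨e, he⟩ := exists_sectionsEquiv E f U
  refine canonical_not_surjective_and_not_injective_modP hE (A := Sections f U.1) hdim e hU T
    (fun a => ?_) hn
  rw [he]
  exact h a

end AffineCanonical

end ArithJet
end
noncomputable section
set_option linter.unusedSectionVars false
namespace ArithJet
open Prolongation

/-! ### Base change of limits along finite free ring extensions -/

section Coefficient

variable {R R' : Type} [CommRing R] [CommRing R'] [Algebra R R'] {ι : Type} [Fintype ι]
  (b : Module.Basis ι R R') {M N : Type} [CommRing M] [Algebra R M] [CommRing N] [Algebra R N]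

/-- The coefficients of an element of `R' ⊗ M` with respect to a basis of `R'`. -/
def tensorCoeff (M : Type) [CommRing M] [Algebra R M] (i : ι) : R' ⊗[R] M →ₗ[R] M :=
  (TensorProduct.lid R M).toLinearMap ∘ₗ (b.coord i).rTensor M

theorem tensorCoeff_tmul (i : ι) (r : R') (m : M) :
    tensorCoeff b M i (r ⊗ₜ m) = b.coord i r • m := rfl

theorem tensorCoeff_map (g : M →ₐ[R] N) (i : ι) (x : R' ⊗[R] M) :
    tensorCoeff b N i (Algebra.TensorProduct.map (AlgHom.id R' R') g x) =
      g (tensorCoeff b M i x) := by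
  induction x with
  | zero => simp only [map_zero]
  | add x y hx hy => simp only [map_add, hx, hy]
  | tmul r m =>
    rw [Algebra.TensorProduct.map_tmul, tensorCoeff_tmul, tensorCoeff_tmul, map_smul]
    rfl

theorem sum_tmul_tensorCoeff (x : R' ⊗[R] M) : ∑ i, b i ⊗ₜ[R] tensorCoeff b M i x = x := by
  induction x with
  | zero => simp only [map_zero, tmul_zero, Finset.sum_const_zero]
  | add x y hx hy => simp only [map_add, tmul_add, Finset.sum_add_distrib, hx, hy]
  | tmul r m =>
    simp only [tensorCoeff_tmul, ← smul_tmul, ← sum_tmul, Module.Basis.coord_apply]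
    rw [b.sum_repr]

end Coefficient

section Limit

variable {p : ℕ} [Fact p.Prime] {R R' : Type} [CommRing R] [CommRing R'] [Algebra R R']
  [Module.Free R R'] [Module.Finite R R'] {D : FrobeniusBase p R} {D' : FrobeniusBase p R'}
  {J : Type} [Preorder J] {S : J → Prolongation D} {res : ∀ i j : J, i ≤ j → Hom (S j) (S i)}

/-- Coefficients with respect to a basis of `R'` commute with the projections, and an element of the
limit is determined by its components. -/
theorem tensor_limit_ext {n : ℕ} {x y : R' ⊗[R] (limit S res).obj n}
    (h : ∀ j, Algebra.TensorProduct.map (AlgHom.id R' R') ((limitProj S res j).hom n) x =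
      Algebra.TensorProduct.map (AlgHom.id R' R') ((limitProj S res j).hom n) y) : x = y := by
  let b := Module.Free.chooseBasis R R'
  have hc : ∀ i, tensorCoeff b _ i x = tensorCoeff b _ i y := fun i =>
    Subtype.ext (funext fun j => by
      have hj := congrArg (tensorCoeff b _ i) (h j)
      rw [tensorCoeff_map, tensorCoeff_map] at hj
      exact hj)
  rw [← sum_tmul_tensorCoeff b x, ← sum_tmul_tensorCoeff b y]
  exact Finset.sum_congr rfl fun i _ => by rw [hc]

/-- The coefficients of a compatible family are compatible families; finiteness of the basis allows
them to be reassembled into one tensor. -/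
theorem exists_tensor_limit {n : ℕ} (y : ∀ j, R' ⊗[R] (S j).obj n)
    (hy : ∀ i j (h : i ≤ j),
      Algebra.TensorProduct.map (AlgHom.id R' R') ((res i j h).hom n) (y j) = y i) :
    ∃ x : R' ⊗[R] (limit S res).obj n, ∀ j,
      Algebra.TensorProduct.map (AlgHom.id R' R') ((limitProj S res j).hom n) x = y j := by
  let b := Module.Free.chooseBasis R R'
  let c : ∀ i, (limit S res).obj n := fun i => ⟨fun j => tensorCoeff b _ i (y j), fun k j h => by
    rw [← tensorCoeff_map, hy k j h]⟩
  refine ⟨∑ i, b i ⊗ₜ c i, fun j => ?_⟩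
  rw [map_sum, ← sum_tmul_tensorCoeff b (y j)]
  rfl

variable (hφ : ∀ r, D'.frob (algebraMap R R' r) = algebraMap R R' (D.frob r))
  (hu : D'.unif ∣ algebraMap R R' D.unif) (hS : ∀ j n, Module.Flat R ((S j).obj n))
  (hL : ∀ n, Module.Flat R ((limit S res).obj n))

theorem baseChange_limit_ext {n : ℕ} {x y : (baseChange D' hφ hu (limit S res) hL).obj n}
    (h : ∀ j, (baseChangeMap hφ hu hL (hS j) (limitProj S res j)).hom n x =
      (baseChangeMap hφ hu hL (hS j) (limitProj S res j)).hom n y) : x = y :=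
  tensor_limit_ext h

/-- Compatible morphisms to the base changes of the terms of a limit define a morphism to the base
change of the limit. -/
theorem exists_hom_baseChange_limit {N : Prolongation D'}
    (g : ∀ j, Hom N (baseChange D' hφ hu (S j) (hS j)))
    (hg : ∀ i j (h : i ≤ j) n x,
      (baseChangeMap hφ hu (hS j) (hS i) (res i j h)).hom n ((g j).hom n x) = (g i).hom n x) :
    ∃ T : Hom N (baseChange D' hφ hu (limit S res) hL), ∀ j n x,
      (baseChangeMap hφ hu hL (hS j) (limitProj S res j)).hom n (T.hom n x) = (g j).hom n x := by
  have key : ∀ n (x : N.obj n), ∃ y : (baseChange D' hφ hu (limit S res) hL).obj n, ∀ j,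
      (baseChangeMap hφ hu hL (hS j) (limitProj S res j)).hom n y = (g j).hom n x := fun n x =>
    exists_tensor_limit (fun j => (g j).hom n x) fun i j h => hg i j h n x
  choose t ht using key
  -- The projections are jointly injective, so each axiom of a morphism can be checked after
  -- projecting, where it holds for `g j`.
  have ext := fun n x y => baseChange_limit_ext (n := n) (x := x) (y := y) hφ hu hS hL
  refine ⟨⟨fun n => ⟨⟨⟨⟨t n, ?_⟩, ?_⟩, ?_, ?_⟩, ?_⟩, ?_, ?_⟩, fun j n x => ht n x j⟩
  · exact ext n _ _ fun j => by rw [ht, map_one, map_one]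
  · exact fun x y => ext n _ _ fun j => by rw [map_mul, ht, ht, ht, map_mul]
  · exact ext n _ _ fun j => by
      change (baseChangeMap hφ hu hL (hS j) (limitProj S res j)).hom n (t n 0) = _
      rw [ht, map_zero, map_zero]
  · exact fun x y => ext n _ _ fun j => by
      change (baseChangeMap hφ hu hL (hS j) (limitProj S res j)).hom n (t n (x + y)) =
        (baseChangeMap hφ hu hL (hS j) (limitProj S res j)).hom n (t n x + t n y)
      rw [map_add, ht, ht, ht, map_add]
  · exact fun r => ext n _ _ fun j => by
      change (baseChangeMap hφ hu hL (hS j) (limitProj S res j)).hom n (t n _) = _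
      rw [ht, AlgHom.commutes, AlgHom.commutes]
  · exact fun n x => ext (n + 1) _ _ fun j => by
      change (baseChangeMap hφ hu hL (hS j) (limitProj S res j)).hom (n + 1) (t (n + 1) _) =
        (baseChangeMap hφ hu hL (hS j) (limitProj S res j)).hom (n + 1)
          ((baseChange D' hφ hu (limit S res) hL).incl n (t n x))
      rw [ht, Hom.hom_incl, Hom.hom_incl, ht]
  · exact fun n x => ext (n + 1) _ _ fun j => by
      change (baseChangeMap hφ hu hL (hS j) (limitProj S res j)).hom (n + 1) (t (n + 1) _) =
        (baseChangeMap hφ hu hL (hS j) (limitProj S res j)).hom (n + 1)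
          ((baseChange D' hφ hu (limit S res) hL).δ n (t n x))
      rw [ht, Hom.hom_δ, Hom.hom_δ, ht]

/-- A compatible family is determined by its component at a greatest index, and any element there
extends by restriction. For affine schemes this recovers the jets of the ring of functions. -/
theorem limitProj_bijective (j : J) (hj : ∀ i, i ≤ j)
    (hres : ∀ i k (h : i ≤ k) n x,
      (res i k h).hom n ((res k j (hj k)).hom n x) = (res i j (hj i)).hom n x)
    (hid : ∀ n x, (res j j (hj j)).hom n x = x) (n : ℕ) :
    Function.Bijective ((limitProj S res j).hom n) := by
  refine ⟨fun x y hxy => Subtype.ext (funext fun i => ?_), fun x =>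
    ⟨⟨fun i => (res i j (hj i)).hom n x, fun i k h => hres i k h n x⟩, hid n x⟩⟩
  rw [← x.2 i j (hj i), ← y.2 i j (hj i)]
  exact congrArg _ hxy

end Limit

end ArithJet
end
noncomputable section
set_option linter.unusedSectionVars false
namespace ArithJet
open Prolongation

/-! ### Global functions on jet spaces -/

section Restriction

variable {p : ℕ} [Fact p.Prime] {R : Type} [CommRing R] (D : FrobeniusBase p R)
  {Y : Scheme.{0}} (f : Y ⟶ Spec (CommRingCat.of R))

theorem affineJetRes_toAffineJet {V W : Y.Opens} (h : V ≤ W) (a : Sections f W) :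
    (affineJetRes f D h).hom 0 (toAffineJet f D W a) = toAffineJet f D V (Sections.res f h a) := by
  refine (complMap_complOf (R := R) _ (toJet D (Sections f W) a)).trans ?_
  rw [jetMap_toJet]
  rfl

theorem affineJetHom_ext {V W : Y.Opens} {T₁ T₂ : Hom (affineJet f D W) (affineJet f D V)}
    (h : ∀ a, T₁.hom 0 (toAffineJet f D W a) = T₂.hom 0 (toAffineJet f D W a)) : T₁ = T₂ :=
  hom_ext_of_complete (N := affineJet f D V)
    (fun n => (compl_isAdicComplete (A := (jet D (Sections f V)).obj n)).toIsHausdorff) h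

theorem affineJetRes_affineJetRes {V W Z : Y.Opens} (h : V ≤ W) (h' : W ≤ Z) (n : ℕ)
    (x : (affineJet f D Z).obj n) :
    (affineJetRes f D h).hom n ((affineJetRes f D h').hom n x) =
      (affineJetRes f D (h.trans h')).hom n x := by
  have key : (affineJetRes f D h).comp (affineJetRes f D h') = affineJetRes f D (h.trans h') :=
    affineJetHom_ext D f fun a => by
      change (affineJetRes f D h).hom 0 ((affineJetRes f D h').hom 0 _) = _
      rw [affineJetRes_toAffineJet, affineJetRes_toAffineJet, affineJetRes_toAffineJet]
      refine congrArg _ ?_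
      exact congr($((Y.presheaf.map_comp (homOfLE h').op (homOfLE h).op).symm).hom a)
  exact DFunLike.congr_fun (congrFun (congrArg Hom.hom key) n) x

theorem affineJetRes_refl {V : Y.Opens} (n : ℕ) (x : (affineJet f D V).obj n) :
    (affineJetRes f D (le_refl V)).hom n x = x := by
  have key : affineJetRes f D (le_refl V) = ⟨fun n => AlgHom.id R _, fun _ _ => rfl,
      fun _ _ => rfl⟩ :=
    affineJetHom_ext D f fun a => by
      rw [affineJetRes_toAffineJet]
      refine congrArg _ ?_
      exact congr($(Y.presheaf.map_id (Opposite.op V)).hom a)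
  exact DFunLike.congr_fun (congrFun (congrArg Hom.hom key) n) x

theorem globalJetRes_res {V W : Y.affineOpens} (h : V ≤ W) (n : ℕ) (x : (globalJet f D).obj n) :
    (affineJetRes f D h).hom n ((globalJetRes f D W).hom n x) = (globalJetRes f D V).hom n x :=
  x.2 V W h

theorem globalJetRes_bijective (V : Y.affineOpens) (hV : ∀ W, W ≤ V) (n : ℕ) :
    Function.Bijective ((globalJetRes f D V).hom n) :=
  limitProj_bijective V hV (fun _ k h n x => affineJetRes_affineJetRes D f h (hV k) n x)
    (affineJetRes_refl D f) n

/-- A global function on a jet space vanishes if it vanishes on the jet spaces of affine opens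
covering `Y`. -/
theorem globalJet_eq_zero (hD : ∃ e, (p : R) ∣ D.unif ^ e) {ι : Type} (U : ι → Y.affineOpens)
    (hU : ∀ y : Y, ∃ i, y ∈ (U i).1) (n : ℕ) (x : (globalJet f D).obj n)
    (hx : ∀ i, (globalJetRes f D (U i)).hom n x = 0) : x = 0 := by
  refine Subtype.ext (funext fun V => ?_)
  -- `V` itself need not lie in any `U i`, but it is covered by basic opens that do; the detection
  -- of zero on such a cover then applies.
  have key : ∀ v : V.1, ∃ (g : Γ(Y, V.1)) (i : ι), Y.basicOpen g ≤ (U i).1 ∧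
      (v : Y) ∈ Y.basicOpen g := fun v => by
    obtain ⟨i, hi⟩ := hU v
    obtain ⟨g, h1, h2⟩ := V.2.exists_basicOpen_le (V := (U i).1) ⟨v, hi⟩ v.2
    exact ⟨g, i, h1, h2⟩
  choose g i hg hv using key
  refine eq_zero_of_forall_completionMap_eq_zero (A := Sections f V.1) hD g ?_
    (fun v => Sections f (Y.basicOpen (g v))) (fun v => Sections.res f (Y.basicOpen_le (g v)))
    (fun v => V.2.isLocalization_basicOpen (g v)) _ fun v => ?_
  · refine V.2.self_le_iSup_basicOpen_iff.mp fun v hvV => ?_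
    rw [TopologicalSpace.Opens.mem_iSup]
    exact ⟨⟨g ⟨v, hvV⟩, ⟨v, hvV⟩, rfl⟩, hv ⟨v, hvV⟩⟩
  · let B : Y.affineOpens := ⟨Y.basicOpen (g v), V.2.basicOpen (g v)⟩
    refine (globalJetRes_res D f (V := B) (W := V) (Y.basicOpen_le (g v)) n x).trans ?_
    rw [← globalJetRes_res D f (V := B) (W := U (i v)) (hg v) n x, hx, map_zero]
    rfl

end Restriction

theorem modP_injective_of_comm (p : ℕ) {A B A' B' : Type} [CommRing A] [CommRing B] [CommRing A']
    [CommRing B'] {g : A →+* B} {g' : A' →+* B'} {ρ : A →+* A'} {β : B →+* B'}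
    (hρ : Function.Surjective ρ) (hβ : Function.Bijective β) (h : ∀ x, β (g x) = g' (ρ x))
    (hg : Function.Injective (modP p g)) : Function.Injective (modP p g') := by
  rw [injective_iff_map_eq_zero] at hg ⊢
  intro y hy
  obtain ⟨y, rfl⟩ := Ideal.Quotient.mk_surjective y
  obtain ⟨x, rfl⟩ := hρ y
  replace hy : Ideal.Quotient.mk _ (g' (ρ x)) = 0 := hy
  rw [Ideal.Quotient.eq_zero_iff_dvd] at hy
  obtain ⟨b', hb'⟩ := hy
  obtain ⟨b, rfl⟩ := hβ.2 b'
  rw [← h, ← map_natCast β, ← map_mul] at hb'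
  have h1 := hg (Ideal.Quotient.mk _ x) ((Ideal.Quotient.eq_zero_iff_dvd _ _).mpr ⟨b, hβ.1 hb'⟩)
  obtain ⟨z, hz⟩ := (Ideal.Quotient.eq_zero_iff_dvd _ _).mp h1
  exact (Ideal.Quotient.eq_zero_iff_dvd _ _).mpr ⟨ρ z, by rw [hz, map_mul, map_natCast]⟩

/-! ### The canonical morphism for a smooth scheme -/

section GlobalCanonical

variable {p : ℕ} [Fact p.Prime] {E : ℤ_[p][X]} (hE : IsRamifiedEisenstein p E)
  {X : Scheme.{0}} (f : X ⟶ Spec (CommRingCat.of (Rp p)))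

theorem tensorPiMap_bijective {S T : Prolongation (baseP p)}
    (hS : ∀ n, Module.Flat (Rp p) (S.obj n)) (hT : ∀ n, Module.Flat (Rp p) (T.obj n))
    (g : Hom S T) (n : ℕ) (hg : Function.Bijective (g.hom n)) :
    Function.Bijective (tensorPiMap hE hS hT g n) :=
  (Algebra.TensorProduct.congr (AlgEquiv.refl : Rpi p E ≃ₐ[Rpi p E] Rpi p E)
    (AlgEquiv.ofBijective (g.hom n) hg)).bijective

variable [AlgebraicGeometry.Smooth f]

/-- Absence of `p`-torsion passes to compatible families componentwise, whereas flatness itself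
would not obviously do so. -/
theorem globalJet_flat (n : ℕ) : Module.Flat (Rp p) ((globalJet f (baseP p)).obj n) := by
  refine flat_of_torsionFree p fun x hx => Subtype.ext (funext fun V => ?_)
  have := affineJet_flat f V n
  refine torsionFree_of_flat (R := Rp p) (baseP p).unif_mem _ ?_
  have h := congrArg ((globalJetRes f (baseP p) V).hom n) hx
  rw [map_mul, map_natCast, map_zero] at h
  exact h

/-- The local canonical morphisms are compatible by naturality and therefore glue, `R_π` being
finite free over `R_p`. -/
theorem exists_isCanonical (hX : ∀ n, Module.Flat (Rp p) ((globalJet f (baseP p)).obj n)) :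
    ∃ T, IsCanonical hE f hX T := by
  have := free_Rpi hE
  have := finite_Rpi hE
  choose TU hTU using fun U => exists_isCanonicalOn hE f U (affineJet_flat f U)
  obtain ⟨T, hT⟩ := exists_hom_baseChange_limit (D' := basePi p hE) (frobPi_algebraMap p E)
    (pi_dvd_baseP_unif hE) (affineJet_flat f) hX
    (N := globalJet (structPi f E) (basePi p hE))
    (fun U => (TU U).comp (globalJetRes (structPi f E) (basePi p hE) (preimagePi f E U)))
    (fun U W h n x => ((hTU U).naturality h (hTU W) n _).trans
      (congrArg _ (globalJetRes_res (basePi p hE) (structPi f E) (preimagePi_mono E f h) n x)))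
  exact ⟨T, fun U => ⟨affineJet_flat f U, TU U, hTU U, fun n x => hT U n x⟩⟩

variable {hE f} {hX : ∀ n, Module.Flat (Rp p) ((globalJet f (baseP p)).obj n)}

theorem IsCanonical.unique {T₁ T₂} (h₁ : IsCanonical hE f hX T₁) (h₂ : IsCanonical hE f hX T₂) :
    T₁ = T₂ := by
  have := free_Rpi hE
  have := finite_Rpi hE
  refine Hom.ext (funext fun n => AlgHom.ext fun x => ?_)
  refine tensor_limit_ext (R' := Rpi p E) fun U => ?_
  obtain ⟨hU, TU, hTU, h⟩ := h₁ U
  obtain ⟨hU', TU', hTU', h'⟩ := h₂ U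
  obtain rfl := hTU.unique hTU'
  exact (h n x).trans (h' n x).symm

/-- The opens `U_{R_π}` do not exhaust the affine opens of `X_{R_π}`, but they cover it, and a
function on the jet spaces vanishing over a cover vanishes. -/
theorem IsCanonical.injective {T} (h : IsCanonical hE f hX T) (n : ℕ) :
    Function.Injective (T.hom n) := by
  rw [injective_iff_map_eq_zero]
  intro x hx
  refine globalJet_eq_zero (basePi p hE) (structPi f E) (exists_p_dvd_pi_pow hE) (preimagePi f E)
    (fun y => ?_) n x fun U => ?_
  · obtain ⟨U, hU, hy, -⟩ := exists_isAffineOpen_mem_and_subset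
      (TopologicalSpace.Opens.mem_top (projPi f E y))
    exact ⟨⟨U, hU⟩, hy⟩
  · obtain ⟨hU, TU, hTU, hT⟩ := h U
    refine hTU.injective n ?_
    rw [← hT, hx, map_zero, map_zero]

theorem IsCanonical.not_surjective_and_not_injective_modP [IsAffine X] {T}
    (h : IsCanonical hE f hX T)
    (hdim : 0 < ringKrullDim (Γ(X, ⊤) ⧸ Ideal.span {(p : Γ(X, ⊤))})) {n : ℕ} (hn : 1 ≤ n) :
    ¬ Function.Surjective (T.hom n) ∧ ¬ Function.Injective (modP p (T.hom n).toRingHom) := by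
  let U : X.affineOpens := ⟨⊤, isAffineOpen_top X⟩
  obtain ⟨hU, TU, hTU, hT⟩ := h U
  have hβ := tensorPiMap_bijective hE hX hU (globalJetRes f (baseP p) U) n
    (globalJetRes_bijective (baseP p) f U (fun W => (le_top : W.1 ≤ ⊤)) n)
  -- The preimage of the whole of `X` is the whole of `X_{R_π}`, so on both sides global functions
  -- are those of a single affine open.
  have hρ := globalJetRes_bijective (basePi p hE) (structPi f E) (preimagePi f E U)
    (fun _ _ _ => trivial) n
  obtain ⟨h1, h2⟩ := hTU.not_surjective_and_not_injective_modP (n := n) hdim hn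
  refine ⟨fun hs => h1 fun y => ?_, fun hi => h2 ?_⟩
  · obtain ⟨z, rfl⟩ := hβ.2 y
    obtain ⟨x, rfl⟩ := hs z
    exact ⟨_, (hT n x).symm⟩
  · exact modP_injective_of_comm p (ρ := ((globalJetRes (structPi f E) (basePi p hE)
      (preimagePi f E U)).hom n).toRingHom)
      (β := (tensorPiMap hE hX hU (globalJetRes f (baseP p) U) n).toRingHom) hρ.2 hβ (hT n) hi

end GlobalCanonical

end ArithJet
end


theorem proposition2p2 (p : ℕ) [Fact p.Prime]
    (E : ℤ_[p][X]) (hE : IsRamifiedEisenstein p E)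
    (X : Scheme.{0}) (f : X ⟶ Spec (CommRingCat.of (Rp p))) [AlgebraicGeometry.Smooth f] :
    -- existence and uniqueness of the canonical morphism for each affine open of `X`
    (∀ U : X.affineOpens,
      ∃ hU : ∀ n, Module.Flat (Rp p) ((affineJet f (baseP p) U.1).obj n),
        ∃! TU : Prolongation.Hom
            (affineJet (structPi f E) (basePi p hE) (preimagePi f E U).1)
            (tensorPi p hE (affineJet f (baseP p) U.1) hU),
          IsCanonicalOn hE f U hU TU) ∧
    -- existence and uniqueness of the canonical morphism for `X`
    ∃ hX : ∀ n, Module.Flat (Rp p) ((globalJet f (baseP p)).obj n),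
      ∃ T : Prolongation.Hom
          (globalJet (structPi f E) (basePi p hE))
          (tensorPi p hE (globalJet f (baseP p)) hX),
        IsCanonical hE f hX T ∧
        (∀ T', IsCanonical hE f hX T' → T' = T) ∧
        -- it is injective
        (∀ n, Function.Injective (T.hom n)) ∧
        -- for affine `X` with special fibre of positive dimension, it is not surjective and
        -- its reduction modulo `p` is not injective, in orders `n ≥ 1`
        (IsAffine X →
          0 < ringKrullDim (Γ(X, ⊤) ⧸ Ideal.span {(p : Γ(X, ⊤))}) →
          ∀ n, 1 ≤ n → ¬ Function.Surjective (T.hom n) ∧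
            ¬ Function.Injective (modP p (T.hom n).toRingHom)) := by
  refine ⟨fun U => ⟨affineJet_flat f U, ?_⟩, globalJet_flat f, ?_⟩
  · obtain ⟨TU, hTU⟩ := exists_isCanonicalOn hE f U (affineJet_flat f U)
    exact ⟨TU, hTU, fun _ h => h.unique hTU⟩
  · obtain ⟨T, hT⟩ := exists_isCanonical hE f (globalJet_flat f)
    exact ⟨T, hT, fun _ h => h.unique hT, hT.injective, fun _ hdim _ hn =>
      hT.not_surjective_and_not_injective_modP hdim hn⟩
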